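/- Let $\mathbb R^2_+=\{x=(x_1,x_2): x_2>0\}$, let $E(x)=\frac1{2\pi}\ln|x|$, and let $\Gamma(x,t)=\frac1{4\pi t}e^{-|x|^2/(4t)}$ for $t>0$ ($\Gamma=0$ for $t\le0$) be the fundamental solutions of the Laplace equation ($\Delta E=\delta$) and of the heat equation $\partial_t-\Delta$. For boundary data $g=(g_1,g_2)$ on $\partial\mathbb R^2_+\times(0,\infty)=\mathbb R\times(0,\infty)$ let the Stokes velocity $u=(u^1,u^2)$ be $$u^i(x,t)=\sum_{j=1}^2\int_0^t\!\!\int_{\mathbb R}\big(-2\delta_{ij}D_{x_2}\Gamma+4L_{ij}\big)(x_1-y,x_2,t-s)\,g_j(y,s)\,dy\,ds+2\int_{\mathbb R}D_{x_i}E(x_1-y,x_2)\,g_2(y,t)\,dy,$$ $$L_{ij}(x,t)=D_{x_j}\int_0^{x_2}\!\!\int_{\mathbb R}D_{z_2}\Gamma(z,t)\,D_{x_i}E(x-z)\,dz_1\,dz_2 .$$ Take $g_1=0$ and $g_2(y,s)=\chi_{(-1,1)}(y)\,\chi_{(1/2,1)}(s)$. Then the following hold. 1. $g\in L^p(\mathbb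 R\times(0,\infty))$ for every $1\le p\le\infty$. 2. $u$ is a very weak solution of the nonstationary Stokes system $u_t-\Delta u+\nabla p=0$, $\operatorname{div}u=0$ in $\mathbb R^2_+\times(0,\infty)$ with $u|_{t=0}=0$ and $u|_{x_2=0}=g$. That is, $u\in L^1_{loc}(\overline{\mathbb R^2_+}\times[0,\infty))$, $$\int_0^\infty\!\!\int_{\mathbb R^2_+}u\cdot(\varphi_t+\Delta\varphi)\,dx\,dt+\int_0^\infty\!\!\int_{\mathbb R}g\cdot\partial_{x_2}\varphi(y,0,t)\,dy\,dt=0$$ for all $\varphi\in C_c^\infty(\overline{\mathbb R^2_+}\times[0,\infty);\mathbb R^2)$ with $\operatorname{div}\varphi=0$ and $\varphi|_{x_2=0}=0$, and $$\int_0^\infty\!\!\int_{\mathbb R^2_+}u\cdot\nabla\psi\,dx\,dt=-\int_0^\infty\!\!\int_{\mathbb R}g_2(y,t)\,\psi(y,0,t)\,dy\,dt$$ for all $\psi\in C_c^\infty(\overline{\mathbb R^2_+}\times[0,\infty))$. 3. There are constants $c>0$ and $M$ such that $|u^1(1,x_2,1+x_2^2)-c\ln x_2|\le M$ for all $0<x_2<\frac12$.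 In particular $u^1(1,x_2,1+x_2^2)\to-\infty$ at a logarithmic rate as $x_2\to0^+$. 4. For every $T>1$, $\|u^1\|_{L^\infty(\mathbb R^2_+\times(0,T))}=\infty$. Hence bounded boundary data do not give a bounded velocity without extra regularity of the normal component of the data. -/

import Mathlib

open Set Filter Topology MeasureTheory
open scoped ContDiff ENNReal

noncomputable section

namespace HalfPlaneStokes

/-- The spatial partial derivative `D_{x_i} f` of a function on the plane: index `0` is the
tangential variable `x₁`, index `1` is the normal variable `x₂`. -/
def spaceDeriv (i : Fin 2) (f : ℝ → ℝ → ℝ) (x₁ x₂ : ℝ) : ℝ :=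
  if i = 0 then deriv (fun a => f a x₂) x₁ else deriv (fun b => f x₁ b) x₂

/-- The fundamental solution of the Laplace equation in the plane, `ΔE = δ`. -/
def laplaceKernel (x₁ x₂ : ℝ) : ℝ :=
  (2 * Real.pi)⁻¹ * Real.log (Real.sqrt (x₁ ^ 2 + x₂ ^ 2))

/-- The fundamental solution of the heat equation `∂ₜ - Δ` in the plane. -/
def heatKernel (t x₁ x₂ : ℝ) : ℝ :=
  if 0 < t then (4 * Real.pi * t)⁻¹ * Real.exp (-(x₁ ^ 2 + x₂ ^ 2) / (4 * t)) else 0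

/-- `L_{ij}(x,t) = D_{x_j} ∫₀^{x₂} ∫_ℝ D_{z₂}Γ(z,t) D_{x_i}E(x-z) dz₁ dz₂`. -/
def compositeKernel (i j : Fin 2) (t x₁ x₂ : ℝ) : ℝ :=
  spaceDeriv j
    (fun a b => ∫ z₂ in (0 : ℝ)..b, ∫ z₁ : ℝ,
      spaceDeriv 1 (heatKernel t) z₁ z₂ * spaceDeriv i laplaceKernel (a - z₁) (b - z₂))
    x₁ x₂

/-- The part `-2 δ_{ij} D_{x₂}Γ + 4 L_{ij}` of the Poisson kernel `K_{ij}` of the nonstationary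
Stokes system in the half plane that is a function of time. The remaining part is
`2 δ_{j2} δ(t) D_{x_i}E`, with the Dirac mass `δ(t)` in time. -/
def regularPoissonKernel (i j : Fin 2) (t x₁ x₂ : ℝ) : ℝ :=
  (if i = j then -2 * spaceDeriv 1 (heatKernel t) x₁ x₂ else 0) + 4 * compositeKernel i j t x₁ x₂

/-- The `i`-th component at `(x₁, x₂, t)` of the Stokes velocity in the half plane with boundary
data `g` and zero initial data: the space-time convolution of the Poisson kernel with `g`.
The Dirac mass in time contributes the last integral. -/
def velocity (g : Fin 2 → ℝ → ℝ → ℝ) (i : Fin 2) (x₁ x₂ t : ℝ) : ℝ :=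
  (∑ j : Fin 2, ∫ s in (0 : ℝ)..t, ∫ y : ℝ,
      regularPoissonKernel i j (t - s) (x₁ - y) x₂ * g j y s)
    + 2 * ∫ y : ℝ, spaceDeriv i laplaceKernel (x₁ - y) x₂ * g 1 y t

/-- Space-time directions: a space-time point is `q = (x₁, x₂, t)`. -/
def dir (i : Fin 2) : ℝ × ℝ × ℝ := if i = 0 then (1, 0, 0) else (0, 1, 0)

/-- `∂φ/∂x_i` for a function of `(x₁, x₂, t)`. -/
def pd (i : Fin 2) (φ : ℝ × ℝ × ℝ → ℝ) (q : ℝ × ℝ × ℝ) : ℝ := fderiv ℝ φ q (dir i)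

/-- `∂φ/∂t` for a function of `(x₁, x₂, t)`. -/
def pdt (φ : ℝ × ℝ × ℝ → ℝ) (q : ℝ × ℝ × ℝ) : ℝ := fderiv ℝ φ q (0, 0, 1)

/-- The spatial Laplacian of a function of `(x₁, x₂, t)`. -/
def lap (φ : ℝ × ℝ × ℝ → ℝ) (q : ℝ × ℝ × ℝ) : ℝ := ∑ i : Fin 2, pd i (pd i φ) q

/-- The open space-time half plane `{x₂ > 0, t > 0}`. -/
def halfSpaceTime : Set (ℝ × ℝ × ℝ) := {q | 0 < q.2.1 ∧ 0 < q.2.2}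

/-- `{x₂ ≥ 0, t ≥ 0}`. -/
def closedHalfSpaceTime : Set (ℝ × ℝ × ℝ) := {q | 0 ≤ q.2.1 ∧ 0 ≤ q.2.2}

/-- The lateral boundary `{(y, t) : t > 0}`. -/
def lateralBoundary : Set (ℝ × ℝ) := {r | 0 < r.2}

/-- Solenoidal test fields: smooth, compactly supported in `{x₂ ≥ 0, t ≥ 0}`, divergence free
and vanishing on the lateral boundary `x₂ = 0`. -/
structure IsSolenoidalTest (φ : Fin 2 → ℝ × ℝ × ℝ → ℝ) : Prop where
  smooth : ∀ i, ContDiff ℝ ∞ (φ i)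
  compact : ∀ i, HasCompactSupport (φ i)
  div_free : ∀ q ∈ halfSpaceTime, ∑ i : Fin 2, pd i (φ i) q = 0
  boundary : ∀ i y t, 0 < t → φ i (y, 0, t) = 0

/-- Very weak solutions of `∂ₜu - Δu + ∇p = 0`, `div u = 0` in `{x₂ > 0, t > 0}` with `u = 0` at
`t = 0` and `u = g` on `x₂ = 0`. The outward unit normal is `(0, -1)`. -/
structure IsVeryWeakSolution (g : Fin 2 → ℝ → ℝ → ℝ) (u : Fin 2 → ℝ → ℝ → ℝ → ℝ) : Prop where
  locallyIntegrable : ∀ i, LocallyIntegrableOn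
    (fun q : ℝ × ℝ × ℝ => u i q.1 q.2.1 q.2.2) closedHalfSpaceTime
  momentum : ∀ φ : Fin 2 → ℝ × ℝ × ℝ → ℝ, IsSolenoidalTest φ →
    (∫ q in halfSpaceTime, ∑ i : Fin 2, u i q.1 q.2.1 q.2.2 * (pdt (φ i) q + lap (φ i) q))
      + (∫ r in lateralBoundary, ∑ i : Fin 2, g i r.1 r.2 * pd 1 (φ i) (r.1, 0, r.2)) = 0
  divergence : ∀ ψ : ℝ × ℝ × ℝ → ℝ, ContDiff ℝ ∞ ψ → HasCompactSupport ψ →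
    (∫ q in halfSpaceTime, ∑ i : Fin 2, u i q.1 q.2.1 q.2.2 * pd i ψ q)
      = -∫ r in lateralBoundary, g 1 r.1 r.2 * ψ (r.1, 0, r.2)

/-- The boundary data `g = (0, χ_{(-1,1)}(y) χ_{(1/2,1)}(s))`. -/
def datum (i : Fin 2) (y s : ℝ) : ℝ :=
  if i = 1 then (Ioo (-1 : ℝ) 1).indicator 1 y * (Ioo (1 / 2 : ℝ) 1).indicator 1 s else 0

end HalfPlaneStokes

end

/-!
The datum is supported in `(-1, 1) × (1/2, 1)`, and its normal component is a superposition of the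
data `δ(t - s) cos (k x₁)`, with amplitude `amp k = (2 / π) sin k / k`. For one such mode the
convolution formula for the velocity can be evaluated: with `e = heatPoisson` the Poisson kernel of
the heat equation on the half line and `A = expConv` its convolution with `exp (-k x₂)`, the
tangential and normal velocities are `sin (k x₁)` and `cos (k x₁)` times

  `exp (-k²τ) (-e + k A)` and `exp (-k²τ) k A`,   `τ = t - s > 0`,

together with the potential part `exp (-k x₂)` at the instant `t = s` (`velocity_datum_eq`).

*Very weak solution.* The bounds `abs_modeKernel_le_rpow` allow testing mode by mode
(`integral_velocity_mul`), so local integrability comes with absolute convergence. For one mode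
the divergence identity is the equation `∂_b A = e - k A` (`modePairing_gradient`), and Fourier
inversion adds the boundary values of the modes up to the datum (`integral_amp_mul_tangential`).
In the momentum identity a solenoidal test field `φ` can be eliminated in favour of its normal
component: what remains is the heat kernel `e` paired with the backward heat operator of
`∂₂φ₂ + k φ₂`. This function vanishes on the boundary, by `div φ = 0` and `φ = 0` there, so the very
weak identity for the heat equation on the half line (`integral_heatPoisson_mul`) applies
(`IsSolenoidalTest.modePairing_backwardHeat`).

*Logarithmic growth.* For `t = 1 + δ` with `δ ≈ x₂²` the potential part is absent and the term with
`A` is bounded. The term with `e` near the end point `x₁ = 1` of the datum contains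
`∫ (sin² k / k) exp (-k²τ) dk = -(log τ) / 4 + O(1)` (`abs_logKernel_one_add_log_le`), because
`sin²` has mean `1 / 2`. The kernel `e(x₂, τ)` lives at the scale `τ ≈ x₂²` and
`∫ e dτ` over `τ > δ` is bounded below by scaling, so `log τ` may be replaced by `2 log x₂`, which
gives the velocity `c log x₂ + O(1)` with `c > 0`. The estimate is uniform in `|x₁ - 1| ≤ x₂` and
`x₂² ≤ δ ≤ 2 x₂²` (`abs_velocity_sub_log_le`), hence holds on open sets touching `(1, 0, 1)`, and the
essential supremum is infinite.
-/

namespace HalfPlaneStokes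

/-! ### The heat kernel on the half line and its exponential convolution -/

/-- The Poisson kernel `-2 ∂_b G(b, τ)` of the heat equation on the half line `b > 0`, where `G` is
the one-dimensional heat kernel. The square root makes it `0` for `τ ≤ 0`. -/
noncomputable def heatPoisson (b τ : ℝ) : ℝ :=
  b / (τ * Real.sqrt (4 * Real.pi * τ)) * Real.exp (-b ^ 2 / (4 * τ))

lemma heatPoisson_of_nonpos {τ : ℝ} (hτ : τ ≤ 0) (b : ℝ) : heatPoisson b τ = 0 := by
  have : Real.sqrt (4 * Real.pi * τ) = 0 :=
    Real.sqrt_eq_zero_of_nonpos (mul_nonpos_of_nonneg_of_nonpos (by positivity) hτ)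
  simp [heatPoisson, this]

lemma heatPoisson_nonneg {b : ℝ} (hb : 0 ≤ b) (τ : ℝ) : 0 ≤ heatPoisson b τ := by
  rcases le_or_gt τ 0 with hτ | hτ
  · rw [heatPoisson_of_nonpos hτ]
  · unfold heatPoisson; positivity

lemma exp_neg_le_rpow {x p : ℝ} (hx : 0 < x) (hp : 0 ≤ p) (hp1 : p ≤ 1) :
    Real.exp (-x) ≤ x ^ (-p) := by
  rw [Real.exp_neg, Real.rpow_neg hx.le]
  gcongr
  have h1 := Real.add_one_le_exp x
  rcases le_total x 1 with h | h
  · exact (Real.rpow_le_one hx.le h hp).trans (by linarith)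
  · calc x ^ p ≤ x ^ (1 : ℝ) := Real.rpow_le_rpow_of_exponent_le h hp1
      _ = x := Real.rpow_one x
      _ ≤ _ := by linarith

lemma inv_mul_sqrt_le {τ : ℝ} (hτ : 0 < τ) :
    (τ * Real.sqrt (4 * Real.pi * τ))⁻¹ ≤ τ ^ (-(3 / 2) : ℝ) := by
  have h1 : τ ^ (-(3 / 2) : ℝ) = (τ * Real.sqrt τ)⁻¹ := by
    rw [Real.rpow_neg hτ.le, Real.sqrt_eq_rpow]
    congr 1
    nth_rw 2 [← Real.rpow_one τ]
    rw [← Real.rpow_add hτ]; norm_num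
  rw [h1]
  have h2 : Real.sqrt τ ≤ Real.sqrt (4 * Real.pi * τ) := by
    apply Real.sqrt_le_sqrt
    nlinarith [Real.pi_gt_three]
  have := Real.sqrt_pos.2 hτ
  gcongr

lemma heatPoisson_le {b τ : ℝ} (hb : 0 ≤ b) (hτ : 0 < τ) :
    heatPoisson b τ ≤ b * τ ^ (-(3 / 2) : ℝ) := by
  have h1 : Real.exp (-b ^ 2 / (4 * τ)) ≤ 1 := by
    rw [Real.exp_le_one_iff, neg_div]
    have : 0 ≤ b ^ 2 / (4 * τ) := by positivity
    linarith
  have h2 := inv_mul_sqrt_le hτ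
  unfold heatPoisson
  rw [div_eq_mul_inv]
  have h3 : 0 ≤ (τ * Real.sqrt (4 * Real.pi * τ))⁻¹ := by positivity
  calc b * (τ * Real.sqrt (4 * Real.pi * τ))⁻¹ * Real.exp (-b ^ 2 / (4 * τ))
      ≤ b * (τ * Real.sqrt (4 * Real.pi * τ))⁻¹ * 1 := by gcongr
    _ ≤ _ := by rw [mul_one]; gcongr

/-- The decay of the exponential is spent on lowering the singularity in `τ` to an integrable power,
uniformly up to an integrable power of `b`. -/
lemma heatPoisson_le_rpow {b τ : ℝ} (hb : 0 < b) (hτ : 0 < τ) :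
    heatPoisson b τ ≤ 4 * b ^ (-(3 / 4) : ℝ) * τ ^ (-(5 / 8) : ℝ) := by
  have h1 : Real.exp (-b ^ 2 / (4 * τ)) ≤ (b ^ 2 / (4 * τ)) ^ (-(7 / 8) : ℝ) := by
    rw [neg_div]
    exact exp_neg_le_rpow (by positivity) (by norm_num) (by norm_num)
  have h2 := inv_mul_sqrt_le hτ
  have h4 : (b ^ 2 / (4 * τ)) ^ (-(7 / 8) : ℝ)
      = b ^ (-(7 / 4) : ℝ) * ((4 : ℝ) ^ (7 / 8 : ℝ) * τ ^ (7 / 8 : ℝ)) := by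
    rw [Real.div_rpow (by positivity) (by positivity), ← Real.rpow_natCast b 2,
      ← Real.rpow_mul hb.le, Real.mul_rpow (by norm_num) hτ.le, Real.rpow_neg (by norm_num),
      Real.rpow_neg hτ.le]
    norm_num
    rw [div_eq_mul_inv, mul_inv, inv_inv, inv_inv]
  have h5 : (4 : ℝ) ^ (7 / 8 : ℝ) ≤ 4 := by
    calc (4 : ℝ) ^ (7 / 8 : ℝ) ≤ 4 ^ (1 : ℝ) :=
          Real.rpow_le_rpow_of_exponent_le (by norm_num) (by norm_num)
      _ = 4 := Real.rpow_one _
  unfold heatPoisson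
  rw [div_eq_mul_inv]
  calc b * (τ * Real.sqrt (4 * Real.pi * τ))⁻¹ * Real.exp (-b ^ 2 / (4 * τ))
      ≤ b * τ ^ (-(3 / 2) : ℝ) * (b ^ (-(7 / 4) : ℝ) * (4 * τ ^ (7 / 8 : ℝ))) := by
        rw [h4] at h1
        have h6 : b ^ (-(7 / 4) : ℝ) * ((4 : ℝ) ^ (7 / 8 : ℝ) * τ ^ (7 / 8 : ℝ))
          ≤ b ^ (-(7 / 4) : ℝ) * (4 * τ ^ (7 / 8 : ℝ)) := by gcongr
        have h7 := h1.trans h6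
        gcongr
    _ = 4 * (b ^ (1 : ℝ) * b ^ (-(7 / 4) : ℝ)) * (τ ^ (-(3 / 2) : ℝ) * τ ^ (7 / 8 : ℝ)) := by
        rw [Real.rpow_one]; ring
    _ = _ := by
        rw [← Real.rpow_add hb, ← Real.rpow_add hτ]; norm_num

@[fun_prop]
lemma measurable_heatPoisson : Measurable (fun p : ℝ × ℝ => heatPoisson p.1 p.2) := by
  unfold heatPoisson; fun_prop

lemma continuous_heatPoisson_left (τ : ℝ) : Continuous (fun b => heatPoisson b τ) := by
  unfold heatPoisson
  fun_prop

/-- The convolution `∫₀ᵇ e(z, τ) exp (-k (b - z)) dz` of the kernel `e = heatPoisson` with an exponential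
in the normal variable. -/
noncomputable def expConv (k b τ : ℝ) : ℝ :=
  ∫ z in Ioc 0 b, heatPoisson z τ * Real.exp (-(k * (b - z)))

lemma expConv_eq_exp_mul (k : ℝ) {b : ℝ} (hb : 0 ≤ b) (τ : ℝ) :
    expConv k b τ = Real.exp (-(k * b)) * ∫ z in (0 : ℝ)..b, heatPoisson z τ * Real.exp (k * z) := by
  rw [expConv, intervalIntegral.integral_of_le hb, ← integral_const_mul]
  refine setIntegral_congr_fun measurableSet_Ioc fun z _ => ?_
  rw [show -(k * (b - z)) = -(k * b) + k * z by ring, Real.exp_add]; ring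

lemma expConv_of_nonpos {τ : ℝ} (hτ : τ ≤ 0) (k b : ℝ) : expConv k b τ = 0 := by
  simp only [expConv, heatPoisson_of_nonpos hτ, zero_mul, integral_zero]

lemma expConv_nonneg (k b τ : ℝ) : 0 ≤ expConv k b τ :=
  setIntegral_nonneg measurableSet_Ioc fun _ hz =>
    mul_nonneg (heatPoisson_nonneg hz.1.le τ) (Real.exp_pos _).le

lemma integrableOn_expConv_integrand (k b τ : ℝ) :
    IntegrableOn (fun z => heatPoisson z τ * Real.exp (-(k * (b - z)))) (Ioc 0 b) := by
  have h := continuous_heatPoisson_left τ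
  exact (Continuous.integrableOn_Icc (by fun_prop)).mono_set Ioc_subset_Icc_self

lemma expConv_le {k b τ : ℝ} (hk : 0 ≤ k) (hb : 0 ≤ b) (hτ : 0 < τ) :
    expConv k b τ ≤ b ^ 2 * τ ^ (-(3 / 2) : ℝ) := by
  have h : expConv k b τ ≤ ∫ z in Ioc 0 b, b * τ ^ (-(3 / 2) : ℝ) := by
    refine setIntegral_mono_on (integrableOn_expConv_integrand k b τ)
      (continuous_const.integrableOn_Icc.mono_set Ioc_subset_Icc_self) measurableSet_Ioc ?_
    intro z hz
    have h1 : Real.exp (-(k * (b - z))) ≤ 1 := by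
      rw [Real.exp_le_one_iff]; nlinarith [mul_nonneg hk (sub_nonneg.2 hz.2)]
    have h2 : heatPoisson z τ ≤ b * τ ^ (-(3 / 2) : ℝ) :=
      (heatPoisson_le hz.1.le hτ).trans (by gcongr; exact hz.2)
    calc _ ≤ heatPoisson z τ * 1 := by
          gcongr; exact heatPoisson_nonneg hz.1.le τ
      _ ≤ _ := by linarith
  refine h.trans (le_of_eq ?_)
  rw [setIntegral_const, Real.volume_real_Ioc_of_le hb, smul_eq_mul]; ring

lemma hasDerivAt_expConv (k τ : ℝ) {b : ℝ} (hb : 0 < b) :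
    HasDerivAt (fun b => expConv k b τ) (heatPoisson b τ - k * expConv k b τ) b := by
  have h0 := continuous_heatPoisson_left τ
  have hc : Continuous (fun z => heatPoisson z τ * Real.exp (k * z)) := by fun_prop
  have h1 := (hc.integral_hasStrictDerivAt 0 b).hasDerivAt
  have h2 : HasDerivAt (fun b => Real.exp (-(k * b))) (Real.exp (-(k * b)) * (-(k * 1))) b :=
    ((hasDerivAt_id b).const_mul k).neg.exp
  have h3 := h2.mul h1
  refine (h3.congr_of_eventuallyEq ?_).congr_deriv ?_
  · filter_upwards [lt_mem_nhds hb] with c hc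
    exact expConv_eq_exp_mul k hc.le τ
  · rw [expConv_eq_exp_mul k hb.le τ]
    have : Real.exp (-(k * b)) * (heatPoisson b τ * Real.exp (k * b)) = heatPoisson b τ := by
      rw [mul_left_comm, ← Real.exp_add]; simp
    rw [this]; ring

lemma continuousOn_expConv (k τ : ℝ) : ContinuousOn (fun b => expConv k b τ) (Ici 0) := by
  have h0 := continuous_heatPoisson_left τ
  have hc : Continuous (fun z => heatPoisson z τ * Real.exp (k * z)) := by fun_prop
  have h1 : Continuous fun b => ∫ z in (0 : ℝ)..b, heatPoisson z τ * Real.exp (k * z) :=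
    intervalIntegral.continuous_primitive (fun a b => hc.intervalIntegrable a b) 0
  have h2 : Continuous fun b => Real.exp (-(k * b)) *
    ∫ z in (0 : ℝ)..b, heatPoisson z τ * Real.exp (k * z) := by fun_prop
  exact h2.continuousOn.congr fun b hb => expConv_eq_exp_mul k hb τ

lemma expConv_zero (k τ : ℝ) : expConv k 0 τ = 0 := by simp [expConv]

@[fun_prop]
lemma measurable_expConv : Measurable (fun p : ℝ × ℝ × ℝ => expConv p.1 p.2.1 p.2.2) := by
  have hS : MeasurableSet {q : (ℝ × ℝ × ℝ) × ℝ | 0 < q.2 ∧ q.2 ≤ q.1.2.1} :=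
    MeasurableSet.inter (s₁ := {q : (ℝ × ℝ × ℝ) × ℝ | 0 < q.2})
      (s₂ := {q : (ℝ × ℝ × ℝ) × ℝ | q.2 ≤ q.1.2.1})
      (measurableSet_lt measurable_const (by fun_prop)) (measurableSet_le (by fun_prop) (by fun_prop))
  have hm : Measurable (fun q : (ℝ × ℝ × ℝ) × ℝ =>
      heatPoisson q.2 q.1.2.2 * Real.exp (-(q.1.1 * (q.1.2.1 - q.2)))) := by
    have h1 : Measurable (fun q : (ℝ × ℝ × ℝ) × ℝ => heatPoisson q.2 q.1.2.2) :=
      measurable_heatPoisson.comp (f := fun q : (ℝ × ℝ × ℝ) × ℝ => (q.2, q.1.2.2)) (by fun_prop)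
    exact h1.mul (by fun_prop)
  have h2 := ((hm.indicator hS).stronglyMeasurable.integral_prod_right' (ν := volume)).measurable
  convert h2 using 2 with p
  rw [expConv, ← integral_indicator measurableSet_Ioc]
  rfl

lemma setIntegral_rpow_Ioc {b r : ℝ} (hb : 0 ≤ b) (hr : -1 < r) :
    ∫ z in Ioc 0 b, z ^ r = b ^ (r + 1) / (r + 1) := by
  rw [← intervalIntegral.integral_of_le hb, integral_rpow (Or.inl hr),
    Real.zero_rpow (by linarith)]
  simp

lemma integrableOn_rpow_Ioc {b r : ℝ} (hr : -1 < r) :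
    IntegrableOn (fun z : ℝ => z ^ r) (Ioc 0 b) := by
  rcases le_total 0 b with hb | hb
  · rw [← intervalIntegrable_iff_integrableOn_Ioc_of_le hb]
    exact intervalIntegral.intervalIntegrable_rpow' hr
  · simp [Ioc_eq_empty_of_le hb]

lemma integrableOn_sub_rpow_Ioc {b r : ℝ} (hr : -1 < r) (hb : 0 ≤ b) :
    IntegrableOn (fun z : ℝ => (b - z) ^ r) (Ioc 0 b) ∧
      ∫ z in Ioc 0 b, (b - z) ^ r = b ^ (r + 1) / (r + 1) := by
  constructor
  · rw [← intervalIntegrable_iff_integrableOn_Ioc_of_le hb]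
    have := (intervalIntegral.intervalIntegrable_rpow' (a := b) (b := 0) hr).comp_sub_left b
    simpa using this
  · rw [← intervalIntegral.integral_of_le hb,
      intervalIntegral.integral_comp_sub_left (fun z => z ^ r)]
    rw [← setIntegral_rpow_Ioc hb hr, ← intervalIntegral.integral_of_le hb]
    simp

/-- The weight `(b - z) ^ (-1/2)` comes from `exp (-x) ≤ x ^ (-1/2)`: it trades half a power of `k`, which
makes the Fourier integral of the mode kernel absolutely convergent. -/
lemma expConv_le_rpow {k b τ : ℝ} (hk : 0 < k) (hb : 0 < b) (hτ : 0 < τ) :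
    expConv k b τ
      ≤ 48 * k ^ (-(1 / 2) : ℝ) * τ ^ (-(5 / 8) : ℝ) * b ^ (-(1 / 4) : ℝ) := by
  set c := 4 * k ^ (-(1 / 2) : ℝ) * τ ^ (-(5 / 8) : ℝ) with hc
  have hc0 : 0 ≤ c := by positivity
  set f : ℝ → ℝ := fun z => c * ((b / 2) ^ (-(1 / 2) : ℝ) * z ^ (-(3 / 4) : ℝ)
    + (b / 2) ^ (-(3 / 4) : ℝ) * (b - z) ^ (-(1 / 2) : ℝ)) with hf
  have i1 := integrableOn_rpow_Ioc (b := b) (r := (-(3 / 4) : ℝ)) (by norm_num)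
  have i2 := integrableOn_sub_rpow_Ioc (b := b) (r := (-(1 / 2) : ℝ)) (by norm_num) hb.le
  have hfi : IntegrableOn f (Ioc 0 b) :=
    ((i1.const_mul _).add (i2.1.const_mul _)).const_mul c
  have hle : expConv k b τ ≤ ∫ z in Ioc 0 b, f z := by
    rw [expConv, integral_Ioc_eq_integral_Ioo, integral_Ioc_eq_integral_Ioo]
    refine setIntegral_mono_on ((integrableOn_expConv_integrand k b τ).mono_set Ioo_subset_Ioc_self)
      (hfi.mono_set Ioo_subset_Ioc_self) measurableSet_Ioo ?_
    intro z hz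
    have hz0 := hz.1
    have hz1 : 0 < b - z := sub_pos.2 hz.2
    have h1 := heatPoisson_le_rpow hz.1 hτ
    have h2 : Real.exp (-(k * (b - z))) ≤ k ^ (-(1 / 2) : ℝ) * (b - z) ^ (-(1 / 2) : ℝ) := by
      rw [← Real.mul_rpow hk.le hz1.le]
      exact exp_neg_le_rpow (by positivity) (by norm_num) (by norm_num)
    -- one of the two factors is bounded by its value at the midpoint `b / 2`
    have h3 : z ^ (-(3 / 4) : ℝ) * (b - z) ^ (-(1 / 2) : ℝ)
        ≤ (b / 2) ^ (-(1 / 2) : ℝ) * z ^ (-(3 / 4) : ℝ)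
          + (b / 2) ^ (-(3 / 4) : ℝ) * (b - z) ^ (-(1 / 2) : ℝ) := by
      rcases le_total z (b / 2) with h | h
      · have h4 : (b - z) ^ (-(1 / 2) : ℝ) ≤ (b / 2) ^ (-(1 / 2) : ℝ) :=
          Real.rpow_le_rpow_of_nonpos (by positivity) (by linarith) (by norm_num)
        have h5 : 0 ≤ (b / 2) ^ (-(3 / 4) : ℝ) * (b - z) ^ (-(1 / 2) : ℝ) := by positivity
        have h6 : z ^ (-(3 / 4) : ℝ) * (b - z) ^ (-(1 / 2) : ℝ)
          ≤ z ^ (-(3 / 4) : ℝ) * (b / 2) ^ (-(1 / 2) : ℝ) := by gcongr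
        linarith
      · have h4 : z ^ (-(3 / 4) : ℝ) ≤ (b / 2) ^ (-(3 / 4) : ℝ) :=
          Real.rpow_le_rpow_of_nonpos (by positivity) (by linarith) (by norm_num)
        have h5 : 0 ≤ (b / 2) ^ (-(1 / 2) : ℝ) * z ^ (-(3 / 4) : ℝ) := by positivity
        have h6 : z ^ (-(3 / 4) : ℝ) * (b - z) ^ (-(1 / 2) : ℝ)
          ≤ (b / 2) ^ (-(3 / 4) : ℝ) * (b - z) ^ (-(1 / 2) : ℝ) := by gcongr
        linarith
    calc heatPoisson z τ * Real.exp (-(k * (b - z)))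
        ≤ (4 * z ^ (-(3 / 4) : ℝ) * τ ^ (-(5 / 8) : ℝ))
          * (k ^ (-(1 / 2) : ℝ) * (b - z) ^ (-(1 / 2) : ℝ)) := by gcongr
      _ = c * (z ^ (-(3 / 4) : ℝ) * (b - z) ^ (-(1 / 2) : ℝ)) := by rw [hc]; ring
      _ ≤ f z := mul_le_mul_of_nonneg_left h3 hc0
  refine hle.trans ?_
  have hval : ∫ z in Ioc 0 b, f z = c * ((b / 2) ^ (-(1 / 2) : ℝ) * (4 * b ^ (1 / 4 : ℝ))
      + (b / 2) ^ (-(3 / 4) : ℝ) * (2 * b ^ (1 / 2 : ℝ))) := by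
    rw [hf, integral_const_mul, integral_add (i1.const_mul _) (i2.1.const_mul _),
      integral_const_mul, integral_const_mul, setIntegral_rpow_Ioc hb.le (by norm_num), i2.2]
    norm_num
    left; ring
  have e1 : (b / 2) ^ (-(1 / 2) : ℝ) ≤ 2 * b ^ (-(1 / 2) : ℝ) := by
    rw [Real.div_rpow hb.le (by norm_num), Real.rpow_neg (by norm_num : (0 : ℝ) ≤ 2), div_inv_eq_mul,
      mul_comm]
    gcongr
    calc (2 : ℝ) ^ (1 / 2 : ℝ) ≤ 2 ^ (1 : ℝ) :=
          Real.rpow_le_rpow_of_exponent_le (by norm_num) (by norm_num)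
      _ = 2 := Real.rpow_one _
  have e2 : (b / 2) ^ (-(3 / 4) : ℝ) ≤ 2 * b ^ (-(3 / 4) : ℝ) := by
    rw [Real.div_rpow hb.le (by norm_num), Real.rpow_neg (by norm_num : (0 : ℝ) ≤ 2), div_inv_eq_mul,
      mul_comm]
    gcongr
    calc (2 : ℝ) ^ (3 / 4 : ℝ) ≤ 2 ^ (1 : ℝ) :=
          Real.rpow_le_rpow_of_exponent_le (by norm_num) (by norm_num)
      _ = 2 := Real.rpow_one _
  calc ∫ z in Ioc 0 b, f z
      ≤ c * ((2 * b ^ (-(1 / 2) : ℝ)) * (4 * b ^ (1 / 4 : ℝ))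
      + (2 * b ^ (-(3 / 4) : ℝ)) * (2 * b ^ (1 / 2 : ℝ))) := by rw [hval]; gcongr
    _ = c * (8 * (b ^ (-(1 / 2) : ℝ) * b ^ (1 / 4 : ℝ))
        + 4 * (b ^ (-(3 / 4) : ℝ) * b ^ (1 / 2 : ℝ))) := by ring
    _ = _ := by
      rw [← Real.rpow_add hb, ← Real.rpow_add hb, hc]
      norm_num; ring

/-! ### Mode kernels and amplitudes -/

/-- The tangential oscillation of the `i`-th velocity component. -/
noncomputable def trig (i : Fin 2) (θ : ℝ) : ℝ := if i = 0 then Real.sin θ else Real.cos θ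

lemma abs_trig_le (i : Fin 2) (θ : ℝ) : |trig i θ| ≤ 1 := by
  unfold trig; split_ifs
  · exact Real.abs_sin_le_one θ
  · exact Real.abs_cos_le_one θ

@[fun_prop]
lemma continuous_trig (i : Fin 2) : Continuous (trig i) := by
  unfold trig; split_ifs <;> fun_prop

/-- The `i`-th component of the velocity at `(x₁, b)` and time `τ > 0` produced by the normal boundary
datum `δ(t) cos (k x₁)` is `trig i (k x₁) * modeKernel i k b τ`. -/
noncomputable def modeKernel (i : Fin 2) (k b τ : ℝ) : ℝ :=
  Real.exp (-(k ^ 2 * τ)) * ((if i = 0 then -heatPoisson b τ else 0) + k * expConv k b τ)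

lemma modeKernel_of_nonpos {τ : ℝ} (hτ : τ ≤ 0) (i : Fin 2) (k b : ℝ) :
    modeKernel i k b τ = 0 := by
  simp [modeKernel, heatPoisson_of_nonpos hτ, expConv_of_nonpos hτ]

@[fun_prop]
lemma measurable_modeKernel (i : Fin 2) :
    Measurable (fun p : ℝ × ℝ × ℝ => modeKernel i p.1 p.2.1 p.2.2) := by
  have h1 : Measurable (fun p : ℝ × ℝ × ℝ => heatPoisson p.2.1 p.2.2) :=
    measurable_heatPoisson.comp measurable_snd
  have h2 := measurable_expConv
  unfold modeKernel
  split_ifs <;> fun_prop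

lemma abs_modeKernel_le (i : Fin 2) {k b : ℝ} (hk : 0 ≤ k) (hb : 0 ≤ b) (τ : ℝ) :
    |modeKernel i k b τ| ≤ Real.exp (-(k ^ 2 * τ)) * (heatPoisson b τ + k * expConv k b τ) := by
  have h1 := heatPoisson_nonneg hb τ
  have h2 := mul_nonneg hk (expConv_nonneg k b τ)
  rw [modeKernel, abs_mul, Real.abs_exp]
  gcongr
  split_ifs
  · rw [abs_le]; constructor <;> linarith
  · rw [abs_le]; constructor <;> linarith

lemma abs_modeKernel_le_gaussian (i : Fin 2) {k b τ : ℝ} (hk : 0 ≤ k) (hb : 0 ≤ b) (hτ : 0 < τ) :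
    |modeKernel i k b τ|
      ≤ Real.exp (-(k ^ 2 * τ)) * ((b + k * b ^ 2) * τ ^ (-(3 / 2) : ℝ)) := by
  refine (abs_modeKernel_le i hk hb τ).trans ?_
  gcongr
  have h1 := heatPoisson_le hb hτ
  have h2 := mul_le_mul_of_nonneg_left (expConv_le hk hb hτ) hk
  nlinarith

/-- A dominating function of product form for the mode kernels, integrable on bounded sets. -/
lemma abs_modeKernel_le_rpow (i : Fin 2) {k b τ : ℝ} (hk : 0 < k) (hb : 0 < b) (hτ : 0 < τ) :
    |modeKernel i k b τ| ≤ 48 * (k ^ (-(5 / 8) : ℝ) + k ^ (-(1 / 8) : ℝ))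
      * (b ^ (-(3 / 4) : ℝ) + b ^ (-(1 / 4) : ℝ)) * τ ^ (-(15 / 16) : ℝ) := by
  have h0 : Real.exp (-(k ^ 2 * τ)) ≤ k ^ (-(5 / 8) : ℝ) * τ ^ (-(5 / 16) : ℝ) := by
    refine (exp_neg_le_rpow (p := 5 / 16) (by positivity) (by norm_num) (by norm_num)).trans ?_
    rw [Real.mul_rpow (by positivity) hτ.le, ← Real.rpow_natCast k 2, ← Real.rpow_mul hk.le]
    norm_num
  have h1 := heatPoisson_le_rpow hb hτ
  have h2 := expConv_le_rpow hk hb hτ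
  have h3 := expConv_nonneg k b τ
  have h4 := heatPoisson_nonneg hb.le τ
  have hk1 : k ^ (-(1 / 8) : ℝ) = k ^ (-(5 / 8) : ℝ) * (k * k ^ (-(1 / 2) : ℝ)) := by
    nth_rw 3 [← Real.rpow_one k]
    rw [← Real.rpow_add hk, ← Real.rpow_add hk]; norm_num
  have ht : τ ^ (-(15 / 16) : ℝ) = τ ^ (-(5 / 16) : ℝ) * τ ^ (-(5 / 8) : ℝ) := by
    rw [← Real.rpow_add hτ]; norm_num
  calc |modeKernel i k b τ|
      ≤ Real.exp (-(k ^ 2 * τ)) * (heatPoisson b τ + k * expConv k b τ) :=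
        abs_modeKernel_le i hk.le hb.le τ
    _ ≤ (k ^ (-(5 / 8) : ℝ) * τ ^ (-(5 / 16) : ℝ)) * (4 * b ^ (-(3 / 4) : ℝ) * τ ^ (-(5 / 8) : ℝ)
        + k * (48 * k ^ (-(1 / 2) : ℝ) * τ ^ (-(5 / 8) : ℝ) * b ^ (-(1 / 4) : ℝ))) := by gcongr
    _ = (4 * k ^ (-(5 / 8) : ℝ) * b ^ (-(3 / 4) : ℝ) + 48 * k ^ (-(1 / 8) : ℝ)
        * b ^ (-(1 / 4) : ℝ)) * τ ^ (-(15 / 16) : ℝ) := by rw [hk1, ht]; ring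
    _ ≤ _ := by
      have p1 : 0 ≤ k ^ (-(5 / 8) : ℝ) * b ^ (-(3 / 4) : ℝ) := by positivity
      have p2 : 0 ≤ k ^ (-(5 / 8) : ℝ) * b ^ (-(1 / 4) : ℝ) := by positivity
      have p3 : 0 ≤ k ^ (-(1 / 8) : ℝ) * b ^ (-(3 / 4) : ℝ) := by positivity
      gcongr
      nlinarith

/-- The Fourier amplitude of the indicator of `(-1, 1)`, whose cosine expansion is
`∫₀^∞ amp k * cos (k x) dk`. -/
noncomputable def amp (k : ℝ) : ℝ := 2 / Real.pi * Real.sinc k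

@[fun_prop]
lemma continuous_amp : Continuous amp := by unfold amp; fun_prop

lemma abs_amp_le_one (k : ℝ) : |amp k| ≤ 1 := by
  rw [amp, abs_mul, abs_of_pos (by positivity)]
  have h1 : 2 / Real.pi ≤ 1 := by rw [div_le_one Real.pi_pos]; linarith [Real.pi_gt_three]
  have h2 := abs_le.2 ⟨Real.neg_one_le_sinc k, Real.sinc_le_one k⟩
  calc _ ≤ (1 : ℝ) * 1 := by gcongr
    _ = 1 := one_mul 1

lemma abs_amp_le_inv {k : ℝ} (hk : 0 < k) : |amp k| ≤ k⁻¹ := by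
  rw [amp, abs_mul, abs_of_pos (by positivity), Real.sinc_of_ne_zero hk.ne', abs_div,
    abs_of_pos hk, div_eq_mul_inv |Real.sin k|]
  have h1 : 2 / Real.pi ≤ 1 := by rw [div_le_one Real.pi_pos]; linarith [Real.pi_gt_three]
  have h2 := Real.abs_sin_le_one k
  calc _ ≤ (1 : ℝ) * (1 * k⁻¹) := by gcongr
    _ = k⁻¹ := by ring

lemma integrableOn_amp_mul_rpow {r : ℝ} (h1 : -1 < r) (h2 : r < 0) :
    IntegrableOn (fun k => |amp k| * k ^ r) (Ioi 0) := by
  have hm : AEStronglyMeasurable (fun k => |amp k| * k ^ r) (volume.restrict (Ioi 0)) := by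
    have : Measurable (fun k => |amp k| * k ^ r) := by
      have := continuous_amp.measurable; fun_prop
    exact this.aestronglyMeasurable
  rw [← Ioc_union_Ioi_eq_Ioi (zero_le_one' ℝ)]
  refine IntegrableOn.union ?_ ?_
  · refine Integrable.mono' (integrableOn_rpow_Ioc (b := 1) h1)
      (hm.mono_set Ioc_subset_Ioi_self) ?_
    refine (ae_restrict_iff' measurableSet_Ioc).2 (ae_of_all _ fun k hk => ?_)
    have := hk.1
    rw [Real.norm_of_nonneg (by positivity)]
    calc _ ≤ 1 * k ^ r := by gcongr; exact abs_amp_le_one k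
      _ = _ := one_mul _
  · refine Integrable.mono' (integrableOn_Ioi_rpow_of_lt (a := r - 1) (by linarith) zero_lt_one)
      (hm.mono_set (Ioi_subset_Ioi zero_le_one)) ?_
    refine (ae_restrict_iff' measurableSet_Ioi).2 (ae_of_all _ fun k hk => ?_)
    have hk0 : 0 < k := zero_lt_one.trans hk
    rw [Real.norm_of_nonneg (by positivity)]
    calc _ ≤ k⁻¹ * k ^ r := by gcongr; exact abs_amp_le_inv hk0
      _ = k ^ (-1 : ℝ) * k ^ r := by rw [Real.rpow_neg_one]
      _ = _ := by rw [← Real.rpow_add hk0]; ring_nf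

/-! ### The velocity in Fourier variables -/

lemma spaceDeriv_laplaceKernel (i : Fin 2) (a : ℝ) {b : ℝ} (hb : 0 < b) :
    spaceDeriv i laplaceKernel a b
      = (2 * Real.pi)⁻¹ * ((if i = 0 then a else b) / (a ^ 2 + b ^ 2)) := by
  have hpos : ∀ x y : ℝ, 0 ≤ x ^ 2 + y ^ 2 := fun x y => by positivity
  have hne : a ^ 2 + b ^ 2 ≠ 0 := by positivity
  unfold spaceDeriv laplaceKernel
  simp_rw [Real.log_sqrt (hpos _ _)]
  split_ifs
  · have h : HasDerivAt (fun x : ℝ => x ^ 2 + b ^ 2) (2 * a) a := by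
      simpa using (hasDerivAt_pow 2 a).add_const (b ^ 2)
    rw [(((h.log hne).div_const 2).const_mul _).deriv]
    congr 1; field_simp
  · have h : HasDerivAt (fun x : ℝ => a ^ 2 + x ^ 2) (2 * b) b := by
      simpa using (hasDerivAt_pow 2 b).const_add (a ^ 2)
    rw [(((h.log hne).div_const 2).const_mul _).deriv]
    congr 1; field_simp

/-- The one-dimensional heat kernel. -/
noncomputable def gauss (t z : ℝ) : ℝ :=
  (Real.sqrt (4 * Real.pi * t))⁻¹ * Real.exp (-((4 * t)⁻¹ * z ^ 2))

lemma spaceDeriv_heatKernel {t : ℝ} (ht : 0 < t) (a b : ℝ) :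
    spaceDeriv 1 (heatKernel t) a b = -(1 / 2) * heatPoisson b t * gauss t a := by
  have h : HasDerivAt (fun x : ℝ => -(a ^ 2 + x ^ 2) / (4 * t)) (-(2 * b) / (4 * t)) b := by
    have h0 : HasDerivAt (fun x : ℝ => a ^ 2 + x ^ 2) (2 * b) b := by
      simpa using (hasDerivAt_pow 2 b).const_add (a ^ 2)
    exact h0.neg.div_const _
  have h1 := (h.exp.const_mul (4 * Real.pi * t)⁻¹).deriv
  simp only [spaceDeriv, heatKernel, if_pos ht, one_ne_zero, if_false]
  rw [h1, heatPoisson, gauss]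
  have h2 : Real.exp (-(a ^ 2 + b ^ 2) / (4 * t))
      = Real.exp (-b ^ 2 / (4 * t)) * Real.exp (-((4 * t)⁻¹ * a ^ 2)) := by
    rw [← Real.exp_add]; congr 1; field_simp; ring
  have h3 : (4 * Real.pi * t)⁻¹
      = (Real.sqrt (4 * Real.pi * t))⁻¹ * (Real.sqrt (4 * Real.pi * t))⁻¹ := by
    rw [← mul_inv, Real.mul_self_sqrt (by positivity)]
  rw [h2, h3]
  have : Real.sqrt (4 * Real.pi * t) ≠ 0 := (Real.sqrt_pos.2 (by positivity)).ne'
  field_simp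
  ring

lemma integrableOn_exp_neg_mul {c : ℝ} (hc : 0 < c) :
    IntegrableOn (fun k : ℝ => Real.exp (-(k * c))) (Ioi 0) := by
  simpa [mul_comm] using integrableOn_exp_mul_Ioi (neg_lt_zero.2 hc) 0

lemma integrable_exp_neg_sq_mul {t : ℝ} (ht : 0 < t) :
    Integrable (fun k : ℝ => Real.exp (-(k ^ 2 * t))) := by
  simpa [mul_comm] using integrable_exp_neg_mul_sq ht

lemma integrable_mul_exp_neg_sq_mul {t : ℝ} (ht : 0 < t) :
    Integrable (fun k : ℝ => k * Real.exp (-(k ^ 2 * t))) := by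
  simpa [mul_comm] using integrable_mul_exp_neg_mul_sq ht

/-- The right-hand side is, up to the factor `2π`, the derivative `D_{x_i} E` of the Laplace kernel. -/
lemma integral_trig_mul_exp_neg (i : Fin 2) (a : ℝ) {b : ℝ} (hb : 0 < b) :
    ∫ k in Ioi (0 : ℝ), trig i (k * a) * Real.exp (-(k * b))
      = (if i = 0 then a else b) / (a ^ 2 + b ^ 2) := by
  set c : ℂ := -b + a * Complex.I with hc
  have hre : c.re < 0 := by simp [hc, hb]
  have h1 := integral_exp_mul_complex_Ioi hre 0
  have h2 := integrableOn_exp_mul_complex_Ioi hre 0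
  have hn : Complex.normSq c = a ^ 2 + b ^ 2 := by
    simp [hc, Complex.normSq_apply]; ring
  have hval : -Complex.exp (c * (0 : ℝ)) / c = -c⁻¹ := by simp [neg_div]
  rw [hval] at h1
  have e1 : ∀ k : ℝ, (c * k).re = -(k * b) := fun k => by simp [hc, mul_comm]
  have e2 : ∀ k : ℝ, (c * k).im = k * a := fun k => by simp [hc, mul_comm]
  unfold trig
  split_ifs
  · have h3 := Complex.imCLM.integral_comp_comm h2
    rw [h1] at h3
    simp only [Complex.imCLM_apply, Complex.exp_im, e1, e2, Complex.neg_im, Complex.inv_im, hn] at h3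
    simp_rw [mul_comm (Real.sin _), h3]
    simp [hc, neg_div]
  · have h3 := Complex.reCLM.integral_comp_comm h2
    rw [h1] at h3
    simp only [Complex.reCLM_apply, Complex.exp_re, e1, e2, Complex.neg_re, Complex.inv_re, hn] at h3
    simp_rw [mul_comm (Real.cos _), h3]
    simp [hc, neg_div]

lemma integral_exp_neg_mul_sq_mul_trig (i : Fin 2) (k : ℝ) {β : ℝ} (hβ : 0 < β) :
    ∫ z : ℝ, Real.exp (-(β * z ^ 2)) * trig i (k * z)
      = if i = 0 then 0 else Real.sqrt (Real.pi / β) * Real.exp (-(k ^ 2 / (4 * β))) := by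
  have h1 := fourierIntegral_gaussian (b := β) (by simpa using hβ) (k : ℂ)
  have h4 : ∀ x : ℝ, Complex.exp (Complex.I * k * x) * Complex.exp (-β * x ^ 2)
      = (Real.exp (-(β * x ^ 2)) : ℂ) * (Real.cos (k * x) + Real.sin (k * x) * Complex.I) := by
    intro x
    push_cast
    rw [← Complex.exp_mul_I, mul_comm]
    congr 2 <;> ring
  have hint : Integrable (fun x : ℝ => (Real.exp (-(β * x ^ 2)) : ℂ)
      * (Real.cos (k * x) + Real.sin (k * x) * Complex.I)) := by
    have h5 : Integrable (fun x : ℝ => Real.exp (-(β * x ^ 2))) := by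
      simpa using integrable_exp_neg_mul_sq hβ
    refine Integrable.mono h5 (by fun_prop) (ae_of_all _ fun x => ?_)
    have : ((Real.cos (k * x) : ℂ) + Real.sin (k * x) * Complex.I)
      = Complex.exp ((k * x : ℝ) * Complex.I) := by
        rw [Complex.exp_mul_I]; push_cast; rfl
    rw [norm_mul, this, Complex.norm_exp_ofReal_mul_I, mul_one, Complex.norm_real]
  have hv : ((Real.pi : ℂ) / β) ^ (1 / 2 : ℂ) * Complex.exp (-(k : ℂ) ^ 2 / (4 * β))
      = ((Real.sqrt (Real.pi / β) * Real.exp (-(k ^ 2 / (4 * β))) : ℝ) : ℂ) := by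
    rw [Real.sqrt_eq_rpow]
    push_cast
    rw [Complex.ofReal_cpow (by positivity)]
    push_cast
    congr 2; ring
  simp_rw [h4] at h1
  rw [hv] at h1
  unfold trig
  split_ifs
  · have h3 := Complex.imCLM.integral_comp_comm hint
    rw [h1] at h3
    simpa only [Complex.imCLM_apply, Complex.re_ofReal_mul, Complex.im_ofReal_mul,
      Complex.add_im, Complex.add_re, Complex.ofReal_im, Complex.ofReal_re, Complex.I_re,
      Complex.I_im, mul_zero, mul_one, zero_add, add_zero, sub_zero] using h3
  · have h3 := Complex.reCLM.integral_comp_comm hint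
    rw [h1] at h3
    simpa only [Complex.reCLM_apply, Complex.re_ofReal_mul, Complex.im_ofReal_mul,
      Complex.add_im, Complex.add_re, Complex.ofReal_im, Complex.ofReal_re, Complex.I_re,
      Complex.I_im, mul_zero, mul_one, zero_add, add_zero, sub_zero] using h3

lemma integrable_gauss {t : ℝ} (ht : 0 < t) : Integrable (gauss t) := by
  have h5 : Integrable (fun x : ℝ => Real.exp (-((4 * t)⁻¹ * x ^ 2))) := by
    simpa only [neg_mul] using integrable_exp_neg_mul_sq (b := (4 * t)⁻¹) (by positivity)
  exact h5.const_mul _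

lemma integral_gauss_mul_trig (i : Fin 2) (k a : ℝ) {t : ℝ} (ht : 0 < t) :
    ∫ z : ℝ, gauss t z * trig i (k * (a - z)) = Real.exp (-(k ^ 2 * t)) * trig i (k * a) := by
  have hβ : 0 < (4 * t)⁻¹ := by positivity
  have hs := integral_exp_neg_mul_sq_mul_trig 0 k hβ
  have hc := integral_exp_neg_mul_sq_mul_trig 1 k hβ
  have h5 : Integrable (fun x : ℝ => Real.exp (-((4 * t)⁻¹ * x ^ 2))) := by
    simpa only [neg_mul] using integrable_exp_neg_mul_sq hβ
  have hi : ∀ i, Integrable (fun x : ℝ => Real.exp (-((4 * t)⁻¹ * x ^ 2)) * trig i (k * x)) := by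
    intro i
    refine Integrable.mono h5 (by fun_prop) (ae_of_all _ fun x => ?_)
    rw [norm_mul]
    calc _ ≤ ‖Real.exp (-((4 * t)⁻¹ * x ^ 2))‖ * 1 := by gcongr; exact abs_trig_le i _
      _ = _ := mul_one _
  have hsq : Real.sqrt (Real.pi / (4 * t)⁻¹) = Real.sqrt (4 * Real.pi * t) := by
    congr 1; field_simp
  have hex : k ^ 2 / (4 * (4 * t)⁻¹) = k ^ 2 * t := by field_simp
  simp only [one_ne_zero, if_true, if_false, hsq, hex] at hs hc
  have hne : Real.sqrt (4 * Real.pi * t) ≠ 0 := (Real.sqrt_pos.2 (by positivity)).ne'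
  have key : ∀ z, gauss t z * trig i (k * (a - z)) = (Real.sqrt (4 * Real.pi * t))⁻¹ *
      (trig i (k * a) * (Real.exp (-((4 * t)⁻¹ * z ^ 2)) * trig 1 (k * z))
        + (if i = 0 then -Real.cos (k * a) else Real.sin (k * a))
          * (Real.exp (-((4 * t)⁻¹ * z ^ 2)) * trig 0 (k * z))) := by
    intro z
    rw [gauss, mul_sub]
    fin_cases i
    · simp [trig, Real.sin_sub]; ring
    · simp [trig, Real.cos_sub]; ring
  simp_rw [key]
  rw [integral_const_mul, integral_add ((hi 1).const_mul _) ((hi 0).const_mul _),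
    integral_const_mul, integral_const_mul, hs, hc]
  field_simp
  ring

/-- The tangential convolution of the heat kernel with the Laplace kernel, as a Fourier integral. -/
lemma integral_heat_mul_laplace (i : Fin 2) {t b : ℝ} (ht : 0 < t) (a z₂ : ℝ) (hz : z₂ < b) :
    ∫ z₁ : ℝ, spaceDeriv 1 (heatKernel t) z₁ z₂ * spaceDeriv i laplaceKernel (a - z₁) (b - z₂)
      = -(4 * Real.pi)⁻¹ * ∫ k in Ioi (0 : ℝ), trig i (k * a) * Real.exp (-(k ^ 2 * t))
          * (heatPoisson z₂ t * Real.exp (-(k * (b - z₂)))) := by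
  have hc : 0 < b - z₂ := sub_pos.2 hz
  have h1 : ∀ z₁, spaceDeriv 1 (heatKernel t) z₁ z₂ * spaceDeriv i laplaceKernel (a - z₁) (b - z₂)
      = (-(4 * Real.pi)⁻¹ * heatPoisson z₂ t) * ∫ k in Ioi (0 : ℝ),
        gauss t z₁ * (trig i (k * (a - z₁)) * Real.exp (-(k * (b - z₂)))) := by
    intro z₁
    rw [spaceDeriv_heatKernel ht, spaceDeriv_laplaceKernel i _ hc, ← integral_trig_mul_exp_neg i _ hc,
      integral_const_mul]
    generalize ∫ k in Ioi (0 : ℝ), trig i (k * (a - z₁)) * Real.exp (-(k * (b - z₂))) = J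
    field_simp
    ring
  simp_rw [h1]
  rw [integral_const_mul, mul_assoc]
  congr 1
  have hint : Integrable (Function.uncurry fun (z₁ k : ℝ) =>
      gauss t z₁ * (trig i (k * (a - z₁)) * Real.exp (-(k * (b - z₂)))))
      (volume.prod (volume.restrict (Ioi 0))) := by
    refine Integrable.mono ((integrable_gauss ht).mul_prod (integrableOn_exp_neg_mul hc)) ?_ ?_
    · refine Continuous.aestronglyMeasurable ?_
      unfold gauss Function.uncurry; fun_prop
    · refine ae_of_all _ fun p => ?_
      simp only [Function.uncurry, norm_mul]
      gcongr
      calc _ ≤ 1 * ‖Real.exp (-(p.2 * (b - z₂)))‖ := by gcongr; exact abs_trig_le i _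
        _ = _ := one_mul _
  rw [integral_integral_swap hint, ← integral_const_mul]
  refine integral_congr_ae (ae_of_all _ fun k => ?_)
  have h2 : ∀ z, gauss t z * (trig i (k * (a - z)) * Real.exp (-(k * (b - z₂))))
    = (gauss t z * trig i (k * (a - z))) * Real.exp (-(k * (b - z₂))) := fun z => by ring
  simp_rw [h2]
  rw [integral_mul_const, integral_gauss_mul_trig i k a ht]
  ring

lemma integral_integral_heat_mul_laplace (i : Fin 2) {t b : ℝ} (ht : 0 < t) (hb : 0 < b) (a : ℝ) :
    ∫ z₂ in (0 : ℝ)..b, ∫ z₁ : ℝ,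
      spaceDeriv 1 (heatKernel t) z₁ z₂ * spaceDeriv i laplaceKernel (a - z₁) (b - z₂)
      = -(4 * Real.pi)⁻¹ * ∫ k in Ioi (0 : ℝ), trig i (k * a) * Real.exp (-(k ^ 2 * t))
          * expConv k b t := by
  have h1 : ∫ z₂ in (0 : ℝ)..b, ∫ z₁ : ℝ,
      spaceDeriv 1 (heatKernel t) z₁ z₂ * spaceDeriv i laplaceKernel (a - z₁) (b - z₂)
      = ∫ z₂ in Ioo 0 b, -(4 * Real.pi)⁻¹ * ∫ k in Ioi (0 : ℝ),
          trig i (k * a) * Real.exp (-(k ^ 2 * t))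
          * (heatPoisson z₂ t * Real.exp (-(k * (b - z₂)))) := by
    rw [intervalIntegral.integral_of_le hb.le, integral_Ioc_eq_integral_Ioo]
    exact setIntegral_congr_fun measurableSet_Ioo fun z hz =>
      integral_heat_mul_laplace i ht a z hz.2
  rw [h1, integral_const_mul]
  congr 1
  have hcont := continuous_heatPoisson_left t
  have hint : Integrable (Function.uncurry fun (z k : ℝ) => trig i (k * a)
      * Real.exp (-(k ^ 2 * t)) * (heatPoisson z t * Real.exp (-(k * (b - z)))))
      ((volume.restrict (Ioo 0 b)).prod (volume.restrict (Ioi 0))) := by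
    have hi : IntegrableOn (fun z => heatPoisson z t) (Ioo 0 b) :=
      hcont.integrableOn_Icc.mono_set Ioo_subset_Icc_self
    refine Integrable.mono (hi.mul_prod (integrable_exp_neg_sq_mul ht).restrict) ?_ ?_
    · refine Continuous.aestronglyMeasurable ?_
      unfold Function.uncurry; fun_prop
    · rw [Measure.prod_restrict]
      refine (ae_restrict_iff' (measurableSet_Ioo.prod measurableSet_Ioi)).2 (ae_of_all _ ?_)
      rintro ⟨z, k⟩ ⟨hz, hk⟩
      have h3 : Real.exp (-(k * (b - z))) ≤ 1 := by
        rw [Real.exp_le_one_iff]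
        have : 0 < k * (b - z) := mul_pos hk (sub_pos.2 hz.2)
        linarith
      simp only [Function.uncurry, norm_mul, Real.norm_eq_abs, Real.abs_exp]
      calc |trig i (k * a)| * Real.exp (-(k ^ 2 * t)) * (|heatPoisson z t|
            * Real.exp (-(k * (b - z))))
          ≤ 1 * Real.exp (-(k ^ 2 * t)) * (|heatPoisson z t| * 1) := by
            gcongr; exact abs_trig_le i _
        _ = _ := by ring
  rw [integral_integral_swap hint]
  refine integral_congr_ae (ae_of_all _ fun k => ?_)
  simp only
  rw [integral_const_mul, expConv, integral_Ioc_eq_integral_Ioo]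

lemma hasDerivAt_integral_expConv (i : Fin 2) {t b : ℝ} (ht : 0 < t) (hb : 0 < b) (a : ℝ) :
    HasDerivAt (fun b => ∫ k in Ioi (0 : ℝ), trig i (k * a) * Real.exp (-(k ^ 2 * t))
          * expConv k b t)
      (∫ k in Ioi (0 : ℝ), trig i (k * a) * Real.exp (-(k ^ 2 * t))
          * (heatPoisson b t - k * expConv k b t)) b := by
  have hm : ∀ c, Measurable (fun k => expConv k c t) := fun c =>
    measurable_expConv.comp (f := fun k : ℝ => (k, c, t)) (by fun_prop)
  set C := (2 * b) * t ^ (-(3 / 2) : ℝ) with hC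
  set D := (2 * b) ^ 2 * t ^ (-(3 / 2) : ℝ) with hD
  have hC0 : 0 ≤ C := by positivity
  have hD0 : 0 ≤ D := by positivity
  have hbd : ∀ k ∈ Ioi (0 : ℝ), ∀ c ∈ Ioo 0 (2 * b), |expConv k c t| ≤ D ∧
      |heatPoisson c t - k * expConv k c t| ≤ C + k * D := by
    intro k hk c hc
    have hk0 : (0 : ℝ) ≤ k := le_of_lt hk
    have h1 := expConv_nonneg k c t
    have h2 : expConv k c t ≤ D := (expConv_le hk0 hc.1.le ht).trans (by
      rw [hD]; have := hc.1.le; have := hc.2.le; gcongr)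
    have h3 := heatPoisson_nonneg hc.1.le t
    have h4 : heatPoisson c t ≤ C := (heatPoisson_le hc.1.le ht).trans (by
      rw [hC]; have := hc.2.le; gcongr)
    have h5 := mul_nonneg hk0 h1
    have h6 := mul_le_mul_of_nonneg_left h2 hk0
    refine ⟨by rwa [abs_of_nonneg h1], ?_⟩
    rw [abs_le]; constructor <;> nlinarith
  refine (hasDerivAt_integral_of_dominated_loc_of_deriv_le (𝕜 := ℝ) (E := ℝ)
    (μ := volume.restrict (Ioi (0 : ℝ)))
    (F := fun c k => trig i (k * a) * Real.exp (-(k ^ 2 * t)) * expConv k c t)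
    (F' := fun c k => trig i (k * a) * Real.exp (-(k ^ 2 * t))
      * (heatPoisson c t - k * expConv k c t)) (s := Ioo 0 (2 * b))
    (bound := fun k => C * Real.exp (-(k ^ 2 * t)) + D * (k * Real.exp (-(k ^ 2 * t))))
    (Ioo_mem_nhds hb (by linarith)) ?_ ?_ ?_ ?_ ?_ ?_).2
  · refine Eventually.of_forall fun c => Measurable.aestronglyMeasurable ?_
    have := hm c; fun_prop
  · refine Integrable.mono' ((integrable_exp_neg_sq_mul ht).restrict.const_mul D) ?_ ?_
    · refine Measurable.aestronglyMeasurable ?_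
      have := hm b; fun_prop
    · refine (ae_restrict_iff' measurableSet_Ioi).2 (ae_of_all _ fun k hk => ?_)
      rw [norm_mul, norm_mul, Real.norm_eq_abs, Real.norm_eq_abs, Real.norm_eq_abs, Real.abs_exp]
      have := (hbd k hk b ⟨hb, by linarith⟩).1
      calc _ ≤ 1 * Real.exp (-(k ^ 2 * t)) * D := by gcongr; exact abs_trig_le i _
        _ = _ := by ring
  · refine Measurable.aestronglyMeasurable ?_
    have := hm b; fun_prop
  · refine (ae_restrict_iff' measurableSet_Ioi).2 (ae_of_all _ fun k hk c hc => ?_)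
    rw [norm_mul, norm_mul, Real.norm_eq_abs, Real.norm_eq_abs, Real.norm_eq_abs, Real.abs_exp]
    have := (hbd k hk c hc).2
    calc _ ≤ 1 * Real.exp (-(k ^ 2 * t)) * (C + k * D) := by gcongr; exact abs_trig_le i _
      _ = _ := by ring
  · exact ((integrable_exp_neg_sq_mul ht).restrict.const_mul C).add
      ((integrable_mul_exp_neg_sq_mul ht).restrict.const_mul D)
  · exact (ae_restrict_iff' measurableSet_Ioi).2 (ae_of_all _ fun k hk c hc =>
      (hasDerivAt_expConv k t hc.1).const_mul _)

/-- Only the normal derivative `j = 1` of the composite potential is needed, since the tangential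
component of the datum is zero. -/
lemma compositeKernel_eq (i : Fin 2) {t b : ℝ} (ht : 0 < t) (hb : 0 < b) (a : ℝ) :
    compositeKernel i 1 t a b = -(4 * Real.pi)⁻¹ * ∫ k in Ioi (0 : ℝ),
      trig i (k * a) * Real.exp (-(k ^ 2 * t)) * (heatPoisson b t - k * expConv k b t) := by
  rw [compositeKernel, spaceDeriv, if_neg one_ne_zero]
  refine (((hasDerivAt_integral_expConv i ht hb a).const_mul (-(4 * Real.pi)⁻¹)).congr_of_eventuallyEq
    ?_).deriv
  filter_upwards [lt_mem_nhds hb] with c hc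
  exact integral_integral_heat_mul_laplace i ht hc a

lemma integral_cos_mul_exp_neg_sq {t : ℝ} (ht : 0 < t) (a : ℝ) :
    ∫ k in Ioi (0 : ℝ), Real.cos (k * a) * Real.exp (-(k ^ 2 * t)) = Real.pi * gauss t a := by
  have h1 := integral_exp_neg_mul_sq_mul_trig 1 a ht
  have h2 := integral_comp_abs (f := fun z => Real.exp (-(t * z ^ 2)) * trig 1 (a * z))
  have h3 : ∀ z, Real.exp (-(t * |z| ^ 2)) * trig 1 (a * |z|)
      = Real.exp (-(t * z ^ 2)) * trig 1 (a * z) := by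
    intro z
    rcases abs_cases z with ⟨h, _⟩ | ⟨h, _⟩ <;> rw [h] <;> simp [trig]
  simp_rw [h3] at h2
  rw [h1] at h2
  simp only [one_ne_zero, if_false, trig] at h2
  have h4 : Real.sqrt (Real.pi / t) = 2 * Real.pi * (Real.sqrt (4 * Real.pi * t))⁻¹ := by
    have hs : Real.sqrt (4 * Real.pi * t) = 2 * Real.sqrt (Real.pi * t) := by
      rw [mul_assoc, Real.sqrt_mul (by norm_num)]
      congr 1
      rw [show (4 : ℝ) = 2 ^ 2 by norm_num, Real.sqrt_sq (by norm_num)]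
    rw [hs]
    have h5 : Real.pi / t = Real.pi ^ 2 / (Real.pi * t) := by field_simp
    rw [h5, Real.sqrt_div (by positivity), Real.sqrt_sq Real.pi_pos.le]
    field_simp
  have h6 : ∀ k, Real.cos (k * a) * Real.exp (-(k ^ 2 * t))
    = Real.exp (-(t * k ^ 2)) * Real.cos (a * k) := fun k => by
      rw [mul_comm, mul_comm a k, mul_comm t]
  simp_rw [h6]
  rw [gauss]
  have h7 : a ^ 2 / (4 * t) = (4 * t)⁻¹ * a ^ 2 := by field_simp
  rw [h4, h7] at h2
  linarith

lemma integrableOn_modeKernel (i : Fin 2) {t b : ℝ} (ht : 0 < t) (hb : 0 < b) :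
    IntegrableOn (fun k => modeKernel i k b t) (Ioi 0) := by
  refine Integrable.mono' (g := fun k => (b * t ^ (-(3 / 2) : ℝ)) * Real.exp (-(k ^ 2 * t))
    + (b ^ 2 * t ^ (-(3 / 2) : ℝ)) * (k * Real.exp (-(k ^ 2 * t))))
    (((integrable_exp_neg_sq_mul ht).restrict.const_mul _).add
      ((integrable_mul_exp_neg_sq_mul ht).restrict.const_mul _)) ?_ ?_
  · exact ((measurable_modeKernel i).comp (f := fun k : ℝ => (k, b, t))
      (by fun_prop)).aestronglyMeasurable
  · refine (ae_restrict_iff' measurableSet_Ioi).2 (ae_of_all _ fun k hk => ?_)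
    refine (abs_modeKernel_le_gaussian i (le_of_lt hk) hb.le ht).trans (le_of_eq ?_)
    ring

lemma regularPoissonKernel_eq (i : Fin 2) {t b : ℝ} (ht : 0 < t) (hb : 0 < b) (a : ℝ) :
    regularPoissonKernel i 1 t a b
      = Real.pi⁻¹ * ∫ k in Ioi (0 : ℝ), trig i (k * a) * modeKernel i k b t := by
  rw [regularPoissonKernel, compositeKernel_eq i ht hb]
  have hp : 4 * (-(4 * Real.pi)⁻¹) = -Real.pi⁻¹ := by field_simp
  rw [← mul_assoc, hp]
  have hpi := Real.pi_pos.ne'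
  fin_cases i
  · simp only [Fin.zero_eta, Fin.isValue, zero_ne_one, if_false, zero_add, modeKernel, if_true]
    rw [neg_mul, ← mul_neg, ← integral_neg]
    congr 2; ext k; ring
  · simp only [Fin.mk_one, if_true, spaceDeriv_heatKernel ht]
    have hmi := integrableOn_modeKernel 1 ht hb
    have i1 : IntegrableOn (fun k => Real.cos (k * a) * Real.exp (-(k ^ 2 * t))) (Ioi 0) := by
      refine Integrable.mono (integrable_exp_neg_sq_mul ht).restrict (by fun_prop) (ae_of_all _ ?_)
      intro k
      rw [norm_mul]
      calc _ ≤ 1 * ‖Real.exp (-(k ^ 2 * t))‖ := by gcongr; exact Real.abs_cos_le_one _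
        _ = _ := one_mul _
    have i2 : IntegrableOn (fun k => trig 1 (k * a) * modeKernel 1 k b t) (Ioi 0) := by
      refine Integrable.mono hmi ?_ (ae_of_all _ fun k => ?_)
      · exact (Continuous.aestronglyMeasurable (by fun_prop)).mul hmi.aestronglyMeasurable
      · rw [norm_mul]
        calc _ ≤ 1 * ‖modeKernel 1 k b t‖ := by gcongr; exact abs_trig_le 1 _
          _ = _ := one_mul _
    have e : ∀ k, trig 1 (k * a) * Real.exp (-(k ^ 2 * t)) * (heatPoisson b t - k * expConv k b t)
        = heatPoisson b t * (Real.cos (k * a) * Real.exp (-(k ^ 2 * t)))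
          - trig 1 (k * a) * modeKernel 1 k b t := by
      intro k; simp [trig, modeKernel]; ring
    simp_rw [e]
    rw [integral_sub (i1.const_mul _) i2, integral_const_mul, integral_cos_mul_exp_neg_sq ht]
    generalize ∫ k in Ioi (0 : ℝ), trig 1 (k * a) * modeKernel 1 k b t = J
    field_simp
    ring

lemma integral_trig_Ioo (i : Fin 2) {k : ℝ} (hk : 0 < k) (x : ℝ) :
    ∫ y in Ioo (-1 : ℝ) 1, trig i (k * (x - y)) = Real.pi * amp k * trig i (k * x) := by
  rw [← integral_Ioc_eq_integral_Ioo, ← intervalIntegral.integral_of_le (by norm_num)]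
  have hd : ∀ y ∈ uIcc (-1 : ℝ) 1, HasDerivAt
      (fun y => k⁻¹ * (if i = 0 then Real.cos (k * (x - y)) else -Real.sin (k * (x - y))))
      (trig i (k * (x - y))) y := by
    intro y _
    have h0 : HasDerivAt (fun y => k * (x - y)) (-k) y := by
      simpa using ((hasDerivAt_id y).const_sub x).const_mul k
    unfold trig
    split_ifs
    · refine (h0.cos.const_mul k⁻¹).congr_deriv ?_
      field_simp
    · refine (h0.sin.neg.const_mul k⁻¹).congr_deriv ?_
      field_simp
  rw [intervalIntegral.integral_eq_sub_of_hasDerivAt hd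
    (Continuous.intervalIntegrable (by fun_prop) _ _), amp, Real.sinc_of_ne_zero hk.ne']
  have hpi := Real.pi_pos.ne'
  unfold trig
  have e1 : k * (x - 1) = k * x - k := by ring
  have e2 : k * (x - -1) = k * x + k := by ring
  rw [e1, e2]
  split_ifs
  · rw [Real.cos_sub, Real.cos_add]; field_simp; ring
  · rw [Real.sin_sub, Real.sin_add]; field_simp; ring

/-- Integrating a tangential Fourier integral over the support of the boundary datum. -/
lemma integral_Ioo_fourier (i : Fin 2) {f : ℝ → ℝ} (hf : IntegrableOn f (Ioi 0)) (x : ℝ) :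
    ∫ y in Ioo (-1 : ℝ) 1, Real.pi⁻¹ * ∫ k in Ioi (0 : ℝ), trig i (k * (x - y)) * f k
      = ∫ k in Ioi (0 : ℝ), amp k * trig i (k * x) * f k := by
  have hint : Integrable (Function.uncurry fun (y k : ℝ) => trig i (k * (x - y)) * f k)
      ((volume.restrict (Ioo (-1) 1)).prod (volume.restrict (Ioi 0))) := by
    have h1 : IntegrableOn (fun _ : ℝ => (1 : ℝ)) (Ioo (-1) 1) :=
      continuous_const.integrableOn_Icc.mono_set Ioo_subset_Icc_self
    have h2 := h1.mul_prod hf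
    refine Integrable.mono h2 ?_ (ae_of_all _ fun p => ?_)
    · have h3 : AEStronglyMeasurable (fun p : ℝ × ℝ => f p.2)
        ((volume.restrict (Ioo (-1) 1)).prod (volume.restrict (Ioi 0))) := by
        simpa using h2.aestronglyMeasurable
      exact (Continuous.aestronglyMeasurable (by fun_prop)).mul h3
    · simp only [Function.uncurry, norm_mul]
      gcongr
      simpa using abs_trig_le i _
  rw [integral_const_mul, integral_integral_swap hint, ← integral_const_mul]
  refine setIntegral_congr_fun measurableSet_Ioi fun k hk => ?_
  rw [integral_mul_const, integral_trig_Ioo i hk]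
  have hpi := Real.pi_pos.ne'
  field_simp

/-- The velocity as a superposition of tangential Fourier modes. -/
theorem velocity_datum_eq (i : Fin 2) (x₁ : ℝ) {b t : ℝ} (hb : 0 < b) (ht : 0 < t) :
    velocity datum i x₁ b t
      = (∫ s in Ioo (1 / 2 : ℝ) 1, ∫ k in Ioi (0 : ℝ),
          amp k * trig i (k * x₁) * modeKernel i k b (t - s))
        + (Ioo (1 / 2 : ℝ) 1).indicator 1 t
          * ∫ k in Ioi (0 : ℝ), amp k * trig i (k * x₁) * Real.exp (-(k * b)) := by
  have hχ : ∀ (F : ℝ → ℝ) (c : ℝ), ∫ y : ℝ, F y * ((Ioo (-1 : ℝ) 1).indicator 1 y * c)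
      = c * ∫ y in Ioo (-1 : ℝ) 1, F y := by
    intro F c
    rw [← integral_indicator measurableSet_Ioo, ← integral_const_mul]
    congr 1; ext y
    by_cases hy : y ∈ Ioo (-1 : ℝ) 1
    · simp [hy, mul_comm]
    · simp [hy]
  have h0 : ∀ y s, datum 0 y s = 0 := fun y s => by simp [datum]
  have h1 : ∀ y s, datum 1 y s = (Ioo (-1 : ℝ) 1).indicator 1 y
    * (Ioo (1 / 2 : ℝ) 1).indicator 1 s := fun y s => by simp [datum]
  rw [velocity, Fin.sum_univ_two]
  simp_rw [h0, h1, hχ]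
  simp only [mul_zero, integral_zero, intervalIntegral.integral_zero, zero_add]
  congr 1
  · rw [intervalIntegral.integral_of_le ht.le, integral_Ioc_eq_integral_Ioo,
      ← integral_indicator measurableSet_Ioo, ← integral_indicator measurableSet_Ioo]
    congr 1; ext s
    by_cases hs : s ∈ Ioo 0 t
    · rw [indicator_of_mem hs]
      by_cases hs' : s ∈ Ioo (1 / 2 : ℝ) 1
      · rw [indicator_of_mem hs', indicator_of_mem hs', Pi.one_apply, one_mul]
        have hts : 0 < t - s := sub_pos.2 hs.2
        simp_rw [regularPoissonKernel_eq i hts hb]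
        exact integral_Ioo_fourier i (integrableOn_modeKernel i hts hb) x₁
      · rw [indicator_of_notMem hs', indicator_of_notMem hs', zero_mul]
    · rw [indicator_of_notMem hs]
      by_cases hs' : s ∈ Ioo (1 / 2 : ℝ) 1
      · rw [indicator_of_mem hs']
        have hts : t - s ≤ 0 := by
          by_contra h
          exact hs ⟨by linarith [hs'.1], by linarith⟩
        simp [modeKernel_of_nonpos hts]
      · rw [indicator_of_notMem hs']
  · rw [mul_left_comm]
    congr 1
    rw [← integral_Ioo_fourier i (integrableOn_exp_neg_mul hb) x₁, ← integral_const_mul]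
    congr 1; ext y
    rw [spaceDeriv_laplaceKernel i _ hb, integral_trig_mul_exp_neg i _ hb]
    field_simp

/-! ### Testing the superposition of modes -/

/-- The open quadrant of the variables `(x₂, t)`. -/
def quadrant : Set (ℝ × ℝ) := Ioi 0 ×ˢ Ioi 0

lemma measurableSet_quadrant : MeasurableSet quadrant := measurableSet_Ioi.prod measurableSet_Ioi

lemma halfSpaceTime_eq : halfSpaceTime = univ ×ˢ quadrant := by
  ext q; simp [halfSpaceTime, quadrant]

lemma measurableSet_halfSpaceTime : MeasurableSet halfSpaceTime := by
  rw [halfSpaceTime_eq]; exact MeasurableSet.univ.prod measurableSet_quadrant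

lemma volume_restrict_halfSpaceTime : (volume : Measure (ℝ × ℝ × ℝ)).restrict halfSpaceTime
    = (volume : Measure ℝ).prod (volume.restrict quadrant) := by
  rw [halfSpaceTime_eq, Measure.volume_eq_prod, ← Measure.prod_restrict, Measure.restrict_univ]

lemma volume_restrict_quadrant : (volume : Measure (ℝ × ℝ)).restrict quadrant
    = (volume.restrict (Ioi (0 : ℝ))).prod (volume.restrict (Ioi (0 : ℝ))) := by
  rw [quadrant, Measure.volume_eq_prod, ← Measure.prod_restrict]

lemma exists_bound_of_hasCompactSupport {E : Type*} [NormedAddCommGroup E] {θ : E → ℝ}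
    (hθ : Continuous θ) (hc : HasCompactSupport θ) :
    ∃ C R : ℝ, 0 ≤ C ∧ 0 < R ∧ (∀ q, |θ q| ≤ C) ∧ ∀ q, θ q ≠ 0 → ‖q‖ ≤ R := by
  obtain ⟨C, hC⟩ := hc.exists_bound_of_continuous hθ
  obtain ⟨R, hR0, hR⟩ := hc.isCompact.isBounded.exists_pos_norm_le
  exact ⟨C, R, (norm_nonneg _).trans (hC 0), hR0, hC, fun q hq => hR q (subset_tsupport θ hq)⟩

/-- A function bounded on the support of `θ` by `κ β(x₂) h(t - σ)` is integrable against `θ`, with a norm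
linear in `κ` and independent of `σ`. This uniformity makes the integration over all modes possible. -/
lemma integrableOn_halfSpaceTime_of_bound {f θ : ℝ × ℝ × ℝ → ℝ} {κ σ C R : ℝ} {β h : ℝ → ℝ}
    (hf : Measurable f) (hθ : Continuous θ) (hC : 0 ≤ C) (hκ : 0 ≤ κ)
    (hθC : ∀ q, |θ q| ≤ C) (hθR : ∀ q, θ q ≠ 0 → ‖q‖ ≤ R)
    (hβ : IntegrableOn β (Ioc 0 R)) (hβ0 : ∀ b, 0 < b → 0 ≤ β b)
    (hh : Integrable h) (hh0 : ∀ t, 0 ≤ h t)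
    (hle : ∀ x, ∀ b ∈ Ioc 0 R, ∀ t ∈ Ioc 0 R, |f (x, b, t)| ≤ κ * (β b * h (t - σ))) :
    IntegrableOn (fun q => f q * θ q) halfSpaceTime ∧
      ∫ q in halfSpaceTime, ‖f q * θ q‖
        ≤ κ * (C * ((∫ x, (Icc (-R) R).indicator 1 x)
            * ((∫ b, (Ioc 0 R).indicator β b) * ∫ t, h t))) := by
  set G : ℝ × ℝ × ℝ → ℝ := fun q => κ * (C * ((Icc (-R) R).indicator 1 q.1
    * ((Ioc 0 R).indicator β q.2.1 * h (q.2.2 - σ)))) with hG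
  have hi1 : Integrable ((Icc (-R) R).indicator (1 : ℝ → ℝ)) :=
    (integrable_indicator_iff measurableSet_Icc).2 continuous_const.integrableOn_Icc
  have hi2 : Integrable ((Ioc 0 R).indicator β) := (integrable_indicator_iff measurableSet_Ioc).2 hβ
  have hi3 : Integrable (fun t => h (t - σ)) := hh.comp_sub_right σ
  have hGi : Integrable G := ((hi1.mul_prod (hi2.mul_prod hi3)).const_mul C).const_mul κ
  have hind2 : ∀ b, 0 ≤ (Ioc 0 R).indicator β b := fun b =>
    indicator_nonneg (fun b hb => hβ0 b hb.1) b
  have hind1 : ∀ x, (0 : ℝ) ≤ (Icc (-R) R).indicator 1 x := fun x =>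
    indicator_nonneg (fun _ _ => zero_le_one) x
  have hG0 : ∀ q, 0 ≤ G q := fun q => mul_nonneg hκ (mul_nonneg hC (mul_nonneg (hind1 _)
    (mul_nonneg (hind2 _) (hh0 _))))
  have hbd : ∀ q ∈ halfSpaceTime, ‖f q * θ q‖ ≤ G q := by
    rintro ⟨x, b, t⟩ ⟨hb, ht⟩
    by_cases h0 : θ (x, b, t) = 0
    · simpa [h0] using hG0 (x, b, t)
    · have hn := hθR _ h0
      simp only [Prod.norm_def, sup_le_iff, Real.norm_eq_abs] at hn
      have hx : x ∈ Icc (-R) R := abs_le.1 hn.1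
      have hb' : b ∈ Ioc 0 R := ⟨hb, (abs_le.1 hn.2.1).2⟩
      have ht' : t ∈ Ioc 0 R := ⟨ht, (abs_le.1 hn.2.2).2⟩
      simp only [hG, indicator_of_mem hx, indicator_of_mem hb', Pi.one_apply, one_mul]
      rw [norm_mul, mul_left_comm, mul_comm ‖f _‖]
      exact mul_le_mul (hθC _) (hle x b hb' t ht') (abs_nonneg _) hC
  have hmeas : AEStronglyMeasurable (fun q => f q * θ q) (volume.restrict halfSpaceTime) :=
    (hf.mul hθ.measurable).aestronglyMeasurable
  have hae : ∀ᵐ q ∂(volume.restrict halfSpaceTime), ‖f q * θ q‖ ≤ G q :=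
    (ae_restrict_iff' measurableSet_halfSpaceTime).2 (ae_of_all _ hbd)
  refine ⟨Integrable.mono' hGi.restrict hmeas hae, ?_⟩
  calc ∫ q in halfSpaceTime, ‖f q * θ q‖ ≤ ∫ q in halfSpaceTime, G q :=
        integral_mono_of_nonneg (ae_of_all _ fun _ => norm_nonneg _) hGi.restrict hae
    _ ≤ ∫ q, G q := setIntegral_le_integral hGi (ae_of_all _ hG0)
    _ = _ := by
      rw [hG, integral_const_mul, integral_const_mul, Measure.volume_eq_prod,
        integral_prod_mul (fun x => (Icc (-R) R).indicator (1 : ℝ → ℝ) x)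
          (fun p : ℝ × ℝ => (Ioc 0 R).indicator β p.1 * h (p.2 - σ)), Measure.volume_eq_prod,
        integral_prod_mul (fun b => (Ioc 0 R).indicator β b) (fun t => h (t - σ)),
        integral_sub_right_eq_self]

lemma integrable_prod_halfSpaceTime_of_bound {Ω : Type*} [MeasurableSpace Ω] {μ : Measure Ω}
    [SFinite μ] {F : Ω → ℝ × ℝ × ℝ → ℝ} {θ : ℝ × ℝ × ℝ → ℝ} {κ σ : Ω → ℝ} {C R : ℝ} {β h : ℝ → ℝ}
    (hF : Measurable (Function.uncurry F)) (hθ : Continuous θ) (hC : 0 ≤ C)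
    (hκ : Integrable κ μ) (hκ0 : ∀ᵐ m ∂μ, 0 ≤ κ m)
    (hθC : ∀ q, |θ q| ≤ C) (hθR : ∀ q, θ q ≠ 0 → ‖q‖ ≤ R)
    (hβ : IntegrableOn β (Ioc 0 R)) (hβ0 : ∀ b, 0 < b → 0 ≤ β b)
    (hh : Integrable h) (hh0 : ∀ t, 0 ≤ h t)
    (hle : ∀ᵐ m ∂μ, ∀ x, ∀ b ∈ Ioc 0 R, ∀ t ∈ Ioc 0 R,
      |F m (x, b, t)| ≤ κ m * (β b * h (t - σ m))) :
    Integrable (fun p : Ω × (ℝ × ℝ × ℝ) => F p.1 p.2 * θ p.2)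
      (μ.prod (volume.restrict halfSpaceTime)) := by
  have hm : Measurable (fun p : Ω × (ℝ × ℝ × ℝ) => F p.1 p.2 * θ p.2) :=
    hF.mul (hθ.measurable.comp measurable_snd)
  have hms : ∀ m, Measurable (F m) := fun m => hF.comp measurable_prodMk_left
  rw [integrable_prod_iff hm.aestronglyMeasurable]
  constructor
  · filter_upwards [hκ0, hle] with m h1 h2
    exact (integrableOn_halfSpaceTime_of_bound (hms m) hθ hC h1 hθC hθR hβ hβ0 hh hh0 h2).1
  · refine Integrable.mono' (hκ.mul_const (C * ((∫ x, (Icc (-R) R).indicator 1 x)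
            * ((∫ b, (Ioc 0 R).indicator β b) * ∫ t, h t)))) ?_ ?_
    · exact hm.aestronglyMeasurable.norm.integral_prod_right'
    · filter_upwards [hκ0, hle] with m h1 h2
      rw [Real.norm_of_nonneg (integral_nonneg fun _ => norm_nonneg _)]
      exact (integrableOn_halfSpaceTime_of_bound (hms m) hθ hC h1 hθC hθR hβ hβ0 hh hh0 h2).2

/-- The tangential sine (`i = 0`) or cosine (`i = 1`) transform of a function of `(x₁, x₂, t)`. -/
noncomputable def tangential (i : Fin 2) (k : ℝ) (θ : ℝ × ℝ × ℝ → ℝ) (p : ℝ × ℝ) : ℝ :=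
  ∫ x, trig i (k * x) * θ (x, p)

lemma measurable_tangential (i : Fin 2) {θ : ℝ × ℝ × ℝ → ℝ} (hθ : Continuous θ) :
    Measurable (fun q : ℝ × ℝ × ℝ => tangential i q.1 θ q.2) := by
  have h : Measurable (fun q : (ℝ × ℝ × ℝ) × ℝ => trig i (q.1.1 * q.2) * θ (q.2, q.1.2)) := by
    refine Continuous.measurable ?_
    fun_prop
  exact (h.stronglyMeasurable.integral_prod_right' (ν := volume)).measurable

lemma tangential_eq_zero (i : Fin 2) (k : ℝ) {θ : ℝ × ℝ × ℝ → ℝ} {R : ℝ}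
    (hθR : ∀ q, θ q ≠ 0 → ‖q‖ ≤ R) {p : ℝ × ℝ} (hp : R < ‖p‖) : tangential i k θ p = 0 := by
  have : ∀ x, θ (x, p) = 0 := fun x => by
    by_contra h
    have := hθR _ h
    rw [Prod.norm_def, sup_le_iff] at this
    linarith [this.2]
  simp [tangential, this]

lemma abs_tangential_le (i : Fin 2) (k : ℝ) {θ : ℝ × ℝ × ℝ → ℝ} {C R : ℝ}
    (hR : 0 < R) (hθC : ∀ q, |θ q| ≤ C) (hθR : ∀ q, θ q ≠ 0 → ‖q‖ ≤ R) (p : ℝ × ℝ) :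
    |tangential i k θ p| ≤ C * (2 * R) := by
  have hb : ∀ x, ‖trig i (k * x) * θ (x, p)‖ ≤ (Icc (-R) R).indicator (fun _ => C) x := by
    intro x
    by_cases hx : x ∈ Icc (-R) R
    · rw [indicator_of_mem hx, norm_mul]
      calc _ ≤ 1 * C := mul_le_mul (abs_trig_le i _) (hθC _) (abs_nonneg _) zero_le_one
        _ = C := one_mul C
    · have : θ (x, p) = 0 := by
        by_contra h
        have := hθR _ h
        rw [Prod.norm_def, sup_le_iff] at this
        exact hx (abs_le.1 this.1)
      simp [this, hx]
  have hi : Integrable ((Icc (-R) R).indicator (fun _ => C)) :=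
    (integrable_indicator_iff measurableSet_Icc).2 continuous_const.integrableOn_Icc
  have h := norm_integral_le_of_norm_le hi (ae_of_all _ hb)
  rw [integral_indicator measurableSet_Icc, setIntegral_const, smul_eq_mul,
    Real.volume_real_Icc_of_le (by linarith)] at h
  rw [Real.norm_eq_abs] at h
  unfold tangential
  linarith

lemma setIntegral_halfSpaceTime_eq {f : ℝ × ℝ × ℝ → ℝ} (hf : IntegrableOn f halfSpaceTime) :
    ∫ q in halfSpaceTime, f q = ∫ p in quadrant, ∫ x, f (x, p) := by
  unfold IntegrableOn at hf
  rw [volume_restrict_halfSpaceTime] at hf ⊢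
  exact integral_prod_symm f hf

/-- The pairing of the velocity produced by the boundary datum `δ(t - s) cos (k x₁)` with a test
function: its part that is a function of time, and its part at the instant `s`. -/
noncomputable def modePairing (i : Fin 2) (k s : ℝ) (θ : ℝ × ℝ × ℝ → ℝ) : ℝ :=
  (∫ p in quadrant, modeKernel i k p.1 (p.2 - s) * tangential i k θ p)
    + ∫ b in Ioi (0 : ℝ), Real.exp (-(k * b)) * tangential i k θ (b, s)

/-- The measure on the set of pairs `(s, k)` of a time in the support of the datum and a frequency. -/
noncomputable def modeMeasure : Measure (ℝ × ℝ) :=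
  (volume.restrict (Ioo (1 / 2 : ℝ) 1)).prod (volume.restrict (Ioi (0 : ℝ)))

instance : SFinite modeMeasure := by unfold modeMeasure; infer_instance

lemma modeMeasure_eq : modeMeasure = volume.restrict (Ioo (1 / 2 : ℝ) 1 ×ˢ Ioi (0 : ℝ)) := by
  rw [modeMeasure, Measure.prod_restrict, Measure.volume_eq_prod]

lemma ae_modeMeasure {P : ℝ × ℝ → Prop} (h : ∀ s ∈ Ioo (1 / 2 : ℝ) 1, ∀ k, 0 < k → P (s, k)) :
    ∀ᵐ m ∂modeMeasure, P m := by
  rw [modeMeasure_eq]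
  exact (ae_restrict_iff' (measurableSet_Ioo.prod measurableSet_Ioi)).2
    (ae_of_all _ fun m hm => h m.1 hm.1 m.2 hm.2)

section Superposition

variable {θ : ℝ × ℝ × ℝ → ℝ} {C R : ℝ}

lemma integrableOn_sum_rpow (R : ℝ) :
    IntegrableOn (fun b : ℝ => b ^ (-(3 / 4) : ℝ) + b ^ (-(1 / 4) : ℝ)) (Ioc 0 R) :=
  (integrableOn_rpow_Ioc (by norm_num)).add (integrableOn_rpow_Ioc (by norm_num))

lemma integrable_indicator_rpow (R : ℝ) :
    Integrable ((Ioc 0 R).indicator (fun t : ℝ => t ^ (-(15 / 16) : ℝ))) :=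
  (integrable_indicator_iff measurableSet_Ioc).2 (integrableOn_rpow_Ioc (by norm_num))

/-- The weight of the frequency `k` in the bound for the superposition of mode kernels. -/
noncomputable def frequencyWeight (k : ℝ) : ℝ :=
  48 * (|amp k| * k ^ (-(5 / 8) : ℝ) + |amp k| * k ^ (-(1 / 8) : ℝ))

lemma integrableOn_frequencyWeight : IntegrableOn frequencyWeight (Ioi 0) :=
  ((integrableOn_amp_mul_rpow (by norm_num) (by norm_num)).add
    (integrableOn_amp_mul_rpow (by norm_num) (by norm_num))).const_mul 48

lemma abs_amp_mul_modeKernel_le (i : Fin 2) {s k : ℝ} (hs : 0 < s) (hk : 0 < k) (x : ℝ) {b t : ℝ}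
    (hb : b ∈ Ioc 0 R) (ht : t ∈ Ioc 0 R) :
    |amp k * trig i (k * x) * modeKernel i k b (t - s)|
      ≤ frequencyWeight k * ((b ^ (-(3 / 4) : ℝ) + b ^ (-(1 / 4) : ℝ))
        * (Ioc 0 R).indicator (fun t : ℝ => t ^ (-(15 / 16) : ℝ)) (t - s)) := by
  have hb0 := hb.1
  rcases le_or_gt (t - s) 0 with h | h
  · rw [modeKernel_of_nonpos h, mul_zero, abs_zero, indicator_of_notMem (fun h' => h.not_gt h'.1)]
    simp
  · rw [indicator_of_mem (show t - s ∈ Ioc 0 R from ⟨h, by linarith [ht.2]⟩)]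
    rw [abs_mul, abs_mul]
    calc |amp k| * |trig i (k * x)| * |modeKernel i k b (t - s)|
        ≤ |amp k| * 1 * (48 * (k ^ (-(5 / 8) : ℝ) + k ^ (-(1 / 8) : ℝ))
      * (b ^ (-(3 / 4) : ℝ) + b ^ (-(1 / 4) : ℝ)) * (t - s) ^ (-(15 / 16) : ℝ)) := by
          gcongr
          · exact abs_trig_le i _
          · exact abs_modeKernel_le_rpow i hk hb0 h
      _ = _ := by rw [frequencyWeight]; ring

lemma measurable_regularIntegrand (i : Fin 2) : Measurable (Function.uncurry
    fun (m : ℝ × ℝ) (q : ℝ × ℝ × ℝ) =>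
      amp m.2 * trig i (m.2 * q.1) * modeKernel i m.2 q.2.1 (q.2.2 - m.1)) := by
  have h1 : Measurable fun p : (ℝ × ℝ) × (ℝ × ℝ × ℝ) =>
      modeKernel i p.1.2 p.2.2.1 (p.2.2.2 - p.1.1) :=
    (measurable_modeKernel i).comp (f := fun p : (ℝ × ℝ) × (ℝ × ℝ × ℝ) =>
      (p.1.2, p.2.2.1, p.2.2.2 - p.1.1)) (by fun_prop)
  have h2 : Measurable fun p : (ℝ × ℝ) × (ℝ × ℝ × ℝ) => amp p.1.2 * trig i (p.1.2 * p.2.1) :=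
    Continuous.measurable (by fun_prop)
  exact h2.mul h1

lemma integrable_regularIntegrand (i : Fin 2) (hθ : Continuous θ) (hC : 0 ≤ C)
    (hθC : ∀ q, |θ q| ≤ C) (hθR : ∀ q, θ q ≠ 0 → ‖q‖ ≤ R) :
    Integrable (fun p : (ℝ × ℝ) × (ℝ × ℝ × ℝ) => (amp p.1.2 * trig i (p.1.2 * p.2.1)
      * modeKernel i p.1.2 p.2.2.1 (p.2.2.2 - p.1.1)) * θ p.2)
      (modeMeasure.prod (volume.restrict halfSpaceTime)) := by
  refine integrable_prod_halfSpaceTime_of_bound (κ := fun m => frequencyWeight m.2)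
    (σ := fun m => m.1) (measurable_regularIntegrand i) hθ hC ?_ ?_ hθC hθR
    (integrableOn_sum_rpow R) ?_ (integrable_indicator_rpow R) ?_ ?_
  · have h1 : IntegrableOn (fun _ : ℝ => (1 : ℝ)) (Ioo (1 / 2) 1) :=
      continuous_const.integrableOn_Icc.mono_set Ioo_subset_Icc_self
    exact (h1.mul_prod integrableOn_frequencyWeight).congr (ae_of_all _ fun _ => one_mul _)
  · exact ae_modeMeasure fun s _ k hk => by unfold frequencyWeight; positivity
  · intro b hb; positivity
  · intro t; exact indicator_nonneg (fun t ht => Real.rpow_nonneg ht.1.le _) t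
  · exact ae_modeMeasure fun s hs k hk x b hb t ht =>
      abs_amp_mul_modeKernel_le i (by linarith [hs.1]) hk x hb ht

lemma integrableOn_regularIntegrand (i : Fin 2) {s k : ℝ} (hs : 0 < s) (hk : 0 < k)
    (hθ : Continuous θ) (hC : 0 ≤ C)
    (hθC : ∀ q, |θ q| ≤ C) (hθR : ∀ q, θ q ≠ 0 → ‖q‖ ≤ R) :
    IntegrableOn (fun q : ℝ × ℝ × ℝ => (amp k * trig i (k * q.1)
      * modeKernel i k q.2.1 (q.2.2 - s)) * θ q) halfSpaceTime := by
  refine (integrableOn_halfSpaceTime_of_bound (κ := frequencyWeight k) (σ := s) ?_ hθ hC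
    (by unfold frequencyWeight; positivity) hθC hθR
    (integrableOn_sum_rpow R) ?_ (integrable_indicator_rpow R) ?_ ?_).1
  · exact (measurable_regularIntegrand i).comp (measurable_prodMk_left (x := (s, k)))
  · intro b hb; positivity
  · intro t; exact indicator_nonneg (fun t ht => Real.rpow_nonneg ht.1.le _) t
  · exact fun x b hb t ht => abs_amp_mul_modeKernel_le i hs hk x hb ht

lemma exp_neg_mul_le_rpow {k b : ℝ} (hk : 0 < k) (hb : 0 < b) :
    Real.exp (-(k * b)) ≤ k ^ (-(1 / 2) : ℝ) * b ^ (-(1 / 2) : ℝ) := by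
  rw [← Real.mul_rpow hk.le hb.le]
  exact exp_neg_le_rpow (by positivity) (by norm_num) (by norm_num)

lemma measurable_harmonicIntegrand (i : Fin 2) : Measurable (Function.uncurry
    fun (k : ℝ) (q : ℝ × ℝ × ℝ) => amp k * trig i (k * q.1) * Real.exp (-(k * q.2.1))
      * (Ioo (1 / 2 : ℝ) 1).indicator 1 q.2.2) := by
  have h1 : Measurable fun p : ℝ × (ℝ × ℝ × ℝ) =>
      (Ioo (1 / 2 : ℝ) 1).indicator (1 : ℝ → ℝ) p.2.2.2 :=
    (measurable_one.indicator measurableSet_Ioo).comp (by fun_prop)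
  have h2 : Measurable fun p : ℝ × (ℝ × ℝ × ℝ) =>
      amp p.1 * trig i (p.1 * p.2.1) * Real.exp (-(p.1 * p.2.2.1)) :=
    Continuous.measurable (by fun_prop)
  exact h2.mul h1

lemma abs_harmonicIntegrand_le (i : Fin 2) {k : ℝ} (hk : 0 < k) (x : ℝ) {b t : ℝ}
    (hb : b ∈ Ioc 0 R) (ht : t ∈ Ioc 0 R) :
    |amp k * trig i (k * x) * Real.exp (-(k * b)) * (Ioo (1 / 2 : ℝ) 1).indicator 1 t|
      ≤ (|amp k| * k ^ (-(1 / 2) : ℝ)) * (b ^ (-(1 / 2) : ℝ)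
        * (Ioc 0 R).indicator (fun _ => 1) (t - 0)) := by
  have hb0 := hb.1
  rw [sub_zero, indicator_of_mem ht, mul_one, abs_mul, abs_mul, abs_mul, Real.abs_exp]
  have h1 : |(Ioo (1 / 2 : ℝ) 1).indicator (1 : ℝ → ℝ) t| ≤ 1 := by
    by_cases h : t ∈ Ioo (1 / 2 : ℝ) 1
    · rw [indicator_of_mem h, Pi.one_apply, abs_one]
    · rw [indicator_of_notMem h, abs_zero]; exact zero_le_one
  calc _ ≤ |amp k| * 1 * (k ^ (-(1 / 2) : ℝ) * b ^ (-(1 / 2) : ℝ)) * 1 := by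
        gcongr
        · exact abs_trig_le i _
        · exact exp_neg_mul_le_rpow hk hb0
    _ = _ := by ring

lemma integrable_indicator_one (R : ℝ) : Integrable ((Ioc 0 R).indicator (fun _ : ℝ => (1 : ℝ))) :=
  (integrable_indicator_iff measurableSet_Ioc).2
    (continuous_const.integrableOn_Icc.mono_set Ioc_subset_Icc_self)

lemma integrable_harmonicIntegrand (i : Fin 2) (hθ : Continuous θ) (hC : 0 ≤ C)
    (hθC : ∀ q, |θ q| ≤ C) (hθR : ∀ q, θ q ≠ 0 → ‖q‖ ≤ R) :
    Integrable (fun p : ℝ × (ℝ × ℝ × ℝ) => (amp p.1 * trig i (p.1 * p.2.1)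
      * Real.exp (-(p.1 * p.2.2.1)) * (Ioo (1 / 2 : ℝ) 1).indicator 1 p.2.2.2) * θ p.2)
      ((volume.restrict (Ioi 0)).prod (volume.restrict halfSpaceTime)) := by
  refine integrable_prod_halfSpaceTime_of_bound (κ := fun k => |amp k| * k ^ (-(1 / 2) : ℝ))
    (σ := fun _ => 0) (measurable_harmonicIntegrand i) hθ hC
    (integrableOn_amp_mul_rpow (by norm_num) (by norm_num)) ?_ hθC hθR
    (integrableOn_rpow_Ioc (r := (-(1 / 2) : ℝ)) (by norm_num)) ?_ (integrable_indicator_one R) ?_ ?_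
  · refine (ae_restrict_iff' measurableSet_Ioi).2 (ae_of_all _ fun k hk => ?_)
    have : (0 : ℝ) < k := hk
    positivity
  · intro b hb; positivity
  · intro t; exact indicator_nonneg (fun _ _ => zero_le_one) t
  · exact (ae_restrict_iff' measurableSet_Ioi).2 (ae_of_all _ fun k hk x b hb t ht =>
      abs_harmonicIntegrand_le i hk x hb ht)

lemma integrableOn_harmonicIntegrand (i : Fin 2) {k : ℝ} (hk : 0 < k) (hθ : Continuous θ)
    (hC : 0 ≤ C) (hθC : ∀ q, |θ q| ≤ C) (hθR : ∀ q, θ q ≠ 0 → ‖q‖ ≤ R) :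
    IntegrableOn (fun q : ℝ × ℝ × ℝ => (amp k * trig i (k * q.1)
      * Real.exp (-(k * q.2.1)) * (Ioo (1 / 2 : ℝ) 1).indicator 1 q.2.2) * θ q) halfSpaceTime := by
  refine (integrableOn_halfSpaceTime_of_bound (κ := |amp k| * k ^ (-(1 / 2) : ℝ)) (σ := 0)
    ?_ hθ hC (by positivity) hθC hθR
    (integrableOn_rpow_Ioc (r := (-(1 / 2) : ℝ)) (by norm_num)) ?_
    (integrable_indicator_one R) ?_ ?_).1
  · exact (measurable_harmonicIntegrand i).comp (measurable_prodMk_left (x := k))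
  · intro b hb; positivity
  · intro t; exact indicator_nonneg (fun _ _ => zero_le_one) t
  · exact fun x b hb t ht => abs_harmonicIntegrand_le i hk x hb ht

/-- The velocity tested against `θ`, with the integrals over modes written over one product space. -/
lemma velocity_mul_ae_eq (i : Fin 2) (hθ : Continuous θ) (hc : HasCompactSupport θ) :
    (fun q : ℝ × ℝ × ℝ => velocity datum i q.1 q.2.1 q.2.2 * θ q)
      =ᵐ[volume.restrict halfSpaceTime] fun q =>
        (∫ m, (amp m.2 * trig i (m.2 * q.1) * modeKernel i m.2 q.2.1 (q.2.2 - m.1)) * θ q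
            ∂modeMeasure)
        + ∫ k in Ioi (0 : ℝ), (amp k * trig i (k * q.1)
            * Real.exp (-(k * q.2.1)) * (Ioo (1 / 2 : ℝ) 1).indicator 1 q.2.2) * θ q := by
  obtain ⟨C, R, hC, hR, hθC, hθR⟩ := exists_bound_of_hasCompactSupport hθ hc
  filter_upwards [(integrable_regularIntegrand i hθ hC hθC hθR).prod_left_ae,
    ae_restrict_mem measurableSet_halfSpaceTime] with q hq1 hq2
  rw [velocity_datum_eq i q.1 hq2.1 hq2.2, add_mul]
  congr 1
  · unfold modeMeasure at hq1 ⊢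
    rw [integral_prod _ hq1, ← integral_mul_const]
    congr 1; ext s
    rw [← integral_mul_const]
  · rw [mul_comm _ (∫ k in Ioi (0 : ℝ), _), ← integral_mul_const, ← integral_mul_const]

lemma integrableOn_velocity_mul (i : Fin 2) (hθ : Continuous θ) (hc : HasCompactSupport θ) :
    IntegrableOn (fun q : ℝ × ℝ × ℝ => velocity datum i q.1 q.2.1 q.2.2 * θ q) halfSpaceTime := by
  obtain ⟨C, R, hC, hR, hθC, hθR⟩ := exists_bound_of_hasCompactSupport hθ hc
  exact ((integrable_regularIntegrand i hθ hC hθC hθR).integral_prod_right.add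
    (integrable_harmonicIntegrand i hθ hC hθC hθR).integral_prod_right).congr
    (velocity_mul_ae_eq i hθ hc).symm

lemma integrable_modeMeasure_harmonic (i : Fin 2) (hθ : Continuous θ) (hR : 0 < R)
    (hθC : ∀ q, |θ q| ≤ C) (hθR : ∀ q, θ q ≠ 0 → ‖q‖ ≤ R) :
    Integrable (fun m : ℝ × ℝ => amp m.2
      * ∫ b in Ioi (0 : ℝ), Real.exp (-(m.2 * b)) * tangential i m.2 θ (b, m.1)) modeMeasure := by
  have h1 : IntegrableOn (fun _ : ℝ => (1 : ℝ)) (Ioo (1 / 2) 1) :=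
    continuous_const.integrableOn_Icc.mono_set Ioo_subset_Icc_self
  have h2 := h1.mul_prod (integrableOn_amp_mul_rpow (r := (-(1 / 2) : ℝ)) (by norm_num) (by norm_num))
  have hβ := integrableOn_rpow_Ioc (b := R) (r := (-(1 / 2) : ℝ)) (by norm_num)
  have hβi : Integrable ((Ioc 0 R).indicator fun b : ℝ => b ^ (-(1 / 2) : ℝ)) :=
    (integrable_indicator_iff measurableSet_Ioc).2 hβ
  set B := ∫ b in Ioi (0 : ℝ), (Ioc 0 R).indicator (fun b : ℝ => b ^ (-(1 / 2) : ℝ)) b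
  refine Integrable.mono' (h2.const_mul (C * (2 * R) * B)) ?_ ?_
  · have hm : Measurable (fun p : (ℝ × ℝ) × ℝ => Real.exp (-(p.1.2 * p.2))
        * tangential i p.1.2 θ (p.2, p.1.1)) := by
      have := (measurable_tangential i hθ).comp
        (f := fun p : (ℝ × ℝ) × ℝ => (p.1.2, p.2, p.1.1)) (by fun_prop)
      exact Measurable.mul (by fun_prop) this
    have hm2 := (hm.stronglyMeasurable.integral_prod_right'
      (ν := volume.restrict (Ioi (0 : ℝ)))).measurable
    have hm3 : Measurable fun m : ℝ × ℝ => amp m.2 := Continuous.measurable (by fun_prop)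
    exact (hm3.mul hm2).aestronglyMeasurable
  · refine ae_modeMeasure fun s hs k hk => ?_
    have hin : ‖∫ b in Ioi (0 : ℝ), Real.exp (-(k * b)) * tangential i k θ (b, s)‖
        ≤ ∫ b in Ioi (0 : ℝ), (C * (2 * R) * k ^ (-(1 / 2) : ℝ))
          * (Ioc 0 R).indicator (fun b : ℝ => b ^ (-(1 / 2) : ℝ)) b := by
      refine norm_integral_le_of_norm_le (hβi.restrict.const_mul _) ?_
      refine (ae_restrict_iff' measurableSet_Ioi).2 (ae_of_all _ fun b hb => ?_)
      rw [norm_mul, Real.norm_eq_abs, Real.norm_eq_abs, Real.abs_exp]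
      by_cases hbR : b ≤ R
      · rw [indicator_of_mem (show b ∈ Ioc 0 R from ⟨hb, hbR⟩)]
        have e1 := exp_neg_mul_le_rpow hk hb
        have e2 := abs_tangential_le i k hR hθC hθR (b, s)
        calc _ ≤ (k ^ (-(1 / 2) : ℝ) * b ^ (-(1 / 2) : ℝ)) * (C * (2 * R)) := by
              have : (0 : ℝ) < b := hb
              gcongr
          _ = _ := by ring
      · rw [indicator_of_notMem (fun h => hbR h.2), tangential_eq_zero i k hθR]
        · simp
        · rw [Prod.norm_def]
          exact lt_of_lt_of_le (lt_of_lt_of_le (not_le.1 hbR) (le_abs_self b)) (le_max_left _ _)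
    rw [integral_const_mul] at hin
    rw [norm_mul]
    calc _ ≤ ‖amp k‖ * (C * (2 * R) * k ^ (-(1 / 2) : ℝ) * B) := by gcongr
      _ = _ := by rw [Real.norm_eq_abs]; ring

lemma integral_regular_eq (i : Fin 2) {s k : ℝ} (hs : 0 < s) (hk : 0 < k)
    (hθ : Continuous θ) (hc : HasCompactSupport θ) :
    ∫ q in halfSpaceTime, (amp k * trig i (k * q.1)
      * modeKernel i k q.2.1 (q.2.2 - s)) * θ q
      = amp k * ∫ p in quadrant, modeKernel i k p.1 (p.2 - s) * tangential i k θ p := by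
  obtain ⟨C, R, hC, hR, hθC, hθR⟩ := exists_bound_of_hasCompactSupport hθ hc
  rw [setIntegral_halfSpaceTime_eq (integrableOn_regularIntegrand i hs hk hθ hC hθC hθR),
    ← integral_const_mul]
  congr 1; ext p
  rw [tangential, ← integral_const_mul, ← integral_const_mul]
  congr 1; ext x; ring

lemma integral_harmonic_eq (i : Fin 2) {k : ℝ} (hk : 0 < k)
    (hθ : Continuous θ) (hc : HasCompactSupport θ) :
    ∫ q in halfSpaceTime, (amp k * trig i (k * q.1)
      * Real.exp (-(k * q.2.1)) * (Ioo (1 / 2 : ℝ) 1).indicator 1 q.2.2) * θ q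
      = ∫ s in Ioo (1 / 2 : ℝ) 1, amp k
        * ∫ b in Ioi (0 : ℝ), Real.exp (-(k * b)) * tangential i k θ (b, s) := by
  obtain ⟨C, R, hC, hR, hθC, hθR⟩ := exists_bound_of_hasCompactSupport hθ hc
  have hi := integrableOn_harmonicIntegrand i hk hθ hC hθC hθR
  rw [setIntegral_halfSpaceTime_eq hi]
  have e : ∀ p : ℝ × ℝ, ∫ x, (amp k * trig i (k * x)
      * Real.exp (-(k * p.1)) * (Ioo (1 / 2 : ℝ) 1).indicator 1 p.2) * θ (x, p)
      = amp k * (Real.exp (-(k * p.1)) * tangential i k θ p)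
        * (Ioo (1 / 2 : ℝ) 1).indicator 1 p.2 := by
    intro p
    rw [tangential, ← integral_const_mul, ← integral_const_mul, ← integral_mul_const]
    congr 1; ext x; ring
  have hi2 : Integrable (fun p : ℝ × ℝ => amp k * (Real.exp (-(k * p.1)) * tangential i k θ p)
        * (Ioo (1 / 2 : ℝ) 1).indicator 1 p.2)
      ((volume.restrict (Ioi (0 : ℝ))).prod (volume.restrict (Ioi (0 : ℝ)))) := by
    unfold IntegrableOn at hi
    rw [volume_restrict_halfSpaceTime] at hi
    have := hi.integral_prod_right
    rw [volume_restrict_quadrant] at this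
    exact this.congr (ae_of_all _ e)
  rw [setIntegral_congr_fun measurableSet_quadrant fun p _ => e p, volume_restrict_quadrant,
    integral_prod_symm _ hi2, ← integral_indicator measurableSet_Ioi,
    ← integral_indicator measurableSet_Ioo]
  congr 1; ext t
  by_cases ht : t ∈ Ioo (1 / 2 : ℝ) 1
  · rw [indicator_of_mem ht, indicator_of_mem (show t ∈ Ioi (0 : ℝ) from by
      have := ht.1; simp only [mem_Ioi]; linarith), ← integral_const_mul]
    simp only [indicator_of_mem ht, Pi.one_apply, mul_one]
  · rw [indicator_of_notMem ht]
    by_cases ht0 : t ∈ Ioi (0 : ℝ)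
    · rw [indicator_of_mem ht0]
      simp only [indicator_of_notMem ht, mul_zero, integral_zero]
    · rw [indicator_of_notMem ht0]

/-- The pairing of the velocity with a test function is the superposition of the mode pairings. -/
theorem integral_velocity_mul (i : Fin 2) (hθ : Continuous θ) (hc : HasCompactSupport θ) :
    Integrable (fun m : ℝ × ℝ => amp m.2 * modePairing i m.2 m.1 θ) modeMeasure ∧
    ∫ q in halfSpaceTime, velocity datum i q.1 q.2.1 q.2.2 * θ q
      = ∫ m, amp m.2 * modePairing i m.2 m.1 θ ∂modeMeasure := by
  obtain ⟨C, R, hC, hR, hθC, hθR⟩ := exists_bound_of_hasCompactSupport hθ hc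
  have hA := integrable_regularIntegrand i hθ hC hθC hθR
  have hB := integrable_harmonicIntegrand i hθ hC hθC hθR
  have hA2 : Integrable (fun m : ℝ × ℝ => amp m.2 * ∫ p in quadrant,
      modeKernel i m.2 p.1 (p.2 - m.1) * tangential i m.2 θ p) modeMeasure :=
    hA.integral_prod_left.congr (ae_modeMeasure fun s hs k hk =>
      integral_regular_eq i (by linarith [hs.1]) hk hθ hc)
  have hB2 := integrable_modeMeasure_harmonic i hθ hR hθC hθR
  have hsum : ∀ m : ℝ × ℝ, amp m.2 * modePairing i m.2 m.1 θ
      = amp m.2 * (∫ p in quadrant, modeKernel i m.2 p.1 (p.2 - m.1) * tangential i m.2 θ p)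
        + amp m.2 * ∫ b in Ioi (0 : ℝ), Real.exp (-(m.2 * b)) * tangential i m.2 θ (b, m.1) :=
    fun m => mul_add _ _ _
  simp_rw [hsum]
  refine ⟨hA2.add hB2, ?_⟩
  rw [integral_add hA2 hB2, integral_congr_ae (velocity_mul_ae_eq i hθ hc),
    integral_add hA.integral_prod_right hB.integral_prod_right]
  congr 1
  · rw [integral_integral_swap (f := fun (q : ℝ × ℝ × ℝ) (m : ℝ × ℝ) => (amp m.2 * trig i (m.2 * q.1)
      * modeKernel i m.2 q.2.1 (q.2.2 - m.1)) * θ q) hA.swap]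
    exact integral_congr_ae (ae_modeMeasure fun s hs k hk =>
      integral_regular_eq i (by linarith [hs.1]) hk hθ hc)
  · rw [integral_integral_swap (f := fun q k => (amp k * trig i (k * q.1)
      * Real.exp (-(k * q.2.1)) * (Ioo (1 / 2 : ℝ) 1).indicator 1 q.2.2) * θ q) hB.swap]
    rw [setIntegral_congr_fun measurableSet_Ioi fun k hk => integral_harmonic_eq i hk hθ hc]
    unfold modeMeasure at hB2 ⊢
    rw [integral_prod_symm _ hB2]

end Superposition

lemma closedHalfSpaceTime_ae_eq : closedHalfSpaceTime =ᵐ[volume] halfSpaceTime := by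
  have h1 : closedHalfSpaceTime = univ ×ˢ (Ici 0 ×ˢ Ici 0) := by
    ext q; simp [closedHalfSpaceTime, mem_prod, -Ici_prod_Ici]
  rw [h1, halfSpaceTime_eq, quadrant]
  exact Measure.set_prod_ae_eq (ae_eq_refl _)
    (Measure.set_prod_ae_eq Ioi_ae_eq_Ici.symm Ioi_ae_eq_Ici.symm)

/-- A test function that is `1` near a given point reduces local integrability to the integrability
of the tested velocity. -/
lemma locallyIntegrableOn_velocity (i : Fin 2) : LocallyIntegrableOn
    (fun q : ℝ × ℝ × ℝ => velocity datum i q.1 q.2.1 q.2.2) closedHalfSpaceTime := by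
  intro q₀ _
  obtain ⟨θ, hθ1, -, hθc, -⟩ := exists_continuous_one_zero_of_isCompact
    (isCompact_closedBall q₀ 1) isClosed_empty (disjoint_empty _)
  refine ⟨closedHalfSpaceTime ∩ Metric.closedBall q₀ 1,
    inter_mem_nhdsWithin _ (Metric.closedBall_mem_nhds q₀ one_pos), ?_⟩
  have h1 := (integrableOn_velocity_mul i θ.continuous hθc).mono_set
    (inter_subset_left (t := Metric.closedBall q₀ 1))
  have h2 : IntegrableOn (fun q : ℝ × ℝ × ℝ => velocity datum i q.1 q.2.1 q.2.2)
      (halfSpaceTime ∩ Metric.closedBall q₀ 1) :=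
    h1.congr_fun (fun q hq => by simp only [hθ1 hq.2, Pi.one_apply, mul_one])
      (measurableSet_halfSpaceTime.inter Metric.isClosed_closedBall.measurableSet)
  exact h2.congr_set_ae (closedHalfSpaceTime_ae_eq.inter (ae_eq_refl _))

/-! ### Tangential transforms of test functions -/

/-- The derivative of a function of `(x₁, x₂, t)` in the direction `v`. -/
noncomputable def dirDeriv (v : ℝ × ℝ × ℝ) (f : ℝ × ℝ × ℝ → ℝ) (q : ℝ × ℝ × ℝ) : ℝ :=
  fderiv ℝ f q v

lemma pd_zero_eq : pd 0 = dirDeriv (1, 0, 0) := by ext f q; simp [pd, dir, dirDeriv]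
lemma pd_one_eq : pd 1 = dirDeriv (0, 1, 0) := by ext f q; simp [pd, dir, dirDeriv]
lemma pdt_eq : pdt = dirDeriv (0, 0, 1) := rfl

section DirDeriv

variable {f g : ℝ × ℝ × ℝ → ℝ} (v w : ℝ × ℝ × ℝ)

lemma contDiff_dirDeriv (hf : ContDiff ℝ ∞ f) : ContDiff ℝ ∞ (dirDeriv v f) :=
  (hf.fderiv_right (m := ∞) (by simp)).clm_apply contDiff_const

lemma hasCompactSupport_dirDeriv (hf : HasCompactSupport f) : HasCompactSupport (dirDeriv v f) :=
  hf.fderiv_apply (𝕜 := ℝ) v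

lemma dirDeriv_add (hf : ContDiff ℝ ∞ f) (hg : ContDiff ℝ ∞ g) :
    dirDeriv v (f + g) = dirDeriv v f + dirDeriv v g := by
  ext q
  simp [dirDeriv, fderiv_add (hf.differentiable (by simp) q) (hg.differentiable (by simp) q)]

lemma dirDeriv_const_smul (c : ℝ) (hf : ContDiff ℝ ∞ f) :
    dirDeriv v (c • f) = c • dirDeriv v f := by
  ext q
  simp [dirDeriv, fderiv_const_smul (hf.differentiable (by simp) q)]

lemma dirDeriv_comm (hf : ContDiff ℝ ∞ f) :
    dirDeriv v (dirDeriv w f) = dirDeriv w (dirDeriv v f) := by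
  ext q
  have h : IsSymmSndFDerivAt ℝ f q := by
    refine hf.contDiffAt.isSymmSndFDerivAt ?_
    rw [minSmoothness_of_isRCLikeNormedField]
    exact WithTop.coe_le_coe.2 (by simp)
  have hd : DifferentiableAt ℝ (fderiv ℝ f) q :=
    (hf.fderiv_right (m := ∞) (by simp)).differentiable (by simp) q
  have key : ∀ a b : ℝ × ℝ × ℝ, dirDeriv a (dirDeriv b f) q = fderiv ℝ (fderiv ℝ f) q a b := by
    intro a b
    have : dirDeriv b f = fun q => fderiv ℝ f q b := rfl
    rw [dirDeriv, this, fderiv_clm_apply hd (differentiableAt_const b)]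
    simp
  rw [key, key]
  exact h v w

/-- The derivative of `f` along a line vanishes at a point near which `f` is zero on this line. -/
lemma dirDeriv_eq_zero (hf : ContDiff ℝ ∞ f) {q : ℝ × ℝ × ℝ}
    (h : ∀ᶠ c : ℝ in 𝓝 0, f (q + c • v) = 0) : dirDeriv v f q = 0 := by
  have h1 : HasFDerivAt f (fderiv ℝ f q) (q + (0 : ℝ) • v) := by
    simpa using (hf.differentiable (by simp) q).hasFDerivAt
  have h2 : HasDerivAt (fun c : ℝ => q + c • v) v 0 := by
    simpa using ((hasDerivAt_id (0 : ℝ)).smul_const v).const_add q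
  have h3 := h1.comp_hasDerivAt (0 : ℝ) h2
  have h4 : HasDerivAt (f ∘ fun c : ℝ => q + c • v) 0 0 :=
    (hasDerivAt_const (0 : ℝ) (0 : ℝ)).congr_of_eventuallyEq (by
      filter_upwards [h] with c hc using hc)
  exact h3.unique h4

end DirDeriv

section Tangential

variable {θ : ℝ × ℝ × ℝ → ℝ}

lemma integrable_trig_mul (i : Fin 2) (k : ℝ) (hθ : Continuous θ) (hc : HasCompactSupport θ)
    (p : ℝ × ℝ) : Integrable fun x => trig i (k * x) * θ (x, p) := by
  obtain ⟨C, R, hC, hR, hθC, hθR⟩ := exists_bound_of_hasCompactSupport hθ hc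
  refine Continuous.integrable_of_hasCompactSupport (by fun_prop) ?_
  refine HasCompactSupport.intro (isCompact_closedBall (0 : ℝ) R) fun x hx => ?_
  have : θ (x, p) = 0 := by
    by_contra h
    have h2 := hθR _ h
    rw [Prod.norm_def, sup_le_iff] at h2
    exact hx (by simpa using h2.1)
  rw [this, mul_zero]

lemma tangential_add (i : Fin 2) (k : ℝ) {θ' : ℝ × ℝ × ℝ → ℝ} (hθ : Continuous θ)
    (hc : HasCompactSupport θ) (hθ' : Continuous θ') (hc' : HasCompactSupport θ') :
    tangential i k (θ + θ') = tangential i k θ + tangential i k θ' := by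
  ext p
  simp only [tangential, Pi.add_apply, mul_add]
  exact integral_add (integrable_trig_mul i k hθ hc p) (integrable_trig_mul i k hθ' hc' p)

lemma tangential_const_smul (i : Fin 2) (k c : ℝ) (θ : ℝ × ℝ × ℝ → ℝ) :
    tangential i k (c • θ) = c • tangential i k θ := by
  ext p
  simp only [tangential, Pi.smul_apply, smul_eq_mul]
  rw [← integral_const_mul]
  congr 1; ext x; ring

/-- The integrands of tangential transforms are dominated uniformly in `(x₂, t)`; the vector-valued form
covers the Fréchet derivative. -/
lemma exists_dominating (i : Fin 2) (k : ℝ) {E : Type*} [NormedAddCommGroup E] [NormedSpace ℝ E]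
    {θ : ℝ × ℝ × ℝ → E} (hθ : Continuous θ) (hc : HasCompactSupport θ) :
    ∃ g : ℝ → ℝ, Integrable g ∧ ∀ p x, ‖trig i (k * x) • θ (x, p)‖ ≤ g x := by
  obtain ⟨C, R, hC, hR, hθC, hθR⟩ := exists_bound_of_hasCompactSupport hθ.norm hc.norm
  refine ⟨(Icc (-R) R).indicator fun _ => C, (integrable_indicator_iff measurableSet_Icc).2
    continuous_const.integrableOn_Icc, fun p x => ?_⟩
  by_cases hx : x ∈ Icc (-R) R
  · rw [indicator_of_mem hx, norm_smul]
    have := (le_abs_self _).trans (hθC (x, p))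
    calc _ ≤ 1 * C := mul_le_mul (abs_trig_le i _) this (norm_nonneg _) zero_le_one
      _ = C := one_mul C
  · have : θ (x, p) = 0 := by
      by_contra h
      have := hθR _ (norm_ne_zero_iff.2 h)
      rw [Prod.norm_def, sup_le_iff] at this
      exact hx (abs_le.1 this.1)
    simp [this, hx]

lemma continuous_tangential (i : Fin 2) (k : ℝ) (hθ : Continuous θ) (hc : HasCompactSupport θ) :
    Continuous (tangential i k θ) := by
  obtain ⟨g, hg, hle⟩ := exists_dominating i k hθ hc
  refine continuous_of_dominated (bound := g) (fun p => ?_) (fun p => ?_) hg ?_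
  · exact Continuous.aestronglyMeasurable (by fun_prop)
  · exact ae_of_all _ fun x => hle p x
  · exact ae_of_all _ fun x => by fun_prop

lemma hasFDerivAt_tangential (i : Fin 2) (k : ℝ) (hθ : ContDiff ℝ ∞ θ) (hc : HasCompactSupport θ)
    (p : ℝ × ℝ) : ∃ L : ℝ × ℝ →L[ℝ] ℝ, HasFDerivAt (tangential i k θ) L p ∧
      ∀ v, L v = tangential i k (dirDeriv (0, v) θ) p := by
  have hcd : Continuous (fderiv ℝ θ) := hθ.continuous_fderiv (by simp)
  obtain ⟨g, hg, hle⟩ := exists_dominating i k hcd (hc.fderiv ℝ)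
  set F' : ℝ × ℝ → ℝ → (ℝ × ℝ →L[ℝ] ℝ) := fun p x =>
    trig i (k * x) • (fderiv ℝ θ (x, p)).comp (ContinuousLinearMap.inr ℝ ℝ (ℝ × ℝ)) with hF'
  have hbd : ∀ p x, ‖F' p x‖ ≤ g x := fun p x => by
    refine le_trans ?_ (hle p x)
    rw [hF', norm_smul, norm_smul]
    gcongr
    exact (ContinuousLinearMap.opNorm_comp_le _ _).trans
      (mul_le_of_le_one_right (norm_nonneg _) (ContinuousLinearMap.norm_inr_le_one ℝ ℝ (ℝ × ℝ)))
  have hcont : ∀ p, Continuous (F' p) := fun p => by rw [hF']; fun_prop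
  have hint : Integrable (F' p) :=
    hg.mono' (hcont p).aestronglyMeasurable (ae_of_all _ (hbd p))
  refine ⟨∫ x, F' p x, ?_, fun v => ?_⟩
  · refine hasFDerivAt_integral_of_dominated_of_fderiv_le (s := univ) (bound := g) univ_mem ?_ ?_
      (hcont p).aestronglyMeasurable (ae_of_all _ fun x p _ => hbd p x) hg
      (ae_of_all _ fun x p _ => ?_)
    · have := hθ.continuous
      exact Eventually.of_forall fun p => Continuous.aestronglyMeasurable (by fun_prop)
    · exact integrable_trig_mul i k hθ.continuous hc p
    · have h1 : HasFDerivAt θ (fderiv ℝ θ (x, p)) (x, p) :=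
        (hθ.differentiable (by simp) _).hasFDerivAt
      exact (h1.comp p (hasFDerivAt_prodMk_right x p)).const_mul _
  · rw [ContinuousLinearMap.integral_apply hint]
    simp [hF', tangential, dirDeriv]

lemma hasDerivAt_tangential (i : Fin 2) (k : ℝ) (hθ : ContDiff ℝ ∞ θ) (hc : HasCompactSupport θ)
    (b t : ℝ) : HasDerivAt (fun b => tangential i k θ (b, t))
      (tangential i k (pd 1 θ) (b, t)) b := by
  obtain ⟨L, hL, hLv⟩ := hasFDerivAt_tangential i k hθ hc (b, t)
  have h2 : HasDerivAt (fun b : ℝ => (b, t)) ((1, 0) : ℝ × ℝ) b :=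
    (hasDerivAt_id b).prodMk (hasDerivAt_const b t)
  have := hL.comp_hasDerivAt b h2
  rw [hLv] at this
  rw [pd_one_eq]
  exact this

/-- Integration by parts in the tangential variable. -/
lemma tangential_pd_zero (i : Fin 2) (k : ℝ) (hθ : ContDiff ℝ ∞ θ) (hc : HasCompactSupport θ)
    (p : ℝ × ℝ) : tangential i k (pd 0 θ) p
      = (if i = 0 then -k else k) * tangential (1 - i) k θ p := by
  have hcont := (contDiff_dirDeriv (1, 0, 0) hθ).continuous
  have hcs := hasCompactSupport_dirDeriv (1, 0, 0) hc
  have hv : ∀ x : ℝ, HasDerivAt (fun x => θ (x, p)) (dirDeriv (1, 0, 0) θ (x, p)) x := by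
    intro x
    have h1 : HasFDerivAt θ (fderiv ℝ θ (x, p)) (x, p) :=
      (hθ.differentiable (by simp) _).hasFDerivAt
    have h2 : HasDerivAt (fun x : ℝ => (x, p)) ((1, 0) : ℝ × (ℝ × ℝ)) x :=
      (hasDerivAt_id x).prodMk (hasDerivAt_const x p)
    exact h1.comp_hasDerivAt x h2
  have hu : ∀ x : ℝ, HasDerivAt (fun x => trig i (k * x))
      ((if i = 0 then k else -k) * trig (1 - i) (k * x)) x := by
    intro x
    have h0 : HasDerivAt (fun x => k * x) k x := by simpa using (hasDerivAt_id x).const_mul k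
    fin_cases i
    · simpa [trig, mul_comm] using h0.sin
    · simpa [trig, mul_comm] using h0.cos
  have h := integral_mul_deriv_eq_deriv_mul_of_integrable
    (u := fun x => trig i (k * x)) (v := fun x => θ (x, p)) (fun x _ => hu x) (fun x _ => hv x)
    (integrable_trig_mul i k hcont hcs p)
    (by
      have := (integrable_trig_mul (1 - i) k hθ.continuous hc p).const_mul (if i = 0 then k else -k)
      refine this.congr (ae_of_all _ fun x => ?_)
      simp only [Pi.mul_apply]; ring)
    (integrable_trig_mul i k hθ.continuous hc p)
  rw [pd_zero_eq, tangential, h, tangential, ← integral_const_mul, ← integral_neg]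
  congr 1; ext x
  split_ifs <;> ring

end Tangential

/-! ### The heat equation on the half line -/

lemma hasCompactSupport_slice {f : ℝ × ℝ → ℝ} (hf : HasCompactSupport f) (t : ℝ) :
    HasCompactSupport fun b => f (b, t) := by
  refine HasCompactSupport.intro (hf.isCompact.image continuous_fst) fun b hb => ?_
  by_contra h
  exact hb ⟨(b, t), subset_tsupport _ h, rfl⟩

/-- The fundamental theorem of calculus on the half line for a function that vanishes far out. -/
lemma integral_Ioi_of_hasDerivAt_of_eq_zero {f f' : ℝ → ℝ} {R : ℝ}
    (hc : ContinuousWithinAt f (Ici 0) 0) (hd : ∀ b, 0 < b → HasDerivAt f (f' b) b)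
    (hi : IntegrableOn f' (Ioi 0)) (h0 : ∀ b, R < b → f b = 0) :
    ∫ b in Ioi (0 : ℝ), f' b = -f 0 := by
  rw [integral_Ioi_of_hasDerivAt_of_tendsto (m := 0) hc hd hi, zero_sub]
  exact tendsto_const_nhds.congr' (by
    filter_upwards [Ioi_mem_atTop R] with b hb using (h0 b hb).symm)

lemma hasDerivAt_two_mul_gauss {τ : ℝ} (hτ : 0 < τ) (b : ℝ) :
    HasDerivAt (fun b => 2 * gauss τ b) (-heatPoisson b τ) b := by
  have h1 : HasDerivAt (fun b : ℝ => -((4 * τ)⁻¹ * b ^ 2)) (-((4 * τ)⁻¹ * (2 * b))) b := by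
    refine ((hasDerivAt_pow 2 b).const_mul (4 * τ)⁻¹).neg.congr_deriv ?_
    norm_num
  refine ((h1.exp.const_mul (Real.sqrt (4 * Real.pi * τ))⁻¹).const_mul 2).congr_deriv ?_
  have : Real.sqrt (4 * Real.pi * τ) ≠ 0 := (Real.sqrt_pos.2 (by positivity)).ne'
  have h2 : -b ^ 2 / (4 * τ) = -((4 * τ)⁻¹ * b ^ 2) := by field_simp
  rw [heatPoisson, h2]
  field_simp
  ring

@[fun_prop]
lemma continuous_gauss (t : ℝ) : Continuous (gauss t) := by unfold gauss; fun_prop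

lemma integrable_mul_gauss_one : Integrable fun w => w * gauss 1 w := by
  have h5 : Integrable (fun x : ℝ => x * Real.exp (-((4 * 1)⁻¹ * x ^ 2))) := by
    simpa only [neg_mul] using integrable_mul_exp_neg_mul_sq (b := (4 * 1 : ℝ)⁻¹) (by positivity)
  refine (h5.const_mul (Real.sqrt (4 * Real.pi * 1))⁻¹).congr (ae_of_all _ fun x => ?_)
  simp only [gauss]; ring

lemma integral_Ioi_two_mul_gauss : ∫ w in Ioi (0 : ℝ), 2 * gauss 1 w = 1 := by
  have h := integral_gaussian_Ioi (4 * 1)⁻¹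
  simp only [neg_mul] at h
  simp only [gauss]
  rw [integral_const_mul, integral_const_mul, h]
  have h1 : Real.pi / (4 * 1)⁻¹ = 4 * Real.pi * 1 := by field_simp
  rw [h1]
  have : Real.sqrt (4 * Real.pi * 1) ≠ 0 := (Real.sqrt_pos.2 (by positivity)).ne'
  field_simp

lemma two_mul_gauss_scale {τ : ℝ} (hτ : 0 < τ) (w : ℝ) :
    2 * gauss 1 w = Real.sqrt τ * (2 * gauss τ (Real.sqrt τ * w)) := by
  have h1 : Real.sqrt (4 * Real.pi * τ) = Real.sqrt (4 * Real.pi * 1) * Real.sqrt τ := by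
    rw [mul_one, Real.sqrt_mul (by positivity)]
  have h2 : (4 * τ)⁻¹ * (Real.sqrt τ * w) ^ 2 = (4 * 1)⁻¹ * w ^ 2 := by
    rw [mul_pow, Real.sq_sqrt hτ.le]; field_simp
  have h3 := (Real.sqrt_pos.2 hτ).ne'
  rw [gauss, gauss, h1, h2]
  field_simp

lemma heatPoisson_scale {τ : ℝ} (hτ : 0 < τ) (w : ℝ) :
    2 * gauss 1 w * (w / (2 * Real.sqrt τ))
      = Real.sqrt τ * heatPoisson (Real.sqrt τ * w) τ := by
  have h1 : Real.sqrt (4 * Real.pi * τ) = Real.sqrt (4 * Real.pi * 1) * Real.sqrt τ := by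
    rw [mul_one, Real.sqrt_mul (by positivity)]
  have h2 : -(Real.sqrt τ * w) ^ 2 / (4 * τ) = -((4 * 1)⁻¹ * w ^ 2) := by
    rw [mul_pow, Real.sq_sqrt hτ.le]; field_simp
  have h3 := (Real.sqrt_pos.2 hτ).ne'
  have h4 : τ = Real.sqrt τ * Real.sqrt τ := (Real.mul_self_sqrt hτ.le).symm
  rw [gauss, heatPoisson, h1, h2]
  field_simp
  nth_rw 1 [h4]
  ring

lemma integral_scale {τ : ℝ} (hτ : 0 < τ) (f : ℝ → ℝ) :
    ∫ w in Ioi (0 : ℝ), Real.sqrt τ * f (Real.sqrt τ * w) = ∫ b in Ioi (0 : ℝ), f b := by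
  have h3 := Real.sqrt_pos.2 hτ
  rw [integral_const_mul, integral_comp_mul_left_Ioi f 0 h3, mul_zero, smul_eq_mul,
    mul_inv_cancel_left₀ h3.ne']

section HeatPairing

variable {k : ℝ} {P U V Q : ℝ × ℝ → ℝ}

lemma integrableOn_heatPoisson_mul {W : ℝ × ℝ → ℝ} (hWc : Continuous W) (hW : HasCompactSupport W)
    (k : ℝ) : IntegrableOn
      (fun p : ℝ × ℝ => Real.exp (-(k ^ 2 * p.2)) * heatPoisson p.1 p.2 * W p) quadrant := by
  obtain ⟨C, R, hC, hR, hWC, hWR⟩ := exists_bound_of_hasCompactSupport hWc hW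
  have hi1 : Integrable ((Ioc 0 R).indicator fun b : ℝ => b ^ (-(3 / 4) : ℝ)) :=
    (integrable_indicator_iff measurableSet_Ioc).2 (integrableOn_rpow_Ioc (by norm_num))
  have hi2 : Integrable ((Ioc 0 R).indicator fun b : ℝ => b ^ (-(5 / 8) : ℝ)) :=
    (integrable_indicator_iff measurableSet_Ioc).2 (integrableOn_rpow_Ioc (by norm_num))
  refine Integrable.mono' ((hi1.mul_prod hi2).const_mul (4 * C)).restrict ?_ ?_
  · have h1 : Measurable fun p : ℝ × ℝ => Real.exp (-(k ^ 2 * p.2)) := by fun_prop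
    exact ((h1.mul measurable_heatPoisson).mul hWc.measurable).aestronglyMeasurable
  · refine (ae_restrict_iff' measurableSet_quadrant).2 (ae_of_all _ ?_)
    rintro ⟨b, τ⟩ ⟨hb, hτ⟩
    simp only [mem_Ioi] at hb hτ
    by_cases h0 : W (b, τ) = 0
    · rw [h0, mul_zero, norm_zero]
      exact mul_nonneg (by positivity) (mul_nonneg
        (indicator_nonneg (fun x hx => Real.rpow_nonneg hx.1.le _) _)
        (indicator_nonneg (fun x hx => Real.rpow_nonneg hx.1.le _) _))
    · have hn := hWR _ h0
      simp only [Prod.norm_def, sup_le_iff, Real.norm_eq_abs] at hn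
      rw [indicator_of_mem (show b ∈ Ioc 0 R from ⟨hb, (abs_le.1 hn.1).2⟩),
        indicator_of_mem (show τ ∈ Ioc 0 R from ⟨hτ, (abs_le.1 hn.2).2⟩)]
      rw [norm_mul, norm_mul, Real.norm_of_nonneg (Real.exp_pos _).le,
        Real.norm_of_nonneg (heatPoisson_nonneg hb.le τ)]
      have h1 : Real.exp (-(k ^ 2 * τ)) ≤ 1 := by
        rw [Real.exp_le_one_iff]; have : 0 ≤ k ^ 2 * τ := by positivity
        linarith
      calc _ ≤ 1 * (4 * b ^ (-(3 / 4) : ℝ) * τ ^ (-(5 / 8) : ℝ)) * C := by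
            gcongr
            · exact heatPoisson_nonneg hb.le τ
            · exact heatPoisson_le_rpow hb hτ
            · exact hWC _
        _ = _ := by ring

/-- In the self-similar variable `w = b / √τ` the Gaussian does not depend on `τ`, so only the test
function is differentiated. -/
lemma hasDerivAt_integral_gauss_mul
    (hPd : ∀ p, ∃ L : ℝ × ℝ →L[ℝ] ℝ, HasFDerivAt P L p ∧ L (1, 0) = U p ∧ L (0, 1) = Q p)
    (hPs : HasCompactSupport P)
    (hUc : Continuous U) (hUs : HasCompactSupport U) (hQc : Continuous Q) (hQs : HasCompactSupport Q)
    {τ : ℝ} (hτ : 0 < τ) :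
    HasDerivAt (fun τ => ∫ w in Ioi (0 : ℝ), 2 * gauss 1 w * P (Real.sqrt τ * w, τ))
      ((∫ b in Ioi (0 : ℝ), heatPoisson b τ * U (b, τ))
        + ∫ b in Ioi (0 : ℝ), 2 * gauss τ b * Q (b, τ)) τ := by
  have hPc : Continuous P := continuous_iff_continuousAt.2 fun p => by
    obtain ⟨L, hL, -⟩ := hPd p; exact hL.continuousAt
  obtain ⟨CP, hCP⟩ := hPs.exists_bound_of_continuous hPc
  obtain ⟨CU, hCU⟩ := hUs.exists_bound_of_continuous hUc
  obtain ⟨CQ, hCQ⟩ := hQs.exists_bound_of_continuous hQc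
  have hCU0 : 0 ≤ CU := (norm_nonneg _).trans (hCU 0)
  have hCQ0 : 0 ≤ CQ := (norm_nonneg _).trans (hCQ 0)
  have hg1 : Integrable fun w => 2 * gauss 1 w := (integrable_gauss one_pos).const_mul 2
  have hg2 : Integrable fun w => 2 * gauss 1 w * w :=
    (integrable_mul_gauss_one.const_mul 2).congr (ae_of_all _ fun w => by ring)
  have hi1 : Integrable fun w => 2 * gauss 1 w * (w / (2 * Real.sqrt τ))
      * U (Real.sqrt τ * w, τ) := by
    refine Integrable.mono' (hg2.norm.mul_const ((2 * Real.sqrt τ)⁻¹ * CU))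
      (Continuous.aestronglyMeasurable (by fun_prop)) (ae_of_all _ fun w => ?_)
    rw [norm_mul, div_eq_mul_inv, ← mul_assoc, norm_mul, mul_assoc, norm_inv,
      Real.norm_of_nonneg (show 0 ≤ 2 * Real.sqrt τ by positivity)]
    gcongr
    exact hCU _
  have hi2 : Integrable fun w => 2 * gauss 1 w * Q (Real.sqrt τ * w, τ) := by
    refine Integrable.mono' (hg1.norm.mul_const CQ)
      (Continuous.aestronglyMeasurable (by fun_prop)) (ae_of_all _ fun w => ?_)
    rw [norm_mul]
    gcongr
    exact hCQ _
  have hval : (∫ b in Ioi (0 : ℝ), heatPoisson b τ * U (b, τ))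
        + ∫ b in Ioi (0 : ℝ), 2 * gauss τ b * Q (b, τ)
      = ∫ w in Ioi (0 : ℝ), (2 * gauss 1 w * (w / (2 * Real.sqrt τ)) * U (Real.sqrt τ * w, τ)
        + 2 * gauss 1 w * Q (Real.sqrt τ * w, τ)) := by
    rw [integral_add hi1.restrict hi2.restrict, ← integral_scale hτ,
      ← integral_scale hτ (fun b => 2 * gauss τ b * Q (b, τ))]
    congr 1
    · congr 1; ext w; rw [heatPoisson_scale hτ]; ring
    · congr 1; ext w; rw [two_mul_gauss_scale hτ]; ring
  rw [hval]
  refine (hasDerivAt_integral_of_dominated_loc_of_deriv_le (𝕜 := ℝ) (E := ℝ)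
    (μ := volume.restrict (Ioi (0 : ℝ))) (s := Ioi (τ / 4))
    (F := fun τ w => 2 * gauss 1 w * P (Real.sqrt τ * w, τ))
    (F' := fun τ w => 2 * gauss 1 w * (w / (2 * Real.sqrt τ)) * U (Real.sqrt τ * w, τ)
        + 2 * gauss 1 w * Q (Real.sqrt τ * w, τ))
    (bound := fun w => ‖2 * gauss 1 w * w‖ * ((2 * Real.sqrt (τ / 4))⁻¹ * CU)
      + ‖2 * gauss 1 w‖ * CQ)
    (Ioi_mem_nhds (by linarith)) ?_ ?_ ?_ ?_ ?_ ?_).2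
  · exact Eventually.of_forall fun τ => Continuous.aestronglyMeasurable (by fun_prop)
  · refine Integrable.mono' (hg1.norm.mul_const CP).restrict
      (Continuous.aestronglyMeasurable (by fun_prop)) (ae_of_all _ fun w => ?_)
    rw [norm_mul]
    gcongr
    exact hCP _
  · exact (hi1.add hi2).aestronglyMeasurable.restrict
  · refine ae_of_all _ fun w τ' hτ' => ?_
    have hτ'' : τ / 4 < τ' := hτ'
    have hs : Real.sqrt (τ / 4) ≤ Real.sqrt τ' := Real.sqrt_le_sqrt hτ''.le
    have hs0 : 0 < Real.sqrt (τ / 4) := Real.sqrt_pos.2 (by linarith)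
    refine (norm_add_le _ _).trans (add_le_add ?_ ?_)
    · rw [norm_mul, div_eq_mul_inv, ← mul_assoc, norm_mul, mul_assoc, norm_inv,
        Real.norm_of_nonneg (show 0 ≤ 2 * Real.sqrt τ' by positivity)]
      gcongr
      exact hCU _
    · rw [norm_mul]
      gcongr
      exact hCQ _
  · exact ((hg2.norm.mul_const _).add (hg1.norm.mul_const _)).restrict
  · refine ae_of_all _ fun w τ' hτ' => ?_
    have hτ'0 : 0 < τ' := lt_trans (by linarith) (show τ / 4 < τ' from hτ')
    obtain ⟨L, hL, hL1, hL2⟩ := hPd (Real.sqrt τ' * w, τ')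
    have h1 : HasDerivAt (fun τ => (Real.sqrt τ * w, τ))
        ((1 / (2 * Real.sqrt τ') * w, 1) : ℝ × ℝ) τ' :=
      ((Real.hasDerivAt_sqrt hτ'0.ne').mul_const w).prodMk (hasDerivAt_id τ')
    have h2 := (HasFDerivAt.comp_hasDerivAt (f := fun τ => (Real.sqrt τ * w, τ)) τ' hL h1).const_mul
      (2 * gauss 1 w)
    refine h2.congr_deriv ?_
    have h3 : ((1 / (2 * Real.sqrt τ') * w, 1) : ℝ × ℝ)
      = (w / (2 * Real.sqrt τ')) • ((1, 0) : ℝ × ℝ) + ((0, 1) : ℝ × ℝ) := by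
      ext
      · simp; ring
      · simp
    rw [h3, map_add, map_smul, hL1, hL2, smul_eq_mul]
    ring

/-- The kernel `heatPoisson` solves the heat equation on the half line with the boundary datum
`δ(τ)`, in the very weak sense and damped by `exp (-k²τ)`. The test function `r` enters through
`P = ∂_b r`, `U = ∂_b² r`, `V = ∂_τ r - k² r` and `Q = ∂_τ ∂_b r`. The pairing is the integral over
`τ` of the derivative of `exp (-k²τ) ∫ 2 G(b,τ) P(b,τ) db`, whose limit as `τ → 0` is `P(0,0)`. -/
theorem integral_heatPoisson_mul
    (hPd : ∀ p, ∃ L : ℝ × ℝ →L[ℝ] ℝ, HasFDerivAt P L p ∧ L (1, 0) = U p ∧ L (0, 1) = Q p)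
    (hPs : HasCompactSupport P)
    (hUc : Continuous U) (hUs : HasCompactSupport U) (hQc : Continuous Q) (hQs : HasCompactSupport Q)
    (hVc : Continuous V) (hVs : HasCompactSupport V)
    (hV : ∀ b τ, HasDerivAt (fun b => V (b, τ)) (Q (b, τ) - k ^ 2 * P (b, τ)) b)
    (hV0 : ∀ τ, 0 < τ → V (0, τ) = 0) :
    ∫ p in quadrant, Real.exp (-(k ^ 2 * p.2)) * heatPoisson p.1 p.2 * (V p + U p) = -P (0, 0) := by
  have hPc : Continuous P := continuous_iff_continuousAt.2 fun p => by
    obtain ⟨L, hL, -⟩ := hPd p; exact hL.continuousAt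
  have hi : IntegrableOn (fun p : ℝ × ℝ => Real.exp (-(k ^ 2 * p.2)) * heatPoisson p.1 p.2
      * (V p + U p)) quadrant := integrableOn_heatPoisson_mul (hVc.add hUc) (hVs.add hUs) k
  unfold IntegrableOn at hi
  rw [volume_restrict_quadrant] at hi ⊢
  rw [integral_prod_symm _ hi]
  set Z : ℝ → ℝ := fun τ => ∫ w in Ioi (0 : ℝ), 2 * gauss 1 w * P (Real.sqrt τ * w, τ) with hZ
  have hZ0 : Z 0 = P (0, 0) := by
    simp only [hZ, Real.sqrt_zero, zero_mul]
    rw [integral_mul_const, integral_Ioi_two_mul_gauss, one_mul]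
  have hZc : Continuous Z := by
    obtain ⟨CP, hCP⟩ := hPs.exists_bound_of_continuous hPc
    have hg1 : Integrable fun w => 2 * gauss 1 w := (integrable_gauss one_pos).const_mul 2
    refine continuous_of_dominated (bound := fun w => ‖2 * gauss 1 w‖ * CP) (fun τ => ?_)
      (fun τ => ae_of_all _ fun w => ?_) (hg1.norm.mul_const CP).restrict (ae_of_all _ fun w => ?_)
    · exact Continuous.aestronglyMeasurable (by fun_prop)
    · rw [norm_mul]
      gcongr
      exact hCP _
    · fun_prop
  obtain ⟨_, R, -, -, -, hPR⟩ := exists_bound_of_hasCompactSupport hPc hPs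
  have hslice : ∀ (W : ℝ × ℝ → ℝ) (h : ℝ → ℝ) (τ : ℝ), Continuous W → HasCompactSupport W →
      Continuous h → Integrable fun b => h b * W (b, τ) := by
    intro W h τ hW hWs hh
    exact Continuous.integrable_of_hasCompactSupport (by fun_prop)
      (hasCompactSupport_slice hWs τ).mul_left
  have key : ∀ τ, 0 < τ → HasDerivAt (fun τ => Real.exp (-(k ^ 2 * τ)) * Z τ)
      (∫ b in Ioi (0 : ℝ), Real.exp (-(k ^ 2 * τ)) * heatPoisson b τ * (V (b, τ) + U (b, τ))) τ := by
    intro τ hτ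
    have h1 := hasDerivAt_integral_gauss_mul hPd hPs hUc hUs hQc hQs hτ
    have h2 : HasDerivAt (fun τ => Real.exp (-(k ^ 2 * τ)))
        (Real.exp (-(k ^ 2 * τ)) * (-(k ^ 2 * 1))) τ := ((hasDerivAt_id τ).const_mul _).neg.exp
    refine (h2.mul h1).congr_deriv ?_
    have hgc : Continuous fun b => 2 * gauss τ b := by fun_prop
    have hhc := continuous_heatPoisson_left τ
    have iV := hslice V _ τ hVc hVs hhc
    have iU := hslice U _ τ hUc hUs hhc
    have iQ := hslice Q _ τ hQc hQs hgc
    have iP := hslice P _ τ hPc hPs hgc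
    -- integration by parts in `b`: no boundary term, because `V` vanishes at `b = 0`
    have hibp : ∫ b in Ioi (0 : ℝ), (-heatPoisson b τ * V (b, τ)
        + 2 * gauss τ b * (Q (b, τ) - k ^ 2 * P (b, τ))) = 0 := by
      obtain ⟨_, R', -, -, -, hVR⟩ := exists_bound_of_hasCompactSupport hVc hVs
      rw [integral_Ioi_of_hasDerivAt_of_eq_zero (f := fun b => 2 * gauss τ b * V (b, τ)) (R := R')]
      · simp [hV0 τ hτ]
      · exact Continuous.continuousWithinAt (by fun_prop)
      · exact fun b _ => (hasDerivAt_two_mul_gauss hτ b).mul (hV b τ)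
      · refine Integrable.integrableOn ((iV.neg.add (iQ.sub (iP.const_mul (k ^ 2)))).congr
          (ae_of_all _ fun b => ?_))
        simp only [Pi.add_apply, Pi.neg_apply, Pi.sub_apply]; ring
      · intro b hb
        by_contra h
        have := hVR (b, τ) (right_ne_zero_of_mul h)
        rw [Prod.norm_def, sup_le_iff] at this
        exact absurd ((le_abs_self b).trans this.1) (not_le.2 hb)
    have e1 : ∫ b in Ioi (0 : ℝ), (-heatPoisson b τ * V (b, τ)
        + 2 * gauss τ b * (Q (b, τ) - k ^ 2 * P (b, τ)))
      = -(∫ b in Ioi (0 : ℝ), heatPoisson b τ * V (b, τ))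
        + ((∫ b in Ioi (0 : ℝ), 2 * gauss τ b * Q (b, τ))
          - k ^ 2 * ∫ b in Ioi (0 : ℝ), 2 * gauss τ b * P (b, τ)) := by
      have iQP : Integrable fun b => 2 * gauss τ b * Q (b, τ) - k ^ 2 * (2 * gauss τ b * P (b, τ)) :=
        iQ.sub (iP.const_mul _)
      have e : ∀ b, -heatPoisson b τ * V (b, τ) + 2 * gauss τ b * (Q (b, τ) - k ^ 2 * P (b, τ))
          = 2 * gauss τ b * Q (b, τ) - k ^ 2 * (2 * gauss τ b * P (b, τ))
            - heatPoisson b τ * V (b, τ) := fun b => by ring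
      simp_rw [e]
      rw [integral_sub iQP.restrict iV.restrict,
        integral_sub iQ.restrict (iP.const_mul _).restrict, integral_const_mul]
      ring
    have e2 : ∫ b in Ioi (0 : ℝ),
        Real.exp (-(k ^ 2 * τ)) * heatPoisson b τ * (V (b, τ) + U (b, τ))
        = Real.exp (-(k ^ 2 * τ)) * ((∫ b in Ioi (0 : ℝ), heatPoisson b τ * V (b, τ))
          + ∫ b in Ioi (0 : ℝ), heatPoisson b τ * U (b, τ)) := by
      rw [← integral_add iV.restrict iU.restrict, ← integral_const_mul]
      congr 1; ext b; ring
    have e3 : Z τ = ∫ b in Ioi (0 : ℝ), 2 * gauss τ b * P (b, τ) := by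
      rw [← integral_scale hτ]
      simp only [hZ]
      congr 1; ext w; rw [two_mul_gauss_scale hτ]; ring
    rw [e1] at hibp
    simp only [hZ] at e3
    rw [e2, e3]
    linear_combination Real.exp (-(k ^ 2 * τ)) * hibp
  rw [integral_Ioi_of_hasDerivAt_of_eq_zero (f := fun τ => Real.exp (-(k ^ 2 * τ)) * Z τ) (R := R)
    (Continuous.continuousWithinAt (by fun_prop)) key hi.integral_prod_right, hZ0]
  · simp
  · intro τ hτ
    have : ∀ w, P (Real.sqrt τ * w, τ) = 0 := fun w => by
      by_contra h
      have := hPR _ h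
      rw [Prod.norm_def, sup_le_iff] at this
      exact absurd ((le_abs_self τ).trans this.2) (not_le.2 hτ)
    simp [hZ, this]

end HeatPairing

/-! ### The divergence of a single mode -/

lemma hasCompactSupport_tangential (i : Fin 2) (k : ℝ) {θ : ℝ × ℝ × ℝ → ℝ} (hθ : Continuous θ)
    (hc : HasCompactSupport θ) : HasCompactSupport (tangential i k θ) := by
  obtain ⟨C, R, -, -, -, hθR⟩ := exists_bound_of_hasCompactSupport hθ hc
  refine HasCompactSupport.intro (isCompact_closedBall (0 : ℝ × ℝ) R) fun p hp => ?_
  exact tangential_eq_zero i k hθR (by simpa using hp)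

lemma integrableOn_modeKernel_mul (i : Fin 2) {k s : ℝ} (hk : 0 < k) (hs : 0 < s)
    {W : ℝ × ℝ → ℝ} (hWc : Continuous W) (hW : HasCompactSupport W) :
    IntegrableOn (fun p : ℝ × ℝ => modeKernel i k p.1 (p.2 - s) * W p) quadrant := by
  obtain ⟨C, R, hC, hR, hWC, hWR⟩ := exists_bound_of_hasCompactSupport hWc hW
  have hi1 : Integrable ((Ioc 0 R).indicator
      fun b : ℝ => b ^ (-(3 / 4) : ℝ) + b ^ (-(1 / 4) : ℝ)) :=
    (integrable_indicator_iff measurableSet_Ioc).2 (integrableOn_sum_rpow R)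
  have hi2 := (integrable_indicator_rpow R).comp_sub_right s
  refine Integrable.mono' ((hi1.mul_prod hi2).const_mul
    (48 * (k ^ (-(5 / 8) : ℝ) + k ^ (-(1 / 8) : ℝ)) * C)).restrict ?_ ?_
  · have h1 : Measurable fun p : ℝ × ℝ => modeKernel i k p.1 (p.2 - s) :=
      (measurable_modeKernel i).comp (f := fun p : ℝ × ℝ => (k, p.1, p.2 - s)) (by fun_prop)
    exact (h1.mul hWc.measurable).aestronglyMeasurable
  · refine (ae_restrict_iff' measurableSet_quadrant).2 (ae_of_all _ ?_)
    rintro ⟨b, t⟩ ⟨hb, ht⟩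
    simp only [mem_Ioi] at hb ht
    by_cases h0 : modeKernel i k b (t - s) * W (b, t) = 0
    · rw [h0, norm_zero]
      exact mul_nonneg (by positivity) (mul_nonneg
        (indicator_nonneg (fun x hx => by have := hx.1; positivity) _)
        (indicator_nonneg (fun x hx => Real.rpow_nonneg hx.1.le _) _))
    · have hn := hWR _ (right_ne_zero_of_mul h0)
      have hts : 0 < t - s := by
        by_contra h
        exact left_ne_zero_of_mul h0 (modeKernel_of_nonpos (not_lt.1 h) i k b)
      simp only [Prod.norm_def, sup_le_iff, Real.norm_eq_abs] at hn
      rw [indicator_of_mem (show b ∈ Ioc 0 R from ⟨hb, (abs_le.1 hn.1).2⟩),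
        indicator_of_mem (show t - s ∈ Ioc 0 R from ⟨hts, by linarith [(abs_le.1 hn.2).2]⟩)]
      rw [norm_mul]
      calc _ ≤ (48 * (k ^ (-(5 / 8) : ℝ) + k ^ (-(1 / 8) : ℝ))
            * (b ^ (-(3 / 4) : ℝ) + b ^ (-(1 / 4) : ℝ)) * (t - s) ^ (-(15 / 16) : ℝ)) * C :=
            mul_le_mul (abs_modeKernel_le_rpow i hk hb hts) (hWC _) (abs_nonneg _) (by positivity)
        _ = _ := by ring

lemma integrableOn_expConv_mul (k τ : ℝ) {f : ℝ → ℝ} (hf : Continuous f)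
    (hfs : HasCompactSupport f) : IntegrableOn (fun b => expConv k b τ * f b) (Ioi 0) := by
  obtain ⟨C, R, -, hR, -, hfR⟩ := exists_bound_of_hasCompactSupport hf hfs
  have h1 : IntegrableOn (fun b => expConv k b τ * f b) (Icc 0 R) :=
    (((continuousOn_expConv k τ).mono Icc_subset_Ici_self).mul hf.continuousOn).integrableOn_Icc
  refine h1.of_forall_sdiff_eq_zero measurableSet_Ioi fun b hb => ?_
  by_contra h
  have h2 := hfR b (right_ne_zero_of_mul h)
  exact hb.2 ⟨le_of_lt hb.1, (le_abs_self b).trans h2⟩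

/-- The integrand is the derivative of `expConv k · τ * f`, which vanishes at `0`. -/
lemma integral_expConv_mul_deriv (k τ : ℝ) {f f' : ℝ → ℝ} (hd : ∀ b, HasDerivAt f (f' b) b)
    (hf' : Continuous f') (hfs : HasCompactSupport f) (hfs' : HasCompactSupport f') :
    ∫ b in Ioi (0 : ℝ), (heatPoisson b τ * f b + expConv k b τ * (f' b - k * f b)) = 0 := by
  have hf : Continuous f := continuous_iff_continuousAt.2 fun b => (hd b).continuousAt
  have hh := continuous_heatPoisson_left τ
  obtain ⟨C, R, -, hR, -, hfR⟩ := exists_bound_of_hasCompactSupport hf hfs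
  rw [integral_Ioi_of_hasDerivAt_of_eq_zero (f := fun b => expConv k b τ * f b) (R := R)]
  · simp [expConv_zero]
  · exact ((continuousOn_expConv k τ).mul hf.continuousOn) 0 self_mem_Ici
  · intro b hb
    refine ((hasDerivAt_expConv k τ hb).mul (hd b)).congr_deriv ?_
    ring
  · refine Integrable.add ?_ (integrableOn_expConv_mul k τ (f := fun b => f' b - k * f b)
      (by fun_prop) (hfs'.sub hfs.mul_left))
    exact (Continuous.integrable_of_hasCompactSupport (by fun_prop) hfs.mul_left).restrict
  · intro b hb
    by_contra h
    exact absurd ((le_abs_self b).trans (hfR b (right_ne_zero_of_mul h))) (not_le.2 hb)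

/-- The contribution of the potential part at the instant `t = s`. -/
lemma integral_exp_mul_deriv (k : ℝ) {f f' : ℝ → ℝ} (hd : ∀ b, HasDerivAt f (f' b) b)
    (hf' : Continuous f') (hfs : HasCompactSupport f) (hfs' : HasCompactSupport f') :
    ∫ b in Ioi (0 : ℝ), Real.exp (-(k * b)) * (f' b - k * f b) = -f 0 := by
  have hf : Continuous f := continuous_iff_continuousAt.2 fun b => (hd b).continuousAt
  obtain ⟨C, R, -, hR, -, hfR⟩ := exists_bound_of_hasCompactSupport hf hfs
  rw [integral_Ioi_of_hasDerivAt_of_eq_zero (f := fun b => Real.exp (-(k * b)) * f b) (R := R)]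
  · simp
  · exact Continuous.continuousWithinAt (by fun_prop)
  · intro b _
    have h : HasDerivAt (fun b => Real.exp (-(k * b))) (Real.exp (-(k * b)) * (-(k * 1))) b :=
      ((hasDerivAt_id b).const_mul k).neg.exp
    refine (h.mul (hd b)).congr_deriv ?_
    ring
  · exact (Continuous.integrable_of_hasCompactSupport (by fun_prop)
      (hfs'.sub hfs.mul_left).mul_left).restrict
  · intro b hb
    by_contra h
    exact absurd ((le_abs_self b).trans (hfR b (right_ne_zero_of_mul h))) (not_le.2 hb)

section Modes

variable {k s : ℝ}

lemma modeKernel_one_eq (k b τ : ℝ) :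
    modeKernel 1 k b τ = k * (Real.exp (-(k ^ 2 * τ)) * expConv k b τ) := by
  simp [modeKernel]; ring

lemma modeKernel_zero_eq (k b τ : ℝ) :
    modeKernel 0 k b τ = modeKernel 1 k b τ - Real.exp (-(k ^ 2 * τ)) * heatPoisson b τ := by
  simp [modeKernel]; ring

/-- The equation `∂_b A = e - k A` for `A = expConv k · τ`, integrated against a function of `(b, t)`. -/
lemma integral_modeKernel_mul_deriv (hk : 0 < k) (hs : 0 < s) {F F' : ℝ × ℝ → ℝ}
    (hF : Continuous F) (hF' : Continuous F') (hFs : HasCompactSupport F)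
    (hFs' : HasCompactSupport F') (hd : ∀ b t, HasDerivAt (fun b => F (b, t)) (F' (b, t)) b) :
    ∫ p in quadrant, ((modeKernel 1 k p.1 (p.2 - s) * (k⁻¹ * F' p)
      - modeKernel 0 k p.1 (p.2 - s) * F p)) = 0 := by
  have hi : IntegrableOn (fun p : ℝ × ℝ => (modeKernel 1 k p.1 (p.2 - s) * (k⁻¹ * F' p)
      - modeKernel 0 k p.1 (p.2 - s) * F p)) quadrant :=
    (integrableOn_modeKernel_mul 1 hk hs (W := fun p => k⁻¹ * F' p) (by fun_prop)
      hFs'.mul_left).sub (integrableOn_modeKernel_mul 0 hk hs hF hFs)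
  unfold IntegrableOn at hi
  rw [volume_restrict_quadrant] at hi ⊢
  rw [integral_prod_symm _ hi]
  refine integral_eq_zero_of_ae (ae_of_all _ fun t => ?_)
  have h := integral_expConv_mul_deriv k (t - s) (hd · t) (by fun_prop)
    (hasCompactSupport_slice hFs t) (hasCompactSupport_slice hFs' t)
  have e : ∀ b, modeKernel 1 k b (t - s) * (k⁻¹ * F' (b, t)) - modeKernel 0 k b (t - s) * F (b, t)
      = Real.exp (-(k ^ 2 * (t - s))) * (heatPoisson b (t - s) * F (b, t)
        + expConv k b (t - s) * (F' (b, t) - k * F (b, t))) := by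
    intro b
    rw [modeKernel_zero_eq, modeKernel_one_eq]
    field_simp
    ring
  simp only [e, Pi.zero_apply]
  rw [integral_const_mul, h, mul_zero]

/-- Each mode is divergence free and has the normal boundary value `δ(t - s) cos (k x₁)`. -/
theorem modePairing_gradient (hk : 0 < k) (hs : 0 < s) {ψ : ℝ × ℝ × ℝ → ℝ}
    (hψ : ContDiff ℝ ∞ ψ) (hc : HasCompactSupport ψ) :
    modePairing 0 k s (pd 0 ψ) + modePairing 1 k s (pd 1 ψ) = -tangential 1 k ψ (0, s) := by
  set F := tangential 1 k ψ
  set F' := tangential 1 k (pd 1 ψ)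
  have hψ1 : Continuous (pd 1 ψ) := by rw [pd_one_eq]; exact (contDiff_dirDeriv _ hψ).continuous
  have hc1 : HasCompactSupport (pd 1 ψ) := by
    rw [pd_one_eq]; exact hasCompactSupport_dirDeriv _ hc
  have hFc : Continuous F := continuous_tangential 1 k hψ.continuous hc
  have hFc' : Continuous F' := continuous_tangential 1 k hψ1 hc1
  have hFs : HasCompactSupport F := hasCompactSupport_tangential 1 k hψ.continuous hc
  have hFs' : HasCompactSupport F' := hasCompactSupport_tangential 1 k hψ1 hc1
  have hd := hasDerivAt_tangential 1 k hψ hc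
  have h0 : ∀ p, tangential 0 k (pd 0 ψ) p = -k * F p := fun p => by
    simpa using tangential_pd_zero 0 k hψ hc p
  have h1 := integral_modeKernel_mul_deriv hk hs hFc hFc' hFs hFs' hd
  have h2 := integral_exp_mul_deriv k (f' := fun b => F' (b, s)) (hd · s) (by fun_prop)
    (hasCompactSupport_slice hFs s) (hasCompactSupport_slice hFs' s)
  have i0 := integrableOn_modeKernel_mul 0 hk hs hFc hFs
  have i1 := integrableOn_modeKernel_mul 1 hk hs hFc' hFs'
  have j0 : Integrable fun b => Real.exp (-(k * b)) * F (b, s) :=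
    Continuous.integrable_of_hasCompactSupport (by fun_prop)
      (hasCompactSupport_slice hFs s).mul_left
  have j1 : Integrable fun b => Real.exp (-(k * b)) * F' (b, s) :=
    Continuous.integrable_of_hasCompactSupport (by fun_prop)
      (hasCompactSupport_slice hFs' s).mul_left
  have e1 : ∀ p : ℝ × ℝ, modeKernel 1 k p.1 (p.2 - s) * (k⁻¹ * F' p)
      - modeKernel 0 k p.1 (p.2 - s) * F p
      = k⁻¹ * (modeKernel 1 k p.1 (p.2 - s) * F' p) - modeKernel 0 k p.1 (p.2 - s) * F p :=
    fun p => by ring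
  have e2 : ∀ b : ℝ, Real.exp (-(k * b)) * (F' (b, s) - k * F (b, s))
      = Real.exp (-(k * b)) * F' (b, s) - k * (Real.exp (-(k * b)) * F (b, s)) := fun b => by ring
  simp_rw [e1] at h1
  change ∫ b in Ioi (0 : ℝ), Real.exp (-(k * b)) * (F' (b, s) - k * F (b, s)) = -F (0, s) at h2
  simp_rw [e2] at h2
  rw [integral_sub (i1.const_mul _) i0, integral_const_mul] at h1
  rw [integral_sub j1.restrict (j0.restrict.const_mul _), integral_const_mul] at h2
  simp only [modePairing, h0]
  have e3 : ∀ p : ℝ × ℝ, modeKernel 0 k p.1 (p.2 - s) * (-k * F p)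
      = -k * (modeKernel 0 k p.1 (p.2 - s) * F p) := fun p => by ring
  have e4 : ∀ b : ℝ, Real.exp (-(k * b)) * (-k * F (b, s))
      = -k * (Real.exp (-(k * b)) * F (b, s)) := fun b => by ring
  simp_rw [e3, e4]
  rw [integral_const_mul, integral_const_mul]
  have h1' : (∫ p in quadrant, modeKernel 1 k p.1 (p.2 - s) * F' p)
      = k * ∫ p in quadrant, modeKernel 0 k p.1 (p.2 - s) * F p := by
    field_simp at h1; linarith
  change _ + ((∫ p in quadrant, modeKernel 1 k p.1 (p.2 - s) * F' p)
    + ∫ b in Ioi (0 : ℝ), Real.exp (-(k * b)) * F' (b, s)) = _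
  linarith

/-- Translation in time of the pairing with the heat kernel. -/
lemma integral_heatPoisson_sub_mul (hs : 0 < s) (W : ℝ × ℝ → ℝ) :
    ∫ p in quadrant, Real.exp (-(k ^ 2 * (p.2 - s))) * heatPoisson p.1 (p.2 - s) * W p
      = ∫ p in quadrant, Real.exp (-(k ^ 2 * p.2)) * heatPoisson p.1 p.2 * W (p.1, p.2 + s) := by
  rw [← integral_indicator measurableSet_quadrant, ← integral_indicator measurableSet_quadrant]
  symm
  rw [← integral_sub_right_eq_self _ ((0, s) : ℝ × ℝ)]
  congr 1; ext ⟨b, t⟩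
  by_cases hts : t - s ≤ 0
  · simp [indicator, heatPoisson_of_nonpos hts]
  · have h1 : ((b, t) ∈ quadrant) ↔ ((b, t) - (0, s) ∈ quadrant) := by
      simp only [quadrant, mem_prod, Prod.fst_sub, Prod.snd_sub, mem_Ioi, sub_zero]
      constructor
      · rintro ⟨h, _⟩; exact ⟨h, not_le.1 hts⟩
      · rintro ⟨h, _⟩; exact ⟨h, by linarith [not_le.1 hts]⟩
    by_cases h : (b, t) ∈ quadrant
    · rw [indicator_of_mem h, indicator_of_mem (h1.1 h)]
      simp
    · rw [indicator_of_notMem h, indicator_of_notMem (fun h' => h (h1.2 h'))]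

end Modes

/-! ### The momentum equation for a single mode -/

/-- The backward heat operator `∂ₜ + Δ`. -/
noncomputable def backwardHeat (f : ℝ × ℝ × ℝ → ℝ) : ℝ × ℝ × ℝ → ℝ := fun q => pdt f q + lap f q

lemma backwardHeat_eq (f : ℝ × ℝ × ℝ → ℝ) : backwardHeat f = pdt f + (pd 0 (pd 0 f) + pd 1 (pd 1 f)) := by
  ext q; simp [backwardHeat, lap, Fin.sum_univ_two]

section

variable {f g : ℝ × ℝ × ℝ → ℝ}

lemma contDiff_pd (i : Fin 2) (hf : ContDiff ℝ ∞ f) : ContDiff ℝ ∞ (pd i f) :=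
  contDiff_dirDeriv (dir i) hf

lemma contDiff_pdt (hf : ContDiff ℝ ∞ f) : ContDiff ℝ ∞ (pdt f) := contDiff_dirDeriv _ hf

lemma hasCompactSupport_pd (i : Fin 2) (hf : HasCompactSupport f) : HasCompactSupport (pd i f) :=
  hasCompactSupport_dirDeriv (dir i) hf

lemma hasCompactSupport_pdt (hf : HasCompactSupport f) : HasCompactSupport (pdt f) :=
  hasCompactSupport_dirDeriv _ hf

lemma pd_add (i : Fin 2) (hf : ContDiff ℝ ∞ f) (hg : ContDiff ℝ ∞ g) :
    pd i (f + g) = pd i f + pd i g := dirDeriv_add (dir i) hf hg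

lemma pdt_add (hf : ContDiff ℝ ∞ f) (hg : ContDiff ℝ ∞ g) :
    pdt (f + g) = pdt f + pdt g := dirDeriv_add _ hf hg

lemma pd_const_smul (i : Fin 2) (c : ℝ) (hf : ContDiff ℝ ∞ f) : pd i (c • f) = c • pd i f :=
  dirDeriv_const_smul (dir i) c hf

lemma pdt_const_smul (c : ℝ) (hf : ContDiff ℝ ∞ f) : pdt (c • f) = c • pdt f :=
  dirDeriv_const_smul _ c hf

lemma pd_comm (i j : Fin 2) (hf : ContDiff ℝ ∞ f) : pd i (pd j f) = pd j (pd i f) :=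
  dirDeriv_comm (dir i) (dir j) hf

lemma pdt_pd_comm (i : Fin 2) (hf : ContDiff ℝ ∞ f) : pdt (pd i f) = pd i (pdt f) :=
  dirDeriv_comm _ (dir i) hf

lemma contDiff_backwardHeat (hf : ContDiff ℝ ∞ f) : ContDiff ℝ ∞ (backwardHeat f) := by
  rw [backwardHeat_eq]
  exact (contDiff_pdt hf).add ((contDiff_pd 0 (contDiff_pd 0 hf)).add
    (contDiff_pd 1 (contDiff_pd 1 hf)))

lemma hasCompactSupport_backwardHeat (hf : HasCompactSupport f) :
    HasCompactSupport (backwardHeat f) := by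
  rw [backwardHeat_eq]
  exact (hasCompactSupport_pdt hf).add ((hasCompactSupport_pd 0 (hasCompactSupport_pd 0 hf)).add
    (hasCompactSupport_pd 1 (hasCompactSupport_pd 1 hf)))

lemma backwardHeat_add (hf : ContDiff ℝ ∞ f) (hg : ContDiff ℝ ∞ g) :
    backwardHeat (f + g) = backwardHeat f + backwardHeat g := by
  simp only [backwardHeat_eq]
  rw [pdt_add hf hg, pd_add 0 hf hg, pd_add 1 hf hg, pd_add 0 (contDiff_pd 0 hf) (contDiff_pd 0 hg),
    pd_add 1 (contDiff_pd 1 hf) (contDiff_pd 1 hg)]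
  abel

lemma backwardHeat_const_smul (c : ℝ) (hf : ContDiff ℝ ∞ f) :
    backwardHeat (c • f) = c • backwardHeat f := by
  simp only [backwardHeat_eq]
  rw [pdt_const_smul c hf, pd_const_smul 0 c hf, pd_const_smul 1 c hf,
    pd_const_smul 0 c (contDiff_pd 0 hf), pd_const_smul 1 c (contDiff_pd 1 hf), smul_add, smul_add]

lemma pd_backwardHeat (i : Fin 2) (hf : ContDiff ℝ ∞ f) :
    pd i (backwardHeat f) = backwardHeat (pd i f) := by
  simp only [backwardHeat_eq]
  have h0 := contDiff_pd 0 (contDiff_pd 0 hf)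
  have h1 := contDiff_pd 1 (contDiff_pd 1 hf)
  have h01 : ContDiff ℝ ∞ (pd 0 (pd 0 f) + pd 1 (pd 1 f)) := h0.add h1
  rw [pd_add i (contDiff_pdt hf) h01, pd_add i h0 h1, pdt_pd_comm i hf,
    pd_comm i 0 (contDiff_pd 0 hf), pd_comm i 0 hf, pd_comm i 1 (contDiff_pd 1 hf), pd_comm i 1 hf]

lemma isOpen_halfSpaceTime : IsOpen halfSpaceTime := by
  rw [halfSpaceTime_eq]
  exact isOpen_univ.prod (isOpen_Ioi.prod isOpen_Ioi)

lemma dirDeriv_eq_zero_of_isOpen (v : ℝ × ℝ × ℝ) (hf : ContDiff ℝ ∞ f)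
    (h : ∀ q ∈ halfSpaceTime, f q = 0) {q : ℝ × ℝ × ℝ} (hq : q ∈ halfSpaceTime) :
    dirDeriv v f q = 0 := by
  refine dirDeriv_eq_zero v hf ?_
  have hc : Tendsto (fun c : ℝ => q + c • v) (𝓝 0) (𝓝 q) := by
    have : Continuous fun c : ℝ => q + c • v := by fun_prop
    simpa using this.tendsto 0
  filter_upwards [hc.eventually_mem (isOpen_halfSpaceTime.mem_nhds hq)] with c hc using h _ hc

lemma backwardHeat_eq_zero (hf : ContDiff ℝ ∞ f) (h : ∀ q ∈ halfSpaceTime, f q = 0)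
    {q : ℝ × ℝ × ℝ} (hq : q ∈ halfSpaceTime) : backwardHeat f q = 0 := by
  have h1 : ∀ i, ∀ q ∈ halfSpaceTime, pd i f q = 0 := fun i q hq =>
    dirDeriv_eq_zero_of_isOpen (dir i) hf h hq
  have h2 : ∀ i, pd i (pd i f) q = 0 := fun i =>
    dirDeriv_eq_zero_of_isOpen (dir i) (contDiff_pd i hf) (h1 i) hq
  have h3 : pdt f q = 0 := dirDeriv_eq_zero_of_isOpen _ hf h hq
  simp [backwardHeat_eq, h2, h3]

lemma eq_zero_on_boundary (hf : Continuous f) (h : ∀ q ∈ halfSpaceTime, f q = 0) (x : ℝ) {t : ℝ}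
    (ht : 0 < t) : f (x, 0, t) = 0 := by
  have hc : Tendsto (fun b : ℝ => f (x, b, t)) (𝓝[>] 0) (𝓝 (f (x, 0, t))) :=
    (Continuous.tendsto (by fun_prop : Continuous fun b : ℝ => f (x, b, t)) 0).mono_left
      nhdsWithin_le_nhds
  refine tendsto_nhds_unique hc (tendsto_const_nhds.congr' ?_)
  filter_upwards [self_mem_nhdsWithin] with b hb using (h (x, b, t) ⟨hb, ht⟩).symm

lemma pd_zero_eq_zero_on_boundary (hf : ContDiff ℝ ∞ f) (h : ∀ x t, 0 < t → f (x, 0, t) = 0)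
    (x : ℝ) {t : ℝ} (ht : 0 < t) : pd 0 f (x, 0, t) = 0 := by
  rw [pd_zero_eq]
  refine dirDeriv_eq_zero _ hf (Eventually.of_forall fun c => ?_)
  simpa using h (x + c) t ht

lemma pdt_eq_zero_on_boundary (hf : ContDiff ℝ ∞ f) (h : ∀ x t, 0 < t → f (x, 0, t) = 0)
    (x : ℝ) {t : ℝ} (ht : 0 < t) : pdt f (x, 0, t) = 0 := by
  rw [pdt_eq]
  refine dirDeriv_eq_zero _ hf ?_
  have hc : ∀ᶠ c : ℝ in 𝓝 0, 0 < t + c := by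
    have : Tendsto (fun c : ℝ => t + c) (𝓝 0) (𝓝 t) := by
      have : Continuous fun c : ℝ => t + c := by fun_prop
      simpa using this.tendsto 0
    exact this.eventually (lt_mem_nhds ht)
  filter_upwards [hc] with c hc
  simpa using h x (t + c) hc

end

section Solenoidal

variable {φ : Fin 2 → ℝ × ℝ × ℝ → ℝ}

lemma IsSolenoidalTest.div_eq_zero (hφ : IsSolenoidalTest φ) (q : ℝ × ℝ × ℝ)
    (hq : q ∈ halfSpaceTime) : (pd 0 (φ 0) + pd 1 (φ 1)) q = 0 := by
  simpa [Fin.sum_univ_two] using hφ.div_free q hq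

lemma IsSolenoidalTest.contDiff_div (hφ : IsSolenoidalTest φ) :
    ContDiff ℝ ∞ (pd 0 (φ 0) + pd 1 (φ 1)) :=
  (contDiff_pd 0 (hφ.smooth 0)).add (contDiff_pd 1 (hφ.smooth 1))

/-- The normal derivative of the normal component vanishes on the boundary: it is minus the
tangential derivative of the tangential component. -/
lemma IsSolenoidalTest.pd_one_boundary (hφ : IsSolenoidalTest φ) (x t : ℝ) (ht : 0 < t) :
    pd 1 (φ 1) (x, 0, t) = 0 := by
  have h1 := eq_zero_on_boundary hφ.contDiff_div.continuous hφ.div_eq_zero x ht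
  have h2 := pd_zero_eq_zero_on_boundary (hφ.smooth 0) (hφ.boundary 0) x ht
  simpa [h2] using h1

lemma tangential_eq_zero_of_forall (i : Fin 2) (k : ℝ) {θ : ℝ × ℝ × ℝ → ℝ} {p : ℝ × ℝ}
    (h : ∀ x, θ (x, p) = 0) : tangential i k θ p = 0 := by simp [tangential, h]

/-- The tangential transform of `div φ = 0`, after applying the backward heat operator: it expresses the
tangential component of the tested field through the normal one. -/
lemma IsSolenoidalTest.tangential_backwardHeat (hφ : IsSolenoidalTest φ) (k : ℝ) {p : ℝ × ℝ}
    (hp : p ∈ quadrant) : k * tangential 0 k (backwardHeat (φ 0)) p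
      = -tangential 1 k (pd 1 (backwardHeat (φ 1))) p := by
  have h0 := contDiff_backwardHeat (hφ.smooth 0)
  have h1 := contDiff_backwardHeat (hφ.smooth 1)
  have c0 := hasCompactSupport_backwardHeat (hφ.compact 0)
  have c1 := hasCompactSupport_backwardHeat (hφ.compact 1)
  have e : tangential 1 k (pd 0 (backwardHeat (φ 0))) p = k * tangential 0 k (backwardHeat (φ 0)) p := by
    simpa using tangential_pd_zero 1 k h0 c0 p
  rw [← e, eq_neg_iff_add_eq_zero, ← Pi.add_apply, ← tangential_add 1 k (contDiff_pd 0 h0).continuous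
    (hasCompactSupport_pd 0 c0) (contDiff_pd 1 h1).continuous (hasCompactSupport_pd 1 c1)]
  refine tangential_eq_zero_of_forall 1 k fun x => ?_
  rw [pd_backwardHeat 0 (hφ.smooth 0), pd_backwardHeat 1 (hφ.smooth 1),
    ← backwardHeat_add (contDiff_pd 0 (hφ.smooth 0)) (contDiff_pd 1 (hφ.smooth 1))]
  refine backwardHeat_eq_zero hφ.contDiff_div hφ.div_eq_zero ?_
  rw [halfSpaceTime_eq]
  exact ⟨mem_univ _, hp⟩

/-- The combination `∂₂φ₂ + k φ₂` of the normal component `φ₂ = φ 1`, to which the momentum equation for the mode of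
frequency `k` reduces. -/
noncomputable def streamTest (k : ℝ) (φ : Fin 2 → ℝ × ℝ × ℝ → ℝ) : ℝ × ℝ × ℝ → ℝ :=
  pd 1 (φ 1) + k • φ 1

lemma IsSolenoidalTest.contDiff_streamTest (hφ : IsSolenoidalTest φ) (k : ℝ) :
    ContDiff ℝ ∞ (streamTest k φ) :=
  (contDiff_pd 1 (hφ.smooth 1)).add ((hφ.smooth 1).const_smul k)

lemma IsSolenoidalTest.hasCompactSupport_streamTest (hφ : IsSolenoidalTest φ) (k : ℝ) :
    HasCompactSupport (streamTest k φ) :=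
  (hasCompactSupport_pd 1 (hφ.compact 1)).add ((hφ.compact 1).smul_left (f := fun _ => k))

lemma IsSolenoidalTest.streamTest_boundary (hφ : IsSolenoidalTest φ) (k x t : ℝ) (ht : 0 < t) :
    streamTest k φ (x, 0, t) = 0 := by
  simp [streamTest, hφ.pd_one_boundary x t ht, hφ.boundary 1 x t ht]

lemma tangential_one_backwardHeat {ρ : ℝ × ℝ × ℝ → ℝ} (hρ : ContDiff ℝ ∞ ρ)
    (hc : HasCompactSupport ρ) (k : ℝ) (p : ℝ × ℝ) :
    tangential 1 k (backwardHeat ρ) p = (tangential 1 k (pdt ρ) p - k ^ 2 * tangential 1 k ρ p)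
      + tangential 1 k (pd 1 (pd 1 ρ)) p := by
  have h00 : tangential 1 k (pd 0 (pd 0 ρ)) p = -k ^ 2 * tangential 1 k ρ p := by
    have h1 : tangential 1 k (pd 0 (pd 0 ρ)) p = k * tangential 0 k (pd 0 ρ) p := by
      simpa using tangential_pd_zero 1 k (contDiff_pd 0 hρ) (hasCompactSupport_pd 0 hc) p
    have h2 : tangential 0 k (pd 0 ρ) p = -k * tangential 1 k ρ p := by
      simpa using tangential_pd_zero 0 k hρ hc p
    rw [h1, h2]; ring
  have h0 := (contDiff_pd 0 (contDiff_pd 0 hρ)).continuous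
  have c0 := hasCompactSupport_pd 0 (hasCompactSupport_pd 0 hc)
  have h1 := (contDiff_pd 1 (contDiff_pd 1 hρ)).continuous
  have c1 := hasCompactSupport_pd 1 (hasCompactSupport_pd 1 hc)
  rw [backwardHeat_eq, tangential_add 1 k (contDiff_pdt hρ).continuous (hasCompactSupport_pdt hc)
    (h0.add h1) (c0.add c1), tangential_add 1 k h0 c0 h1 c1]
  simp only [Pi.add_apply, h00]
  ring

/-- The heat kernel identity for the tangential transform of a test function that vanishes on the
boundary. -/
lemma integral_heatPoisson_mul_tangential {ρ : ℝ × ℝ × ℝ → ℝ} (hρ : ContDiff ℝ ∞ ρ)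
    (hc : HasCompactSupport ρ) (hb : ∀ x t, 0 < t → ρ (x, 0, t) = 0) {k s : ℝ} (hs : 0 < s) :
    ∫ p in quadrant, Real.exp (-(k ^ 2 * (p.2 - s))) * heatPoisson p.1 (p.2 - s)
      * tangential 1 k (backwardHeat ρ) p = -tangential 1 k (pd 1 ρ) (0, s) := by
  have hρ1 := contDiff_pd 1 hρ
  have hc1 := hasCompactSupport_pd 1 hc
  -- the kernel starts at time `s`, so the test function is translated by `s` in time
  set e : ℝ × ℝ ≃ₜ ℝ × ℝ := Homeomorph.addRight ((0, s) : ℝ × ℝ) with he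
  have hee : ∀ p : ℝ × ℝ, e p = (p.1, p.2 + s) := fun p => by
    simp only [he, Homeomorph.coe_addRight]; ext <;> simp
  have cont : ∀ θ : ℝ × ℝ × ℝ → ℝ, ContDiff ℝ ∞ θ → HasCompactSupport θ →
      Continuous fun p => tangential 1 k θ (e p) := fun θ h h' =>
    (continuous_tangential 1 k h.continuous h').comp e.continuous
  have supp : ∀ θ : ℝ × ℝ × ℝ → ℝ, ContDiff ℝ ∞ θ → HasCompactSupport θ →
      HasCompactSupport fun p => tangential 1 k θ (e p) := fun θ h h' =>
    (hasCompactSupport_tangential 1 k h.continuous h').comp_homeomorph e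
  have hPd : ∀ p : ℝ × ℝ, ∃ L : ℝ × ℝ →L[ℝ] ℝ,
      HasFDerivAt (fun p => tangential 1 k (pd 1 ρ) (e p)) L p ∧
      L (1, 0) = tangential 1 k (pd 1 (pd 1 ρ)) (e p) ∧
      L (0, 1) = tangential 1 k (pdt (pd 1 ρ)) (e p) := by
    intro p
    obtain ⟨L, hL, hLv⟩ := hasFDerivAt_tangential 1 k hρ1 hc1 (e p)
    refine ⟨L, ?_, ?_, ?_⟩
    · have he' : HasFDerivAt e (ContinuousLinearMap.id ℝ (ℝ × ℝ)) p :=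
        (hasFDerivAt_id p).add_const (0, s)
      exact hL.comp p he'
    · rw [hLv, pd_one_eq]
    · rw [hLv, pdt_eq]
  have hV : ∀ b τ, HasDerivAt
      (fun b => tangential 1 k (pdt ρ) (e (b, τ)) - k ^ 2 * tangential 1 k ρ (e (b, τ)))
      (tangential 1 k (pdt (pd 1 ρ)) (e (b, τ)) - k ^ 2 * tangential 1 k (pd 1 ρ) (e (b, τ))) b := by
    intro b τ
    have h1 := hasDerivAt_tangential 1 k (contDiff_pdt hρ) (hasCompactSupport_pdt hc) b (τ + s)
    have h2 := hasDerivAt_tangential 1 k hρ hc b (τ + s)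
    simp only [hee]
    rw [pdt_pd_comm 1 hρ]
    exact h1.sub (h2.const_mul (k ^ 2))
  have hV0 : ∀ τ, 0 < τ →
      tangential 1 k (pdt ρ) (e (0, τ)) - k ^ 2 * tangential 1 k ρ (e (0, τ)) = 0 := by
    intro τ hτ
    simp only [hee]
    rw [tangential_eq_zero_of_forall 1 k fun x =>
        pdt_eq_zero_on_boundary hρ hb x (by linarith : 0 < τ + s),
      tangential_eq_zero_of_forall 1 k fun x => hb x (τ + s) (by linarith : 0 < τ + s)]
    ring
  have hρ11 := contDiff_pd 1 hρ1
  have hc11 := hasCompactSupport_pd 1 hc1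
  have hρt := contDiff_pdt hρ
  have hct := hasCompactSupport_pdt hc
  have hρ1t := contDiff_pdt hρ1
  have hc1t := hasCompactSupport_pdt hc1
  have key := integral_heatPoisson_mul (k := k) hPd (supp _ hρ1 hc1) (cont _ hρ11 hc11)
    (supp _ hρ11 hc11) (cont _ hρ1t hc1t) (supp _ hρ1t hc1t)
    ((cont _ hρt hct).sub (continuous_const.mul (cont _ hρ hc)))
    ((supp _ hρt hct).sub (supp _ hρ hc).mul_left) hV hV0
  rw [integral_heatPoisson_sub_mul hs]
  have e0 : e (0, 0) = (0, s) := by rw [hee, zero_add]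
  rw [← e0, ← key]
  congr 1; ext p
  rw [← hee, tangential_one_backwardHeat hρ hc]
  rfl

/-- The caloric part of the momentum equation for one mode. -/
lemma IsSolenoidalTest.integral_heatPoisson_mul_streamTest (hφ : IsSolenoidalTest φ) {k s : ℝ}
    (hs : 0 < s) :
    ∫ p in quadrant, Real.exp (-(k ^ 2 * (p.2 - s))) * heatPoisson p.1 (p.2 - s)
      * tangential 1 k (backwardHeat (streamTest k φ)) p
      = -tangential 1 k (backwardHeat (φ 1)) (0, s) := by
  rw [integral_heatPoisson_mul_tangential (hφ.contDiff_streamTest k)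
    (hφ.hasCompactSupport_streamTest k) (hφ.streamTest_boundary k) hs, tangential, tangential]
  congr 2; ext x
  have b1 : pdt (φ 1) (x, 0, s) = 0 := pdt_eq_zero_on_boundary (hφ.smooth 1) (hφ.boundary 1) x hs
  have b2 : pd 0 (pd 0 (φ 1)) (x, 0, s) = 0 :=
    pd_zero_eq_zero_on_boundary (contDiff_pd 0 (hφ.smooth 1))
      (fun x t ht => pd_zero_eq_zero_on_boundary (hφ.smooth 1) (hφ.boundary 1) x ht) x hs
  have hks : ContDiff ℝ ∞ (k • φ 1) := (hφ.smooth 1).const_smul k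
  rw [backwardHeat_eq, streamTest, pd_add 1 (contDiff_pd 1 (hφ.smooth 1)) hks,
    pd_const_smul 1 k (hφ.smooth 1)]
  simp [b1, b2, hφ.pd_one_boundary x s hs]

/-- The momentum equation for one mode. With `F` the transform of the backward heat operator of the
normal component, the equation for `expConv` cancels its contribution, and what is left is the pairing
of `heatPoisson` with `∂_b F + k F`, which is balanced by the potential part at the instant `s`. -/
theorem IsSolenoidalTest.modePairing_backwardHeat (hφ : IsSolenoidalTest φ) {k s : ℝ} (hk : 0 < k)
    (hs : 0 < s) :
    modePairing 0 k s (backwardHeat (φ 0)) + modePairing 1 k s (backwardHeat (φ 1)) = 0 := by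
  set F := tangential 1 k (backwardHeat (φ 1)) with hFdef
  set F' := tangential 1 k (pd 1 (backwardHeat (φ 1))) with hFdef'
  have hω := contDiff_backwardHeat (hφ.smooth 1)
  have hc := hasCompactSupport_backwardHeat (hφ.compact 1)
  have hω1 := (contDiff_pd 1 hω).continuous
  have hc1 := hasCompactSupport_pd 1 hc
  have hFc : Continuous F := continuous_tangential 1 k hω.continuous hc
  have hFc' : Continuous F' := continuous_tangential 1 k hω1 hc1
  have hFs : HasCompactSupport F := hasCompactSupport_tangential 1 k hω.continuous hc
  have hFs' : HasCompactSupport F' := hasCompactSupport_tangential 1 k hω1 hc1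
  have hd : ∀ b t, HasDerivAt (fun b => F (b, t)) (F' (b, t)) b := hasDerivAt_tangential 1 k hω hc
  have h0 : ∀ p ∈ quadrant, tangential 0 k (backwardHeat (φ 0)) p = -(k⁻¹ * F' p) := by
    intro p hp
    have := hφ.tangential_backwardHeat k hp
    rw [← mul_neg, eq_inv_mul_iff_mul_eq₀ hk.ne', this]
  have h1 := integral_modeKernel_mul_deriv hk hs hFc hFc' hFs hFs' hd
  have h2 := integral_exp_mul_deriv k (f' := fun b => F' (b, s)) (hd · s) (by fun_prop)
    (hasCompactSupport_slice hFs s) (hasCompactSupport_slice hFs' s)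
  have h3 := hφ.integral_heatPoisson_mul_streamTest (k := k) hs
  have hW : ∀ p, tangential 1 k (backwardHeat (streamTest k φ)) p = F' p + k * F p := by
    intro p
    have hks : ContDiff ℝ ∞ (k • φ 1) := (hφ.smooth 1).const_smul k
    rw [streamTest, backwardHeat_add (contDiff_pd 1 (hφ.smooth 1)) hks,
      backwardHeat_const_smul k (hφ.smooth 1), ← pd_backwardHeat 1 (hφ.smooth 1),
      tangential_add 1 k hω1 hc1 (hω.continuous.const_smul k) (hc.smul_left (f := fun _ => k)),
      tangential_const_smul]
    rfl
  have iA := integrableOn_modeKernel_mul 0 hk hs (W := fun p => k⁻¹ * F' p) (by fun_prop)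
    hFs'.mul_left
  have iB := integrableOn_modeKernel_mul 1 hk hs (W := fun p => k⁻¹ * F' p) (by fun_prop)
    hFs'.mul_left
  have iC := integrableOn_modeKernel_mul 0 hk hs hFc hFs
  have iD := integrableOn_modeKernel_mul 1 hk hs hFc hFs
  have j0 : Integrable fun b => Real.exp (-(k * b)) * F (b, s) :=
    Continuous.integrable_of_hasCompactSupport (by fun_prop)
      (hasCompactSupport_slice hFs s).mul_left
  have j1 : Integrable fun b => Real.exp (-(k * b)) * F' (b, s) :=
    Continuous.integrable_of_hasCompactSupport (by fun_prop)
      (hasCompactSupport_slice hFs' s).mul_left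
  have e3 : ∀ p : ℝ × ℝ, Real.exp (-(k ^ 2 * (p.2 - s))) * heatPoisson p.1 (p.2 - s)
      * tangential 1 k (backwardHeat (streamTest k φ)) p
      = k * ((modeKernel 1 k p.1 (p.2 - s) * (k⁻¹ * F' p)
          - modeKernel 0 k p.1 (p.2 - s) * (k⁻¹ * F' p))
        + (modeKernel 1 k p.1 (p.2 - s) * F p - modeKernel 0 k p.1 (p.2 - s) * F p)) := by
    intro p
    rw [hW, modeKernel_zero_eq]
    field_simp
    ring
  have iBA : IntegrableOn (fun p : ℝ × ℝ => modeKernel 1 k p.1 (p.2 - s) * (k⁻¹ * F' p)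
      - modeKernel 0 k p.1 (p.2 - s) * (k⁻¹ * F' p)) quadrant := iB.sub iA
  have iDC : IntegrableOn (fun p : ℝ × ℝ => modeKernel 1 k p.1 (p.2 - s) * F p
      - modeKernel 0 k p.1 (p.2 - s) * F p) quadrant := iD.sub iC
  simp_rw [e3] at h3
  rw [integral_const_mul, integral_add iBA iDC, integral_sub iB iA, integral_sub iD iC] at h3
  rw [integral_sub iB iC] at h1
  have e2 : ∀ b : ℝ, Real.exp (-(k * b)) * (F' (b, s) - k * F (b, s))
      = Real.exp (-(k * b)) * F' (b, s) - k * (Real.exp (-(k * b)) * F (b, s)) := fun b => by ring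
  simp_rw [e2] at h2
  rw [integral_sub j1.restrict (j0.restrict.const_mul _), integral_const_mul] at h2
  have a1 : ∫ p in quadrant, modeKernel 0 k p.1 (p.2 - s) * tangential 0 k (backwardHeat (φ 0)) p
      = -∫ p in quadrant, modeKernel 0 k p.1 (p.2 - s) * (k⁻¹ * F' p) := by
    rw [← integral_neg]
    refine setIntegral_congr_fun measurableSet_quadrant fun p hp => ?_
    simp only [h0 p hp]; ring
  have a2 : ∫ b in Ioi (0 : ℝ), Real.exp (-(k * b)) * tangential 0 k (backwardHeat (φ 0)) (b, s)
      = -k⁻¹ * ∫ b in Ioi (0 : ℝ), Real.exp (-(k * b)) * F' (b, s) := by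
    rw [← integral_const_mul]
    refine setIntegral_congr_fun measurableSet_Ioi fun b hb => ?_
    simp only [h0 (b, s) ⟨hb, hs⟩]; ring
  rw [modePairing, modePairing, a1, a2]
  refine mul_left_cancel₀ hk.ne' ?_
  linear_combination h3 - k * h1 - h2
    - (∫ b in Ioi (0 : ℝ), Real.exp (-(k * b)) * F' (b, s)) * mul_inv_cancel₀ hk.ne'

end Solenoidal

/-! ### Fourier inversion of the boundary datum -/

section FourierInversion

open FourierTransform

variable {f : ℝ → ℝ}

/-- The sine (`i = 0`) and cosine (`i = 1`) transforms on the line. -/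
noncomputable def trigTransform (i : Fin 2) (f : ℝ → ℝ) (k : ℝ) : ℝ := ∫ x, trig i (k * x) * f x

lemma fourier_ofReal_re_im (hf : Integrable f) (w : ℝ) :
    (𝓕 (fun x => (f x : ℂ)) w).re = trigTransform 1 f (2 * Real.pi * w) ∧
    (𝓕 (fun x => (f x : ℂ)) w).im = -trigTransform 0 f (2 * Real.pi * w) := by
  have hi : Integrable fun v => Complex.exp (↑(-2 * Real.pi * v * w) * Complex.I) • (f v : ℂ) := by
    refine hf.ofReal.bdd_mul (c := 1) (Continuous.aestronglyMeasurable (by fun_prop))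
      (ae_of_all _ fun x => ?_)
    rw [Complex.norm_exp_ofReal_mul_I]
  have hval : ∀ v, Complex.exp (↑(-2 * Real.pi * v * w) * Complex.I)
      = (Real.cos (2 * Real.pi * w * v) : ℂ) - Real.sin (2 * Real.pi * w * v) * Complex.I := by
    intro v
    rw [Complex.exp_mul_I, ← Complex.ofReal_cos, ← Complex.ofReal_sin,
      show -2 * Real.pi * v * w = -(2 * Real.pi * w * v) by ring, Real.cos_neg, Real.sin_neg]
    push_cast; ring
  rw [Real.fourier_real_eq_integral_exp_smul]
  constructor
  · have := Complex.reCLM.integral_comp_comm hi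
    simp only [Complex.reCLM_apply] at this
    rw [← this, trigTransform]
    congr 1; ext v
    rw [hval]; simp [trig, -Complex.ofReal_cos, -Complex.ofReal_sin]
  · have := Complex.imCLM.integral_comp_comm hi
    simp only [Complex.imCLM_apply] at this
    rw [← this, trigTransform, ← integral_neg]
    congr 1; ext v
    rw [hval]; simp [trig, -Complex.ofReal_cos, -Complex.ofReal_sin]

lemma integrable_fourier_ofReal (hf : ContDiff ℝ ∞ f) (hc : HasCompactSupport f) :
    Integrable (𝓕 (fun x => (f x : ℂ))) := by
  have h1 : ContDiff ℝ ∞ fun x => (f x : ℂ) := Complex.ofRealCLM.contDiff.comp hf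
  have h2 : HasCompactSupport fun x => (f x : ℂ) := hc.comp_left Complex.ofReal_zero
  exact (𝓕 (h2.toSchwartzMap h1)).integrable

lemma integrable_trigTransform (i : Fin 2) (hf : ContDiff ℝ ∞ f) (hc : HasCompactSupport f) :
    Integrable (trigTransform i f) := by
  have hF := integrable_fourier_ofReal hf hc
  have hi := hf.continuous.integrable_of_hasCompactSupport hc (μ := volume)
  have key : Integrable fun w => trigTransform i f (2 * Real.pi * w) := by
    fin_cases i
    · exact hF.im.neg.congr (ae_of_all _ fun w => by simp [(fourier_ofReal_re_im hi w).2])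
    · exact hF.re.congr (ae_of_all _ fun w => by simp [(fourier_ofReal_re_im hi w).1])
  exact (integrable_comp_mul_left_iff _ (by positivity)).1 key

/-- Fourier inversion in real form. -/
lemma eq_integral_trigTransform (hf : ContDiff ℝ ∞ f) (hc : HasCompactSupport f) (y : ℝ) :
    f y = (Real.pi⁻¹ * ∫ k in Ioi (0 : ℝ), trig 1 (k * (0 - y)) * trigTransform 1 f k)
      - Real.pi⁻¹ * ∫ k in Ioi (0 : ℝ), trig 0 (k * (0 - y)) * trigTransform 0 f k := by
  have hF := integrable_fourier_ofReal hf hc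
  have hi := hf.continuous.integrable_of_hasCompactSupport hc (μ := volume)
  have hT : ∀ i, Integrable fun k => trig i (k * (0 - y)) * trigTransform i f k := fun i =>
    (integrable_trigTransform i hf hc).bdd_mul (c := 1)
      (Continuous.aestronglyMeasurable (by fun_prop)) (ae_of_all _ fun x => abs_trig_le i _)
  set H : ℝ → ℝ := fun k => trig 1 (k * (0 - y)) * trigTransform 1 f k
    - trig 0 (k * (0 - y)) * trigTransform 0 f k with hH
  have hcont : Continuous fun x => (f x : ℂ) := Complex.continuous_ofReal.comp hf.continuous
  have h1 := congrFun (hcont.fourierInv_fourier_eq hi.ofReal hF) y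
  rw [Real.fourierInv_eq'] at h1
  have hint : Integrable fun v => Complex.exp (↑(2 * Real.pi * inner ℝ v y) * Complex.I)
      • 𝓕 (fun x => (f x : ℂ)) v := by
    refine hF.bdd_mul (c := 1) (Continuous.aestronglyMeasurable (by fun_prop))
      (ae_of_all _ fun x => ?_)
    rw [Complex.norm_exp_ofReal_mul_I]
  have h2 := Complex.reCLM.integral_comp_comm hint
  rw [h1] at h2
  simp only [Complex.reCLM_apply, Complex.ofReal_re] at h2
  have h3 : ∀ v : ℝ, (Complex.exp (↑(2 * Real.pi * inner ℝ v y) * Complex.I)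
      • 𝓕 (fun x => (f x : ℂ)) v).re = H (2 * Real.pi * v) := by
    intro v
    obtain ⟨hre, him⟩ := fourier_ofReal_re_im hi v
    have e : 2 * Real.pi * inner ℝ v y = -(2 * Real.pi * v * (0 - y)) := by
      simp; ring
    rw [smul_eq_mul, Complex.mul_re, Complex.exp_ofReal_mul_I_re, Complex.exp_ofReal_mul_I_im,
      hre, him, e, Real.cos_neg, Real.sin_neg]
    simp only [hH, trig]
    simp
  simp_rw [h3] at h2
  rw [Measure.integral_comp_mul_left H (2 * Real.pi)] at h2
  have heven : ∀ k, H |k| = H k := by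
    intro k
    rcases le_total 0 k with h | h
    · rw [abs_of_nonneg h]
    · rw [abs_of_nonpos h]
      simp [hH, trig, trigTransform, integral_neg]
  have h4 := integral_comp_abs (f := H)
  simp_rw [heven] at h4
  rw [h4, abs_of_pos (by positivity)] at h2
  rw [← h2, ← mul_sub, ← integral_sub (hT 1).integrableOn (hT 0).integrableOn, smul_eq_mul]
  have := Real.pi_pos.ne'
  simp only [hH]
  generalize (∫ k in Ioi (0 : ℝ), _ : ℝ) = I
  field_simp

/-- The modes add up to the tangential profile `χ_{(-1,1)}` of the boundary datum, tested against `f`. -/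
lemma integral_amp_mul_trigTransform (hf : ContDiff ℝ ∞ f) (hc : HasCompactSupport f) :
    ∫ k in Ioi (0 : ℝ), amp k * trigTransform 1 f k = ∫ y in Ioo (-1 : ℝ) 1, f y := by
  have h : ∀ i, IntegrableOn (fun y => Real.pi⁻¹ * ∫ k in Ioi (0 : ℝ),
      trig i (k * (0 - y)) * trigTransform i f k) (Ioo (-1 : ℝ) 1) := by
    intro i
    have hT := (integrable_trigTransform i hf hc).integrableOn (s := Ioi 0)
    refine Integrable.const_mul ?_ _
    refine (Continuous.integrableOn_Icc ?_).mono_set Ioo_subset_Icc_self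
    refine continuous_of_dominated (bound := fun k => ‖trigTransform i f k‖) ?_ ?_ hT.norm ?_
    · exact fun y => (Continuous.aestronglyMeasurable (by fun_prop)).mul hT.aestronglyMeasurable
    · refine fun y => ae_of_all _ fun k => ?_
      rw [norm_mul]
      exact mul_le_of_le_one_left (norm_nonneg _) (abs_trig_le i _)
    · exact ae_of_all _ fun k => by fun_prop
  calc ∫ k in Ioi (0 : ℝ), amp k * trigTransform 1 f k
      = (∫ k in Ioi (0 : ℝ), amp k * trig 1 (k * 0) * trigTransform 1 f k)
        - ∫ k in Ioi (0 : ℝ), amp k * trig 0 (k * 0) * trigTransform 0 f k := by simp [trig]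
    _ = ∫ y in Ioo (-1 : ℝ) 1, f y := by
      rw [← integral_Ioo_fourier 1 (integrable_trigTransform 1 hf hc).integrableOn,
        ← integral_Ioo_fourier 0 (integrable_trigTransform 0 hf hc).integrableOn,
        ← integral_sub (h 1) (h 0)]
      refine setIntegral_congr_fun measurableSet_Ioo fun y _ => ?_
      exact (eq_integral_trigTransform hf hc y).symm

end FourierInversion

/-! ### The very weak formulation -/

section WeakSolution

lemma integral_amp_mul_tangential {ψ : ℝ × ℝ × ℝ → ℝ} (hψ : ContDiff ℝ ∞ ψ)
    (hc : HasCompactSupport ψ) (p : ℝ × ℝ) :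
    ∫ k in Ioi (0 : ℝ), amp k * tangential 1 k ψ p = ∫ y in Ioo (-1 : ℝ) 1, ψ (y, p) := by
  have hf : ContDiff ℝ ∞ fun y => ψ (y, p) := hψ.comp (contDiff_prodMk_left p)
  have hfc : HasCompactSupport fun y => ψ (y, p) :=
    HasCompactSupport.intro (hc.isCompact.image continuous_fst) fun y hy => by
      by_contra h
      exact hy ⟨(y, p), subset_tsupport _ h, rfl⟩
  exact integral_amp_mul_trigTransform hf hfc

lemma datum_zero (y s : ℝ) : datum 0 y s = 0 := by simp [datum]

lemma datum_one (y s : ℝ) : datum 1 y s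
    = (Ioo (-1 : ℝ) 1 ×ˢ Ioo (1 / 2 : ℝ) 1).indicator 1 (y, s) := by
  by_cases hy : y ∈ Ioo (-1 : ℝ) 1 <;> simp [datum, indicator, mem_prod, hy, -mem_Ioo]

lemma integral_datum_mul {F : ℝ × ℝ → ℝ} (hF : Continuous F) :
    ∫ r in lateralBoundary, datum 1 r.1 r.2 * F r
      = ∫ s in Ioo (1 / 2 : ℝ) 1, ∫ y in Ioo (-1 : ℝ) 1, F (y, s) := by
  have hS : MeasurableSet (Ioo (-1 : ℝ) 1 ×ˢ Ioo (1 / 2 : ℝ) 1) :=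
    measurableSet_Ioo.prod measurableSet_Ioo
  have e : ∀ r : ℝ × ℝ, datum 1 r.1 r.2 * F r
      = (Ioo (-1 : ℝ) 1 ×ˢ Ioo (1 / 2 : ℝ) 1).indicator F r := by
    intro r
    rw [datum_one]
    by_cases h : r ∈ Ioo (-1 : ℝ) 1 ×ˢ Ioo (1 / 2 : ℝ) 1 <;> simp [indicator]
  have hsub : Ioo (-1 : ℝ) 1 ×ˢ Ioo (1 / 2 : ℝ) 1 ⊆ lateralBoundary := fun r hr => by
    have := hr.2.1
    simp only [lateralBoundary, mem_ofPred_eq]; linarith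
  have hint : IntegrableOn F (Ioo (-1 : ℝ) 1 ×ˢ Ioo (1 / 2 : ℝ) 1) := by
    refine (hF.continuousOn.integrableOn_compact
      ((isCompact_Icc (a := (-1 : ℝ)) (b := 1)).prod (isCompact_Icc (a := (1 / 2 : ℝ)) (b := 1)))
      ).mono_set (prod_mono Ioo_subset_Icc_self Ioo_subset_Icc_self)
  simp_rw [e]
  rw [setIntegral_indicator hS, inter_eq_self_of_subset_right hsub]
  unfold IntegrableOn at hint
  rw [Measure.volume_eq_prod, ← Measure.prod_restrict] at hint ⊢
  exact integral_prod_symm F hint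

/-- The momentum equation. The boundary term vanishes since the tangential datum is zero and the
normal derivative of the normal component of a solenoidal test field is zero on the boundary. -/
lemma velocity_momentum {φ : Fin 2 → ℝ × ℝ × ℝ → ℝ} (hφ : IsSolenoidalTest φ) :
    (∫ q in halfSpaceTime, ∑ i : Fin 2, velocity datum i q.1 q.2.1 q.2.2
        * (pdt (φ i) q + lap (φ i) q))
      + (∫ r in lateralBoundary, ∑ i : Fin 2, datum i r.1 r.2 * pd 1 (φ i) (r.1, 0, r.2)) = 0 := by
  have hm : MeasurableSet lateralBoundary := measurableSet_lt measurable_const measurable_snd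
  have h2 : ∫ r in lateralBoundary, ∑ i : Fin 2, datum i r.1 r.2 * pd 1 (φ i) (r.1, 0, r.2) = 0 := by
    rw [setIntegral_congr_fun (g := fun _ => (0 : ℝ)) hm fun r hr => ?_, integral_zero]
    simp [Fin.sum_univ_two, datum_zero, hφ.pd_one_boundary r.1 r.2 hr]
  have hW : ∀ i, Continuous (backwardHeat (φ i)) := fun i =>
    (contDiff_backwardHeat (hφ.smooth i)).continuous
  have hWc : ∀ i, HasCompactSupport (backwardHeat (φ i)) := fun i =>
    hasCompactSupport_backwardHeat (hφ.compact i)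
  have hi : ∀ i, IntegrableOn (fun q : ℝ × ℝ × ℝ => velocity datum i q.1 q.2.1 q.2.2
      * (pdt (φ i) q + lap (φ i) q)) halfSpaceTime := fun i =>
    integrableOn_velocity_mul i (hW i) (hWc i)
  rw [h2, add_zero, integral_finsetSum _ fun i _ => hi i]
  have e : ∀ i, ∫ q in halfSpaceTime, velocity datum i q.1 q.2.1 q.2.2
      * (pdt (φ i) q + lap (φ i) q) = _ := fun i => (integral_velocity_mul i (hW i) (hWc i)).2
  rw [Fin.sum_univ_two, e, e, ← integral_add (integral_velocity_mul 0 (hW 0) (hWc 0)).1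
    (integral_velocity_mul 1 (hW 1) (hWc 1)).1]
  refine integral_eq_zero_of_ae (ae_modeMeasure fun s hs k hk => ?_)
  simp only [Pi.zero_apply]
  rw [← mul_add, hφ.modePairing_backwardHeat hk (by linarith [hs.1]), mul_zero]

lemma velocity_divergence {ψ : ℝ × ℝ × ℝ → ℝ} (hψ : ContDiff ℝ ∞ ψ) (hc : HasCompactSupport ψ) :
    (∫ q in halfSpaceTime, ∑ i : Fin 2, velocity datum i q.1 q.2.1 q.2.2 * pd i ψ q)
      = -∫ r in lateralBoundary, datum 1 r.1 r.2 * ψ (r.1, 0, r.2) := by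
  have hW : ∀ i, Continuous (pd i ψ) := fun i => (contDiff_pd i hψ).continuous
  have hWc : ∀ i, HasCompactSupport (pd i ψ) := fun i => hasCompactSupport_pd i hc
  have i0 := integral_velocity_mul 0 (hW 0) (hWc 0)
  have i1 := integral_velocity_mul 1 (hW 1) (hWc 1)
  have hae : (fun m : ℝ × ℝ => amp m.2 * modePairing 0 m.2 m.1 (pd 0 ψ)
      + amp m.2 * modePairing 1 m.2 m.1 (pd 1 ψ)) =ᵐ[modeMeasure]
      fun m => -(amp m.2 * tangential 1 m.2 ψ (0, m.1)) :=
    ae_modeMeasure fun s hs k hk => by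
      simp only
      rw [← mul_add, modePairing_gradient hk (by linarith [hs.1]) hψ hc, mul_neg]
  have hint : Integrable (fun m : ℝ × ℝ => amp m.2 * tangential 1 m.2 ψ (0, m.1))
      ((volume.restrict (Ioo (1 / 2 : ℝ) 1)).prod (volume.restrict (Ioi (0 : ℝ)))) := by
    have := ((i0.1.add i1.1).congr hae).neg
    simpa [modeMeasure] using this
  rw [integral_finsetSum _ fun i _ => integrableOn_velocity_mul i (hW i) (hWc i),
    Fin.sum_univ_two, i0.2, i1.2, ← integral_add i0.1 i1.1, integral_congr_ae hae, integral_neg,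
    integral_datum_mul (F := fun r => ψ (r.1, 0, r.2)) (by have := hψ.continuous; fun_prop),
    modeMeasure, integral_prod _ hint]
  congr 1
  refine setIntegral_congr_fun measurableSet_Ioo fun s _ => ?_
  exact integral_amp_mul_tangential hψ hc (0, s)

theorem isVeryWeakSolution_velocity : IsVeryWeakSolution datum (velocity datum) where
  locallyIntegrable := locallyIntegrableOn_velocity
  momentum _ hφ := velocity_momentum hφ
  divergence _ hψ hc := velocity_divergence hψ hc

lemma memLp_datum (p : ℝ≥0∞) (i : Fin 2) :
    MemLp (fun r : ℝ × ℝ => datum i r.1 r.2) p (volume.restrict lateralBoundary) := by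
  fin_cases i
  · simp [datum_zero]
  · have hS : MeasurableSet (Ioo (-1 : ℝ) 1 ×ˢ Ioo (1 / 2 : ℝ) 1) :=
      measurableSet_Ioo.prod measurableSet_Ioo
    have : (fun r : ℝ × ℝ => datum 1 r.1 r.2)
        = (Ioo (-1 : ℝ) 1 ×ˢ Ioo (1 / 2 : ℝ) 1).indicator fun _ => (1 : ℝ) := by
      ext r; rw [datum_one]; rfl
    show MemLp (fun r : ℝ × ℝ => datum 1 r.1 r.2) p (volume.restrict lateralBoundary)
    rw [this]
    refine (memLp_indicator_const p hS 1 (Or.inr ?_)).restrict _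
    rw [Measure.volume_eq_prod, Measure.prod_prod]
    simp [ENNReal.mul_eq_top]

end WeakSolution

/-! ### The logarithmic frequency integral -/

lemma abs_setIntegral_le_of_abs_le {f g : ℝ → ℝ} {s : Set ℝ} (hs : MeasurableSet s)
    (hg : IntegrableOn g s) (h : ∀ x ∈ s, |f x| ≤ g x) : |∫ x in s, f x| ≤ ∫ x in s, g x :=
  norm_integral_le_of_norm_le (μ := volume.restrict s) (f := f) hg
    ((ae_restrict_iff' hs).2 (ae_of_all _ h))

lemma hasDerivAt_exp_neg_sq_mul (τ k : ℝ) : HasDerivAt (fun k : ℝ => Real.exp (-(k ^ 2 * τ)))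
    (-(2 * (k * τ * Real.exp (-(k ^ 2 * τ))))) k := by
  have h : HasDerivAt (fun k : ℝ => -(k ^ 2 * τ)) (-(2 * k * τ)) k :=
    HasDerivAt.congr_deriv ((hasDerivAt_pow 2 k).mul_const τ).neg (by push_cast; ring)
  exact h.exp.congr_deriv (by ring)

lemma setIntegral_exp_neg_sq_mul_le {τ : ℝ} (hτ : 0 < τ) :
    ∫ k in Ioi (0 : ℝ), Real.exp (-(k ^ 2 * τ)) ≤ (Real.sqrt τ)⁻¹ := by
  have h := integral_gaussian_Ioi τ
  have e : ∀ k : ℝ, -τ * k ^ 2 = -(k ^ 2 * τ) := fun k => by ring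
  simp_rw [e] at h
  rw [h, Real.sqrt_div Real.pi_pos.le, div_div, div_le_iff₀ (by positivity)]
  have h1 : Real.sqrt Real.pi ≤ 2 := by
    rw [Real.sqrt_le_left (by norm_num)]
    linarith [Real.pi_lt_four]
  have h2 := Real.sqrt_pos.2 hτ
  rw [← mul_assoc, inv_mul_cancel₀ h2.ne', one_mul]
  exact h1

lemma setIntegral_mul_exp_neg_sq_mul_le {τ : ℝ} (hτ : 0 < τ) (R : ℝ) :
    ∫ k in Ioi R, k * τ * Real.exp (-(k ^ 2 * τ)) ≤ 1 / 2 := by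
  have hd : ∀ k ∈ Ici R, HasDerivAt (fun k : ℝ => -(1 / 2) * Real.exp (-(k ^ 2 * τ)))
      (k * τ * Real.exp (-(k ^ 2 * τ))) k := by
    intro k _
    exact ((hasDerivAt_exp_neg_sq_mul τ k).const_mul (-(1 / 2) : ℝ)).congr_deriv (by ring)
  have hlim : Tendsto (fun k : ℝ => -(1 / 2) * Real.exp (-(k ^ 2 * τ))) atTop (𝓝 (-(1 / 2) * 0)) := by
    refine Tendsto.const_mul _ (Real.tendsto_exp_neg_atTop_nhds_zero.comp ?_)
    exact (tendsto_pow_atTop two_ne_zero).atTop_mul_const hτ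
  have hi : IntegrableOn (fun k : ℝ => k * τ * Real.exp (-(k ^ 2 * τ))) (Ioi R) := by
    refine (((integrable_mul_exp_neg_sq_mul hτ).const_mul τ).congr
      (ae_of_all _ fun k => ?_)).integrableOn
    simp only; ring
  rw [integral_Ioi_of_hasDerivAt_of_tendsto' hd hi hlim]
  have : Real.exp (-(R ^ 2 * τ)) ≤ 1 := Real.exp_le_one_iff.2 (by have := sq_nonneg R; nlinarith)
  linarith

/-- The frequency integral that carries the logarithm: at `x = 1` it is the Gaussian regularization
of `∫ sin² k / k dk`. -/
noncomputable def logKernel (x τ : ℝ) : ℝ :=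
  ∫ k in Ioi (0 : ℝ), Real.sinc k * Real.sin (k * x) * Real.exp (-(k ^ 2 * τ))

lemma integrableOn_logKernel (x : ℝ) {τ : ℝ} (hτ : 0 < τ) :
    IntegrableOn (fun k => Real.sinc k * Real.sin (k * x) * Real.exp (-(k ^ 2 * τ))) (Ioi 0) := by
  refine (integrable_exp_neg_sq_mul hτ).restrict.bdd_mul (c := 1)
    (Continuous.aestronglyMeasurable (by fun_prop)) (ae_of_all _ fun k => ?_)
  rw [norm_mul]
  exact mul_le_one₀ (Real.abs_sinc_le_one k) (norm_nonneg _) (Real.abs_sin_le_one _)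

lemma abs_logKernel_sub_le (x y : ℝ) {τ : ℝ} (hτ : 0 < τ) :
    |logKernel x τ - logKernel y τ| ≤ |x - y| * (Real.sqrt τ)⁻¹ := by
  rw [logKernel, logKernel, ← integral_sub (integrableOn_logKernel x hτ) (integrableOn_logKernel y hτ)]
  have hi : IntegrableOn (fun k : ℝ => |x - y| * Real.exp (-(k ^ 2 * τ))) (Ioi 0) :=
    (integrable_exp_neg_sq_mul hτ).restrict.const_mul _
  refine (abs_setIntegral_le_of_abs_le measurableSet_Ioi hi fun k hk => ?_).trans ?_
  · have hk : 0 < k := hk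
    rw [← sub_mul, ← mul_sub, abs_mul, abs_mul, Real.abs_exp]
    gcongr
    have h1 : |Real.sinc k| ≤ k⁻¹ := by
      rw [Real.sinc_of_ne_zero hk.ne', abs_div, abs_of_pos hk, div_eq_mul_inv]
      exact mul_le_of_le_one_left (by positivity) (Real.abs_sin_le_one k)
    have h2 := Real.abs_sin_sub_sin_le (k * x) (k * y)
    rw [← mul_sub, abs_mul, abs_of_pos hk] at h2
    calc _ ≤ k⁻¹ * (k * |x - y|) := by gcongr
      _ = |x - y| := by field_simp
  · rw [integral_const_mul]
    exact mul_le_mul_of_nonneg_left (setIntegral_exp_neg_sq_mul_le hτ) (abs_nonneg _)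

lemma integrableOn_exp_div {τ : ℝ} (hτ : 0 < τ) :
    IntegrableOn (fun k : ℝ => Real.exp (-(k ^ 2 * τ)) / k) (Ioi 1) := by
  refine Integrable.mono' (integrable_exp_neg_sq_mul hτ).integrableOn
    (Measurable.aestronglyMeasurable (by fun_prop)) ((ae_restrict_iff' measurableSet_Ioi).2
    (ae_of_all _ fun k hk => ?_))
  have hk : 1 < k := hk
  rw [norm_div, Real.norm_eq_abs, Real.abs_exp, Real.norm_eq_abs, abs_of_pos (by linarith)]
  exact div_le_self (Real.exp_pos _).le hk.le

/-- The exponential integral: the Gaussian cuts `∫ dk / k` off at `k ≈ τ ^ (-1/2)`. -/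
lemma abs_integral_exp_div_add_log_le {τ : ℝ} (hτ : 0 < τ) (hτ1 : τ ≤ 1) :
    |(∫ k in Ioi (1 : ℝ), Real.exp (-(k ^ 2 * τ)) / k) + Real.log τ / 2| ≤ 1 := by
  set R : ℝ := (Real.sqrt τ)⁻¹ with hR
  have hs := Real.sqrt_pos.2 hτ
  have hR1 : 1 ≤ R := (one_le_inv₀ hs).2 (Real.sqrt_le_one.2 hτ1)
  have hR0 : 0 < R := by linarith
  have hRτ : R ^ 2 * τ = 1 := by
    rw [hR, inv_pow, Real.sq_sqrt hτ.le, inv_mul_cancel₀ hτ.ne']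
  have hi := integrableOn_exp_div hτ
  have hi1 : IntegrableOn (fun k : ℝ => Real.exp (-(k ^ 2 * τ)) / k) (Ioc 1 R) :=
    hi.mono_set Ioc_subset_Ioi_self
  have hi2 : IntegrableOn (fun k : ℝ => Real.exp (-(k ^ 2 * τ)) / k) (Ioi R) :=
    hi.mono_set (Ioi_subset_Ioi hR1)
  have hinv : IntegrableOn (fun k : ℝ => k⁻¹) (Ioc 1 R) := by
    refine (ContinuousOn.integrableOn_Icc ?_).mono_set Ioc_subset_Icc_self
    exact continuousOn_inv₀.mono fun k hk => (by linarith [hk.1] : (0 : ℝ) < k).ne'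
  have hlog : ∫ k in Ioc 1 R, k⁻¹ = -(Real.log τ / 2) := by
    rw [← intervalIntegral.integral_of_le hR1, integral_inv_of_pos one_pos hR0, div_one, hR,
      Real.log_inv, Real.log_sqrt hτ.le]
  have hsplit : ∫ k in Ioi (1 : ℝ), Real.exp (-(k ^ 2 * τ)) / k
      = (∫ k in Ioc 1 R, Real.exp (-(k ^ 2 * τ)) / k)
        + ∫ k in Ioi R, Real.exp (-(k ^ 2 * τ)) / k := by
    rw [← setIntegral_union (Ioc_disjoint_Ioi le_rfl) measurableSet_Ioi hi1 hi2,
      Ioc_union_Ioi_eq_Ioi hR1]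
  have h1 : |(∫ k in Ioc 1 R, Real.exp (-(k ^ 2 * τ)) / k) - ∫ k in Ioc 1 R, k⁻¹| ≤ 1 / 2 := by
    rw [← integral_sub hi1 hinv]
    have hlin : IntegrableOn (fun k : ℝ => k * τ) (Ioc 1 R) :=
      (Continuous.integrableOn_Icc (by fun_prop)).mono_set Ioc_subset_Icc_self
    refine (abs_setIntegral_le_of_abs_le measurableSet_Ioc hlin fun k hk => ?_).trans ?_
    · have hk0 : 0 < k := by linarith [hk.1]
      have h2 : Real.exp (-(k ^ 2 * τ)) ≤ 1 := Real.exp_le_one_iff.2 (by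
        have : 0 < k ^ 2 * τ := by positivity
        linarith)
      have h3 := Real.add_one_le_exp (-(k ^ 2 * τ))
      rw [abs_sub_comm, abs_of_nonneg (by
        rw [sub_nonneg, div_eq_mul_inv]
        exact mul_le_of_le_one_left (by positivity) h2), inv_eq_one_div, ← sub_div,
        div_le_iff₀ hk0]
      nlinarith
    · rw [integral_mul_const, ← intervalIntegral.integral_of_le hR1, integral_id]
      nlinarith
  have h2 : |∫ k in Ioi R, Real.exp (-(k ^ 2 * τ)) / k| ≤ 1 / 2 := by
    have hlin : IntegrableOn (fun k : ℝ => k * τ * Real.exp (-(k ^ 2 * τ))) (Ioi R) := by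
      refine (((integrable_mul_exp_neg_sq_mul hτ).const_mul τ).congr
        (ae_of_all _ fun k => ?_)).integrableOn
      simp only; ring
    refine (abs_setIntegral_le_of_abs_le measurableSet_Ioi hlin fun k hk => ?_).trans
      (setIntegral_mul_exp_neg_sq_mul_le hτ R)
    have hk : R < k := hk
    have hk0 : 0 < k := by linarith
    rw [abs_div, Real.abs_exp, abs_of_pos hk0, div_le_iff₀ hk0]
    have : 1 ≤ k * τ * k := by
      have h3 : R ^ 2 ≤ k ^ 2 := by gcongr
      have h4 := mul_le_mul_of_nonneg_right h3 hτ.le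
      rw [hRτ] at h4
      linarith
    have := Real.exp_pos (-(k ^ 2 * τ))
    nlinarith
  rw [hsplit]
  rw [hlog] at h1
  rw [abs_le] at h1 h2 ⊢
  constructor <;> linarith

/-- The oscillating part is bounded uniformly, by an integration by parts. -/
lemma abs_integral_cos_mul_exp_div_le {τ : ℝ} (hτ : 0 < τ) (hτ1 : τ ≤ 1) :
    |∫ k in Ioi (1 : ℝ), Real.cos (2 * k) * (Real.exp (-(k ^ 2 * τ)) / k)| ≤ 2 := by
  set h' : ℝ → ℝ := fun k => -(Real.exp (-(k ^ 2 * τ)) * (2 * τ + (k ^ 2)⁻¹)) with hh'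
  have hd : ∀ k ∈ Ici (1 : ℝ), HasDerivAt
      (fun k => Real.sin (2 * k) / 2 * (Real.exp (-(k ^ 2 * τ)) / k))
      (Real.cos (2 * k) * (Real.exp (-(k ^ 2 * τ)) / k) + Real.sin (2 * k) / 2 * h' k) k := by
    intro k hk
    have hk0 : k ≠ 0 := by have : (1 : ℝ) ≤ k := hk; linarith
    have h1 : HasDerivAt (fun k => Real.sin (2 * k) / 2) (Real.cos (2 * k)) k := by
      refine ((((hasDerivAt_id k).const_mul 2).sin).div_const 2).congr_deriv ?_
      simp
    have h2 : HasDerivAt (fun k : ℝ => Real.exp (-(k ^ 2 * τ)) / k) (h' k) k := by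
      refine ((hasDerivAt_exp_neg_sq_mul τ k).div (hasDerivAt_id k) hk0).congr_deriv ?_
      simp only [hh', id]
      field_simp
      ring
    exact h1.mul h2
  have hi0 := integrableOn_exp_div hτ
  have hi1 : IntegrableOn (fun k : ℝ => Real.cos (2 * k) * (Real.exp (-(k ^ 2 * τ)) / k)) (Ioi 1) :=
    hi0.bdd_mul (c := 1) (Continuous.aestronglyMeasurable (by fun_prop))
      (ae_of_all _ fun k => Real.abs_cos_le_one _)
  have hexp : IntegrableOn (fun k : ℝ => Real.exp (-(k ^ 2 * τ))) (Ioi 0) :=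
    (integrable_exp_neg_sq_mul hτ).integrableOn
  have hg : IntegrableOn (fun k : ℝ => τ * Real.exp (-(k ^ 2 * τ)) + 1 / 2 * k ^ (-2 : ℝ)) (Ioi 1) :=
    ((hexp.mono_set (Ioi_subset_Ioi zero_le_one)).const_mul τ).add
      ((integrableOn_Ioi_rpow_of_lt (by norm_num) one_pos).const_mul _)
  have hbd : ∀ k ∈ Ioi (1 : ℝ), ‖Real.sin (2 * k) / 2 * h' k‖
      ≤ τ * Real.exp (-(k ^ 2 * τ)) + 1 / 2 * k ^ (-2 : ℝ) := by
    intro k hk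
    have hk0 : 0 < k := lt_trans one_pos hk
    have h1 : k ^ (-2 : ℝ) = (k ^ 2)⁻¹ := by
      rw [Real.rpow_neg hk0.le]; norm_cast
    have h2 : Real.exp (-(k ^ 2 * τ)) ≤ 1 := Real.exp_le_one_iff.2 (by
      have : 0 < k ^ 2 * τ := by positivity
      linarith)
    have h3 : |Real.sin (2 * k)| ≤ 1 := Real.abs_sin_le_one _
    rw [norm_mul, Real.norm_eq_abs, Real.norm_eq_abs, abs_div, abs_of_pos (two_pos : (0 : ℝ) < 2), h1, hh',
      abs_neg, abs_of_nonneg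
        (by positivity : 0 ≤ Real.exp (-(k ^ 2 * τ)) * (2 * τ + (k ^ 2)⁻¹))]
    calc _ ≤ 1 / 2 * (Real.exp (-(k ^ 2 * τ)) * (2 * τ + (k ^ 2)⁻¹)) := by gcongr
      _ = τ * Real.exp (-(k ^ 2 * τ)) + 1 / 2 * (Real.exp (-(k ^ 2 * τ)) * (k ^ 2)⁻¹) := by ring
      _ ≤ _ := by
        gcongr
        exact mul_le_of_le_one_left (by positivity) h2
  have hi2 : IntegrableOn (fun k : ℝ => Real.sin (2 * k) / 2 * h' k) (Ioi 1) :=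
    Integrable.mono' hg (Measurable.aestronglyMeasurable (by fun_prop))
      ((ae_restrict_iff' measurableSet_Ioi).2 (ae_of_all _ hbd))
  have hlim : Tendsto (fun k : ℝ => Real.sin (2 * k) / 2 * (Real.exp (-(k ^ 2 * τ)) / k)) atTop
      (𝓝 0) := by
    refine squeeze_zero_norm' (a := fun k : ℝ => k⁻¹) ?_ tendsto_inv_atTop_zero
    filter_upwards [eventually_gt_atTop 0] with k hk
    have h2 : Real.exp (-(k ^ 2 * τ)) ≤ 1 := Real.exp_le_one_iff.2 (by
      have : 0 < k ^ 2 * τ := by positivity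
      linarith)
    have h3 : |Real.sin (2 * k)| ≤ 1 := Real.abs_sin_le_one _
    rw [norm_mul, Real.norm_eq_abs, Real.norm_eq_abs, abs_div, abs_of_pos (two_pos : (0 : ℝ) < 2), abs_div,
      Real.abs_exp, abs_of_pos hk]
    calc _ ≤ (1 : ℝ) * (1 / k) := by
          gcongr
          linarith
      _ = k⁻¹ := by simp
  have hFTC := integral_Ioi_of_hasDerivAt_of_tendsto' hd (hi1.add hi2) hlim
  rw [integral_add hi1 hi2] at hFTC
  have hA : |∫ k in Ioi (1 : ℝ), Real.sin (2 * k) / 2 * h' k| ≤ 3 / 2 := by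
    refine (abs_setIntegral_le_of_abs_le measurableSet_Ioi hg hbd).trans ?_
    rw [integral_add ((hexp.mono_set (Ioi_subset_Ioi zero_le_one)).const_mul τ)
      ((integrableOn_Ioi_rpow_of_lt (by norm_num) one_pos).const_mul _), integral_const_mul,
      integral_const_mul, integral_Ioi_rpow_of_lt (by norm_num) one_pos]
    have h1 : ∫ k in Ioi (1 : ℝ), Real.exp (-(k ^ 2 * τ))
        ≤ ∫ k in Ioi (0 : ℝ), Real.exp (-(k ^ 2 * τ)) :=
      setIntegral_mono_set hexp (ae_of_all _ fun k => (Real.exp_pos _).le)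
        (Ioi_subset_Ioi zero_le_one).eventuallyLE
    have h2 := setIntegral_exp_neg_sq_mul_le hτ
    have h3 : τ * (Real.sqrt τ)⁻¹ ≤ 1 := by
      have hs := Real.sqrt_pos.2 hτ
      rw [← div_eq_mul_inv, Real.div_sqrt]
      exact Real.sqrt_le_one.2 hτ1
    have h4 := mul_le_mul_of_nonneg_left (h1.trans h2) hτ.le
    norm_num
    linarith
  have hB : |Real.sin (2 * 1) / 2 * (Real.exp (-(1 ^ 2 * τ)) / 1)| ≤ 1 / 2 := by
    have h2 : Real.exp (-(1 ^ 2 * τ)) ≤ 1 := Real.exp_le_one_iff.2 (by linarith)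
    rw [abs_mul, abs_div, abs_div, Real.abs_exp, abs_one, abs_of_pos (two_pos : (0 : ℝ) < 2), div_one]
    calc _ ≤ (1 : ℝ) / 2 * 1 := by
          gcongr
          exact Real.abs_sin_le_one _
      _ = 1 / 2 := by norm_num
  rw [abs_le] at hA hB ⊢
  constructor <;> linarith

/-- `∫₀^∞ (sin² k / k) exp(-k²τ) dk = -(log τ) / 4 + O(1)`: the mean value `1 / 2` of `sin²` turns
the integral into half an exponential integral. -/
lemma abs_logKernel_one_add_log_le {τ : ℝ} (hτ : 0 < τ) (hτ1 : τ ≤ 1) :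
    |logKernel 1 τ + Real.log τ / 4| ≤ 3 := by
  have hi := integrableOn_logKernel 1 hτ
  have hexp : ∀ k : ℝ, Real.exp (-(k ^ 2 * τ)) ≤ 1 := fun k => Real.exp_le_one_iff.2 (by
    have : 0 ≤ k ^ 2 * τ := by positivity
    linarith)
  have h0 : |∫ k in Ioc (0 : ℝ) 1, Real.sinc k * Real.sin (k * 1) * Real.exp (-(k ^ 2 * τ))| ≤ 1 := by
    have := norm_setIntegral_le_of_norm_le_const (μ := volume) (s := Ioc (0 : ℝ) 1) (C := 1)
      (f := fun k => Real.sinc k * Real.sin (k * 1) * Real.exp (-(k ^ 2 * τ))) (by simp)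
      (fun k _ => by
        rw [norm_mul, norm_mul, Real.norm_eq_abs, Real.norm_eq_abs, Real.norm_eq_abs, Real.abs_exp]
        exact mul_le_one₀ (mul_le_one₀ (Real.abs_sinc_le_one k) (abs_nonneg _)
          (Real.abs_sin_le_one _)) (Real.exp_pos _).le (hexp k))
    simpa using this
  have hi0 := integrableOn_exp_div hτ
  have hi1 : IntegrableOn (fun k : ℝ => Real.cos (2 * k) * (Real.exp (-(k ^ 2 * τ)) / k)) (Ioi 1) :=
    hi0.bdd_mul (c := 1) (Continuous.aestronglyMeasurable (by fun_prop))
      (ae_of_all _ fun k => Real.abs_cos_le_one _)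
  have h1 : ∫ k in Ioi (1 : ℝ), Real.sinc k * Real.sin (k * 1) * Real.exp (-(k ^ 2 * τ))
      = 1 / 2 * (∫ k in Ioi (1 : ℝ), Real.exp (-(k ^ 2 * τ)) / k)
        - 1 / 2 * ∫ k in Ioi (1 : ℝ), Real.cos (2 * k) * (Real.exp (-(k ^ 2 * τ)) / k) := by
    rw [← integral_const_mul, ← integral_const_mul,
      ← integral_sub (hi0.const_mul _) (hi1.const_mul _)]
    refine setIntegral_congr_fun measurableSet_Ioi fun k hk => ?_
    have hk0 : k ≠ 0 := (lt_trans one_pos hk).ne'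
    rw [Real.sinc_of_ne_zero hk0, mul_one, Real.cos_two_mul, Real.cos_sq']
    field_simp
    ring
  have hsplit : logKernel 1 τ
      = (∫ k in Ioc (0 : ℝ) 1, Real.sinc k * Real.sin (k * 1) * Real.exp (-(k ^ 2 * τ)))
        + ∫ k in Ioi (1 : ℝ), Real.sinc k * Real.sin (k * 1) * Real.exp (-(k ^ 2 * τ)) := by
    rw [← setIntegral_union (Ioc_disjoint_Ioi le_rfl) measurableSet_Ioi
      (hi.mono_set Ioc_subset_Ioi_self) (hi.mono_set (Ioi_subset_Ioi zero_le_one)),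
      Ioc_union_Ioi_eq_Ioi zero_le_one, logKernel]
  have h2 := abs_integral_exp_div_add_log_le hτ hτ1
  have h3 := abs_integral_cos_mul_exp_div_le hτ hτ1
  rw [hsplit, h1]
  rw [abs_le] at h0 h2 h3 ⊢
  constructor <;> linarith

/-! ### Growth of the tangential velocity -/

/-- One frequency integral of the tangential velocity is `-(2 / π)` times the heat kernel times the
logarithmic kernel, up to the contribution of `expConv`, which is integrable over `τ > b²` with a
bound that does not depend on `b`. -/
lemma abs_modeIntegral_add_le (x : ℝ) {b τ : ℝ} (hb : 0 < b) (hτ : 0 < τ) :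
    |(∫ k in Ioi (0 : ℝ), amp k * trig 0 (k * x) * modeKernel 0 k b τ)
      + 2 / Real.pi * heatPoisson b τ * logKernel x τ| ≤ (b ^ 2) ^ (1 : ℝ) * τ ^ (-(1 + 1) : ℝ) := by
  set r : ℝ → ℝ := fun k => Real.exp (-(k ^ 2 * τ)) * (amp k * k * Real.sin (k * x) * expConv k b τ)
    with hr
  have hbd : ∀ k ∈ Ioi (0 : ℝ), |r k| ≤ b ^ 2 * τ ^ (-(3 / 2) : ℝ) * Real.exp (-(k ^ 2 * τ)) := by
    intro k hk
    have hk : 0 < k := hk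
    have h1 : |amp k * k| ≤ 1 := by
      rw [abs_mul, abs_of_pos hk, ← le_div_iff₀ hk, one_div]
      exact abs_amp_le_inv hk
    have h2 := expConv_le hk.le hb.le hτ
    have h3 := expConv_nonneg k b τ
    rw [hr, abs_mul, abs_mul, abs_mul _ (Real.sin _), Real.abs_exp, abs_of_nonneg h3, mul_comm]
    refine mul_le_mul_of_nonneg_right ?_ (Real.exp_pos _).le
    calc |amp k * k| * |Real.sin (k * x)| * expConv k b τ
        ≤ 1 * 1 * (b ^ 2 * τ ^ (-(3 / 2) : ℝ)) := by
          gcongr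
          exact Real.abs_sin_le_one _
      _ = _ := by rw [one_mul, one_mul]
  have hg : IntegrableOn (fun k => b ^ 2 * τ ^ (-(3 / 2) : ℝ) * Real.exp (-(k ^ 2 * τ))) (Ioi 0) :=
    (integrable_exp_neg_sq_mul hτ).integrableOn.const_mul _
  have hri : IntegrableOn r (Ioi 0) := by
    refine Integrable.mono' hg (Measurable.aestronglyMeasurable ?_)
      ((ae_restrict_iff' measurableSet_Ioi).2 (ae_of_all _ hbd))
    have h1 := continuous_amp.measurable
    have h2 : Measurable fun k => expConv k b τ :=
      measurable_expConv.comp (f := fun k : ℝ => (k, b, τ)) (by fun_prop)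
    fun_prop
  have hi := integrableOn_logKernel x hτ
  have e : ∫ k in Ioi (0 : ℝ), amp k * trig 0 (k * x) * modeKernel 0 k b τ
      = -(2 / Real.pi * heatPoisson b τ) * logKernel x τ + ∫ k in Ioi (0 : ℝ), r k := by
    rw [logKernel, ← integral_const_mul, ← integral_add (hi.const_mul _) hri]
    congr 1; ext k
    simp only [hr, amp, trig, modeKernel, if_true]
    ring
  rw [e, show ∀ A B C : ℝ, -A * B + C + A * B = C by intros; ring]
  refine (abs_setIntegral_le_of_abs_le measurableSet_Ioi hg hbd).trans ?_
  rw [integral_const_mul, Real.rpow_one]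
  have h1 : τ ^ (-(1 + 1) : ℝ) = τ ^ (-(3 / 2) : ℝ) * (Real.sqrt τ)⁻¹ := by
    rw [Real.sqrt_eq_rpow, ← Real.rpow_neg hτ.le, ← Real.rpow_add hτ]; norm_num
  rw [h1, ← mul_assoc]
  exact mul_le_mul_of_nonneg_left (setIntegral_exp_neg_sq_mul_le hτ) (by positivity)

lemma integrableOn_scaled_rpow {r δ : ℝ} (hr : 0 < r) (b : ℝ) (hδ : 0 < δ) :
    IntegrableOn (fun τ : ℝ => (b ^ 2) ^ r * τ ^ (-(1 + r))) (Ioi δ) :=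
  (integrableOn_Ioi_rpow_of_lt (by linarith) hδ).const_mul _

/-- The error terms are powers of `b² / τ` times `τ⁻¹`; their integrals over `τ > δ ≥ b²` are bounded
uniformly in `b`. -/
lemma integral_scaled_rpow_le {r b δ : ℝ} (hr : 0 < r) (hb : 0 < b) (hδ : b ^ 2 ≤ δ) :
    ∫ τ in Ioi δ, (b ^ 2) ^ r * τ ^ (-(1 + r)) ≤ r⁻¹ := by
  have hb2 : 0 < b ^ 2 := by positivity
  have hδ0 : 0 < δ := by linarith
  rw [integral_const_mul, integral_Ioi_rpow_of_lt (by linarith) hδ0,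
    show -(1 + r) + 1 = -r by ring, neg_div_neg_eq, Real.rpow_neg hδ0.le]
  have h1 : (b ^ 2) ^ r ≤ δ ^ r := by gcongr
  have h2 : 0 < δ ^ r := by positivity
  rw [div_eq_mul_inv, ← mul_assoc]
  refine mul_le_of_le_one_left (by positivity) ?_
  rw [← div_eq_mul_inv, div_le_one h2]
  exact h1

lemma heatPoisson_le_scaled {b τ : ℝ} (hb : 0 < b) (hτ : 0 < τ) :
    heatPoisson b τ ≤ (b ^ 2) ^ (1 / 2 : ℝ) * τ ^ (-(1 + 1 / 2) : ℝ) := by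
  refine (heatPoisson_le hb.le hτ).trans (le_of_eq ?_)
  rw [← Real.sqrt_eq_rpow, Real.sqrt_sq hb.le]
  norm_num

lemma integrableOn_heatPoisson {b δ : ℝ} (hb : 0 < b) (hδ : 0 < δ) :
    IntegrableOn (fun τ => heatPoisson b τ) (Ioi δ) := by
  refine Integrable.mono' (integrableOn_scaled_rpow (r := 1 / 2) (by norm_num) b hδ)
    (measurable_heatPoisson.comp measurable_prodMk_left).aestronglyMeasurable
    ((ae_restrict_iff' measurableSet_Ioi).2 (ae_of_all _ fun τ hτ => ?_))
  have hτ : 0 < τ := lt_trans hδ hτ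
  rw [Real.norm_eq_abs, abs_of_nonneg (heatPoisson_nonneg hb.le τ)]
  exact heatPoisson_le_scaled hb hτ

/-- For `b² ≤ τ ≤ 1` the logarithmic kernel contributes `log τ = 2 log b + log (τ / b²)`, and the
second summand is harmless since the heat kernel lives at the scale `τ ≈ b²`. -/
lemma abs_modeIntegral_sub_le {x b τ : ℝ} (hb : 0 < b) (hx : |x - 1| ≤ b) (hbτ : b ^ 2 ≤ τ)
    (hτ1 : τ ≤ 1) :
    |(∫ k in Ioi (0 : ℝ), amp k * trig 0 (k * x) * modeKernel 0 k b τ)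
      - Real.pi⁻¹ * Real.log b * heatPoisson b τ|
      ≤ (b ^ 2) ^ (1 : ℝ) * τ ^ (-(1 + 1) : ℝ)
        + 4 * ((b ^ 2) ^ (1 / 2 : ℝ) * τ ^ (-(1 + 1 / 2) : ℝ))
        + 2 * ((b ^ 2) ^ (1 / 4 : ℝ) * τ ^ (-(1 + 1 / 4) : ℝ)) := by
  have hb2 : 0 < b ^ 2 := by positivity
  have hτ : 0 < τ := by linarith
  have hpi : Real.pi⁻¹ ≤ 1 / 3 := by
    rw [one_div]; exact inv_anti₀ (by norm_num) Real.pi_gt_three.le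
  have hpi0 : 0 < Real.pi⁻¹ := by positivity
  have h1 := abs_modeIntegral_add_le x hb hτ
  have h2 : |logKernel x τ - logKernel 1 τ| ≤ 1 := by
    refine (abs_logKernel_sub_le x 1 hτ).trans ?_
    have hs := Real.sqrt_pos.2 hτ
    rw [← div_eq_mul_inv, div_le_one hs]
    exact hx.trans (Real.le_sqrt_of_sq_le hbτ)
  have h3 := abs_logKernel_one_add_log_le hτ hτ1
  have h4 : |logKernel x τ + Real.log τ / 4| ≤ 4 := by
    rw [abs_le] at h2 h3 ⊢
    constructor <;> linarith
  have he := heatPoisson_le_scaled hb hτ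
  have he0 := heatPoisson_nonneg hb.le τ
  set e := heatPoisson b τ with hedef
  set y := τ / b ^ 2 with hy
  have hy1 : 1 ≤ y := (one_le_div hb2).2 hbτ
  have hy0 : 0 ≤ y := by linarith
  have hlog : Real.log τ = 2 * Real.log b + Real.log y := by
    rw [hy, Real.log_div hτ.ne' hb2.ne', Real.log_pow]; push_cast; ring
  have hl0 : 0 ≤ Real.log y := Real.log_nonneg hy1
  have hl1 : Real.log y ≤ 4 * y ^ (1 / 4 : ℝ) := by
    have := Real.log_le_rpow_div hy0 (ε := 1 / 4) (by norm_num)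
    linarith
  have hel : e * Real.log y ≤ 4 * ((b ^ 2) ^ (1 / 4 : ℝ) * τ ^ (-(1 + 1 / 4) : ℝ)) := by
    calc e * Real.log y
        ≤ ((b ^ 2) ^ (1 / 2 : ℝ) * τ ^ (-(1 + 1 / 2) : ℝ)) * (4 * y ^ (1 / 4 : ℝ)) := by gcongr
      _ = 4 * (((b ^ 2) ^ (1 / 2 : ℝ) * (b ^ 2) ^ (-(1 / 4) : ℝ))
          * (τ ^ (-(1 + 1 / 2) : ℝ) * τ ^ (1 / 4 : ℝ))) := by
        rw [hy, Real.div_rpow hτ.le hb2.le, Real.rpow_neg hb2.le, div_eq_mul_inv]; ring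
      _ = _ := by
        rw [← Real.rpow_add hb2, ← Real.rpow_add hτ]; norm_num
  have hdec : (∫ k in Ioi (0 : ℝ), amp k * trig 0 (k * x) * modeKernel 0 k b τ)
      - Real.pi⁻¹ * Real.log b * e
      = ((∫ k in Ioi (0 : ℝ), amp k * trig 0 (k * x) * modeKernel 0 k b τ)
        + 2 / Real.pi * e * logKernel x τ)
        - 2 * Real.pi⁻¹ * e * (logKernel x τ + Real.log τ / 4)
        + Real.pi⁻¹ / 2 * (e * Real.log y) := by
    rw [hlog, div_eq_mul_inv 2 Real.pi]; ring
  rw [hdec]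
  have h5 : |2 * Real.pi⁻¹ * e * (logKernel x τ + Real.log τ / 4)| ≤ 2 * (1 / 3) * e * 4 := by
    rw [abs_mul, abs_of_nonneg (by positivity : 0 ≤ 2 * Real.pi⁻¹ * e)]
    gcongr
  have h6 : |Real.pi⁻¹ / 2 * (e * Real.log y)| ≤ 1 / 3 / 2 * (e * Real.log y) := by
    rw [abs_of_nonneg (by positivity)]
    gcongr
  have h7 : 0 ≤ (b ^ 2) ^ (1 / 4 : ℝ) * τ ^ (-(1 + 1 / 4) : ℝ) := by positivity
  refine (abs_add_le _ _).trans ?_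
  have h8 := abs_sub ((∫ k in Ioi (0 : ℝ), amp k * trig 0 (k * x) * modeKernel 0 k b τ)
        + 2 / Real.pi * e * logKernel x τ) (2 * Real.pi⁻¹ * e * (logKernel x τ + Real.log τ / 4))
  linarith

/-- For elapsed times `τ` that reach back beyond the support of the datum, the factor `b` of the heat
kernel absorbs `log b`. -/
lemma abs_log_mul_heatPoisson_le {b τ : ℝ} (hb : 0 < b) (hb1 : b ≤ 1) (hτ : 1 / 2 ≤ τ) :
    |Real.pi⁻¹ * Real.log b * heatPoisson b τ|
      ≤ 2 * ((b ^ 2) ^ (1 / 4 : ℝ) * τ ^ (-(1 + 1 / 4) : ℝ)) := by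
  have hb2 : 0 < b ^ 2 := by positivity
  have hτ0 : 0 < τ := by linarith
  have hpi : Real.pi⁻¹ ≤ 1 / 3 := by
    rw [one_div]; exact inv_anti₀ (by norm_num) Real.pi_gt_three.le
  have h1 : |Real.log b| ≤ 2 * (b ^ 2) ^ (-(1 / 4) : ℝ) := by
    rw [abs_of_nonpos (Real.log_nonpos hb.le hb1), ← Real.log_inv]
    have := Real.log_le_rpow_div (inv_nonneg.2 hb.le) (ε := 1 / 2) (by norm_num)
    have e : (b ^ 2) ^ (-(1 / 4) : ℝ) = b⁻¹ ^ (1 / 2 : ℝ) := by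
      rw [Real.inv_rpow hb.le, ← Real.rpow_neg hb.le, ← Real.rpow_natCast b 2,
        ← Real.rpow_mul hb.le]
      norm_num
    rw [e]; linarith
  have h2 : τ ^ (-(1 + 1 / 2) : ℝ) ≤ 2 * τ ^ (-(1 + 1 / 4) : ℝ) := by
    have h3 : τ ^ (-(1 + 1 / 2) : ℝ) = τ ^ (-(1 / 4) : ℝ) * τ ^ (-(1 + 1 / 4) : ℝ) := by
      rw [← Real.rpow_add hτ0]; norm_num
    rw [h3]
    gcongr
    calc τ ^ (-(1 / 4) : ℝ) ≤ (1 / 2 : ℝ) ^ (-(1 / 4) : ℝ) :=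
          Real.rpow_le_rpow_of_nonpos (by norm_num) hτ (by norm_num)
      _ ≤ (1 / 2 : ℝ) ^ (-1 : ℝ) :=
          Real.rpow_le_rpow_of_exponent_ge (by norm_num) (by norm_num) (by norm_num)
      _ = 2 := by rw [Real.rpow_neg_one]; norm_num
  have he := heatPoisson_le_scaled hb hτ0
  have he0 := heatPoisson_nonneg hb.le τ
  rw [abs_mul, abs_mul, abs_of_nonneg he0, abs_of_pos (by positivity : 0 < Real.pi⁻¹)]
  calc Real.pi⁻¹ * |Real.log b| * heatPoisson b τ
      ≤ 1 / 3 * (2 * (b ^ 2) ^ (-(1 / 4) : ℝ))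
        * ((b ^ 2) ^ (1 / 2 : ℝ) * (2 * τ ^ (-(1 + 1 / 4) : ℝ))) := by
        gcongr
        exact he.trans (by gcongr)
    _ = 4 / 3 * (((b ^ 2) ^ (-(1 / 4) : ℝ) * (b ^ 2) ^ (1 / 2 : ℝ)) * τ ^ (-(1 + 1 / 4) : ℝ)) := by
        ring
    _ = 4 / 3 * ((b ^ 2) ^ (1 / 4 : ℝ) * τ ^ (-(1 + 1 / 4) : ℝ)) := by
        rw [← Real.rpow_add hb2]; norm_num
    _ ≤ _ := by gcongr; norm_num

/-- The logarithmic asymptotics of the tangential velocity, uniformly in a parabolic region that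
touches the boundary at the corner point `(1, 0)` of the datum at the instant when it is
switched off. -/
theorem abs_velocity_sub_log_le {x b δ : ℝ} (hb : 0 < b) (hb1 : b < 1 / 2) (hδ : b ^ 2 ≤ δ)
    (hδ2 : δ ≤ 2 * b ^ 2) (hx : |x - 1| ≤ b) :
    |velocity datum 0 x b (1 + δ)
      - Real.pi⁻¹ * (∫ τ in Ioi δ, heatPoisson b τ) * Real.log b| ≤ 17 := by
  have hb2 : 0 < b ^ 2 := by positivity
  have hδ0 : 0 < δ := by linarith
  set f : ℝ → ℝ := fun τ => ∫ k in Ioi (0 : ℝ), amp k * trig 0 (k * x) * modeKernel 0 k b τ with hf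
  have hfm : StronglyMeasurable f := by
    have : Measurable (fun p : ℝ × ℝ => amp p.2 * trig 0 (p.2 * x) * modeKernel 0 p.2 b p.1) := by
      have h1 := continuous_amp.measurable
      have h2 : Measurable fun p : ℝ × ℝ => modeKernel 0 p.2 b p.1 :=
        (measurable_modeKernel 0).comp (f := fun p : ℝ × ℝ => (p.2, b, p.1)) (by fun_prop)
      have h3 := (continuous_trig 0).measurable
      fun_prop
    exact this.stronglyMeasurable.integral_prod_right' (ν := volume.restrict (Ioi 0))
  set S := Ioo δ (δ + 1 / 2) with hS
  have hvel : velocity datum 0 x b (1 + δ) = ∫ τ in Ioi δ, S.indicator f τ := by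
    have hout : 1 + δ ∉ Ioo (1 / 2 : ℝ) 1 := fun h => by linarith [h.2]
    rw [velocity_datum_eq 0 x hb (by linarith), indicator_of_notMem hout, zero_mul, add_zero,
      setIntegral_indicator measurableSet_Ioo, inter_eq_self_of_subset_right
        (Ioo_subset_Ioi_self : Ioo δ (δ + 1 / 2) ⊆ Ioi δ), ← integral_Ioc_eq_integral_Ioo,
      ← integral_Ioc_eq_integral_Ioo, ← intervalIntegral.integral_of_le (by norm_num),
      ← intervalIntegral.integral_of_le (by linarith),
      intervalIntegral.integral_comp_sub_left (fun τ => f τ) (1 + δ)]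
    congr 1 <;> ring
  set g : ℝ → ℝ := fun τ => (b ^ 2) ^ (1 : ℝ) * τ ^ (-(1 + 1) : ℝ)
        + 4 * ((b ^ 2) ^ (1 / 2 : ℝ) * τ ^ (-(1 + 1 / 2) : ℝ))
        + 2 * ((b ^ 2) ^ (1 / 4 : ℝ) * τ ^ (-(1 + 1 / 4) : ℝ)) with hg
  have i1 := integrableOn_scaled_rpow (r := 1) (by norm_num) b hδ0
  have i2 := (integrableOn_scaled_rpow (r := 1 / 2) (by norm_num) b hδ0).const_mul 4
  have i3 := (integrableOn_scaled_rpow (r := 1 / 4) (by norm_num) b hδ0).const_mul 2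
  have hgi : IntegrableOn g (Ioi δ) := (i1.add i2).add i3
  have hbd : ∀ τ ∈ Ioi δ, |S.indicator f τ - Real.pi⁻¹ * Real.log b * heatPoisson b τ| ≤ g τ := by
    intro τ hτ
    have hτδ : δ < τ := hτ
    have hτ0 : 0 < τ := by linarith
    by_cases h : τ ∈ S
    · rw [indicator_of_mem h]
      exact abs_modeIntegral_sub_le hb hx (by linarith) (by nlinarith [h.2])
    -- the datum vanishes before `t = 1 / 2`, so the remaining `τ` are bounded away from zero
    · have hτ2 : 1 / 2 ≤ τ := by
        by_contra h'
        exact h ⟨hτδ, by linarith⟩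
      rw [indicator_of_notMem h, zero_sub, abs_neg]
      refine (abs_log_mul_heatPoisson_le hb (by linarith) hτ2).trans (le_add_of_nonneg_left ?_)
      positivity
  have hG := (integrableOn_heatPoisson hb hδ0).const_mul (Real.pi⁻¹ * Real.log b)
  have hD : IntegrableOn (fun τ => S.indicator f τ - Real.pi⁻¹ * Real.log b * heatPoisson b τ)
      (Ioi δ) :=
    Integrable.mono' hgi (((hfm.indicator measurableSet_Ioo).aestronglyMeasurable).sub
      hG.aestronglyMeasurable) ((ae_restrict_iff' measurableSet_Ioi).2 (ae_of_all _ hbd))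
  have hF : IntegrableOn (S.indicator f) (Ioi δ) :=
    (hD.add hG).congr (ae_of_all _ fun τ => by simp)
  have key := abs_setIntegral_le_of_abs_le measurableSet_Ioi hgi hbd
  rw [integral_sub hF hG, integral_const_mul, ← hvel] at key
  have e : Real.pi⁻¹ * (∫ τ in Ioi δ, heatPoisson b τ) * Real.log b
      = Real.pi⁻¹ * Real.log b * ∫ τ in Ioi δ, heatPoisson b τ := by ring
  rw [e]
  refine key.trans ?_
  have hsum : ∫ τ in Ioi δ, g τ = (∫ τ in Ioi δ, (b ^ 2) ^ (1 : ℝ) * τ ^ (-(1 + 1) : ℝ))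
      + 4 * (∫ τ in Ioi δ, (b ^ 2) ^ (1 / 2 : ℝ) * τ ^ (-(1 + 1 / 2) : ℝ))
      + 2 * ∫ τ in Ioi δ, (b ^ 2) ^ (1 / 4 : ℝ) * τ ^ (-(1 + 1 / 4) : ℝ) := by
    rw [← integral_const_mul, ← integral_const_mul, ← integral_add i1 i2]
    exact integral_add (i1.add i2) i3
  rw [hsum]
  have j1 := integral_scaled_rpow_le (r := 1) one_pos hb hδ
  have j2 := integral_scaled_rpow_le (r := 1 / 2) (by norm_num) hb hδ
  have j3 := integral_scaled_rpow_le (r := 1 / 4) (by norm_num) hb hδ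
  linarith

/-- Parabolic scaling of the heat kernel. -/
lemma integral_heatPoisson_scaling {b : ℝ} (hb : 0 < b) (c : ℝ) :
    ∫ τ in Ioi (b ^ 2 * c), heatPoisson b τ = ∫ σ in Ioi c, heatPoisson 1 σ := by
  have hb2 : 0 < b ^ 2 := by positivity
  have h := integral_comp_mul_left_Ioi (fun τ => heatPoisson b τ) c hb2
  have e : ∀ σ, heatPoisson b (b ^ 2 * σ) = (b ^ 2)⁻¹ * heatPoisson 1 σ := by
    intro σ
    have h1 : Real.sqrt (4 * Real.pi * (b ^ 2 * σ)) = b * Real.sqrt (4 * Real.pi * σ) := by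
      rw [show 4 * Real.pi * (b ^ 2 * σ) = b ^ 2 * (4 * Real.pi * σ) by ring,
        Real.sqrt_mul hb2.le, Real.sqrt_sq hb.le]
    have h2 : -b ^ 2 / (4 * (b ^ 2 * σ)) = -1 ^ 2 / (4 * σ) := by
      rw [show 4 * (b ^ 2 * σ) = b ^ 2 * (4 * σ) by ring, show -b ^ 2 = b ^ 2 * (-1 ^ 2) by ring,
        mul_div_mul_left _ _ hb2.ne']
    rw [heatPoisson, heatPoisson, h1, h2,
      show b ^ 2 * σ * (b * Real.sqrt (4 * Real.pi * σ))
        = b * (b ^ 2 * (σ * Real.sqrt (4 * Real.pi * σ))) by ring,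
      div_mul_eq_div_div b b, div_self hb.ne', one_div, mul_inv, one_div, mul_assoc]
  simp_rw [e] at h
  rw [integral_const_mul, smul_eq_mul] at h
  exact (mul_left_cancel₀ (inv_ne_zero hb2.ne') h).symm

lemma integral_heatPoisson_one_pos {c : ℝ} (hc : 0 < c) : 0 < ∫ σ in Ioi c, heatPoisson 1 σ := by
  have hpos : ∀ σ ∈ Ioi c, 0 < heatPoisson 1 σ := fun σ hσ => by
    have : 0 < σ := lt_trans hc hσ
    unfold heatPoisson; positivity
  rw [setIntegral_pos_iff_support_of_nonneg_ae (ae_of_all _ fun σ => heatPoisson_nonneg zero_le_one σ)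
    (integrableOn_heatPoisson one_pos hc)]
  have : Ioi c ⊆ Function.support (fun σ => heatPoisson 1 σ) ∩ Ioi c := fun σ hσ =>
    ⟨(hpos σ hσ).ne', hσ⟩
  refine lt_of_lt_of_le ?_ (measure_mono this)
  simp

/-- The tangential velocity is essentially unbounded: it is below every bound on an open subset of
a parabolic region attached to the point `(1, 0, 1)`. -/
theorem eLpNorm_velocity_eq_top {T : ℝ} (hT : 1 < T) :
    eLpNorm (fun q : ℝ × ℝ × ℝ => velocity datum 0 q.1 q.2.1 q.2.2) ⊤
      (volume.restrict {q : ℝ × ℝ × ℝ | 0 < q.2.1 ∧ 0 < q.2.2 ∧ q.2.2 < T}) = ⊤ := by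
  by_contra hne
  set N := eLpNorm (fun q : ℝ × ℝ × ℝ => velocity datum 0 q.1 q.2.1 q.2.2) ⊤
      (volume.restrict {q : ℝ × ℝ × ℝ | 0 < q.2.1 ∧ 0 < q.2.2 ∧ q.2.2 < T}) with hN
  have hopen : IsOpen {q : ℝ × ℝ × ℝ | 0 < q.2.1 ∧ 0 < q.2.2 ∧ q.2.2 < T} := by
    refine IsOpen.and ?_ (IsOpen.and ?_ ?_) <;> exact isOpen_lt (by fun_prop) (by fun_prop)
  have hae : ∀ᵐ q : ℝ × ℝ × ℝ, q ∈ {q : ℝ × ℝ × ℝ | 0 < q.2.1 ∧ 0 < q.2.2 ∧ q.2.2 < T} →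
      |velocity datum 0 q.1 q.2.1 q.2.2| ≤ N.toReal := by
    rw [← ae_restrict_iff' hopen.measurableSet]
    have := ae_le_eLpNormEssSup (f := fun q : ℝ × ℝ × ℝ => velocity datum 0 q.1 q.2.1 q.2.2)
      (μ := volume.restrict {q : ℝ × ℝ × ℝ | 0 < q.2.1 ∧ 0 < q.2.2 ∧ q.2.2 < T})
    filter_upwards [this] with q hq
    rw [← eLpNorm_exponent_top, ← hN] at hq
    have := ENNReal.toReal_mono hne hq
    simpa using this
  set C := Real.pi⁻¹ * ∫ σ in Ioi (2 : ℝ), heatPoisson 1 σ with hC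
  have hC0 : 0 < C := mul_pos (by positivity) (integral_heatPoisson_one_pos two_pos)
  -- below the height `β` the logarithm beats the presumed bound and the region stays in `t < T`
  obtain ⟨β, hβ0, hβ1, hβT, hβN⟩ : ∃ β : ℝ, 0 < β ∧ β < 1 / 2 ∧ 2 * β ^ 2 < T - 1 ∧
      C * Real.log β < -(N.toReal + 17) := by
    have l1 : Tendsto (fun β : ℝ => C * Real.log β) (𝓝[>] 0) atBot :=
      Real.tendsto_log_nhdsGT_zero.const_mul_atBot hC0
    have l2 : Tendsto (fun β : ℝ => 2 * β ^ 2) (𝓝[>] 0) (𝓝 0) := by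
      have : Continuous fun β : ℝ => 2 * β ^ 2 := by fun_prop
      simpa using (this.tendsto 0).mono_left nhdsWithin_le_nhds
    have l3 : ∀ᶠ β : ℝ in 𝓝[>] 0, β < 1 / 2 :=
      nhdsWithin_le_nhds (gt_mem_nhds (by norm_num))
    obtain ⟨β, h1, h2, h3, h4⟩ := (((l1.eventually (eventually_lt_atBot _)).and
      ((l2.eventually (gt_mem_nhds (sub_pos.2 hT))).and
        (l3.and self_mem_nhdsWithin)))).exists
    exact ⟨β, h4, h3, h2, h1⟩
  set W : Set (ℝ × ℝ × ℝ) := {q | 0 < q.2.1 ∧ q.2.1 < β ∧ |q.1 - 1| < q.2.1 ∧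
    q.2.1 ^ 2 < q.2.2 - 1 ∧ q.2.2 - 1 < 2 * q.2.1 ^ 2} with hW
  have hWo : IsOpen W := by
    refine IsOpen.and ?_ (IsOpen.and ?_ (IsOpen.and ?_ (IsOpen.and ?_ ?_))) <;>
      exact isOpen_lt (by fun_prop) (by fun_prop)
  have hWn : W.Nonempty := by
    refine ⟨(1, β / 2, 1 + 3 / 2 * (β / 2) ^ 2), ?_⟩
    have : 0 < (β / 2) ^ 2 := by positivity
    simp only [hW, mem_ofPred_eq, sub_self, abs_zero]
    refine ⟨by linarith, by linarith, by linarith, by linarith, by linarith⟩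
  have hWpos : 0 < volume W := hWo.measure_pos volume hWn
  have hWnull : volume W = 0 := by
    rw [measure_eq_zero_iff_ae_notMem]
    filter_upwards [hae] with q hq hqW
    obtain ⟨h0, h1, h2, h3, h4⟩ := hqW
    have hsq : q.2.1 ^ 2 ≤ β ^ 2 := by gcongr
    have hq2 := hq ⟨h0, by nlinarith, by linarith⟩
    have hv := abs_velocity_sub_log_le (x := q.1) (b := q.2.1) (δ := q.2.2 - 1) h0 (by linarith)
      h3.le h4.le h2.le
    rw [show 1 + (q.2.2 - 1) = q.2.2 by ring] at hv
    have hI : ∫ σ in Ioi (2 : ℝ), heatPoisson 1 σ ≤ ∫ τ in Ioi (q.2.2 - 1), heatPoisson q.2.1 τ := by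
      rw [← integral_heatPoisson_scaling h0 2]
      refine setIntegral_mono_set (integrableOn_heatPoisson h0 (by nlinarith))
        (ae_of_all _ fun τ => heatPoisson_nonneg h0.le τ) (Ioi_subset_Ioi ?_).eventuallyLE
      linarith
    have hlog : Real.log q.2.1 ≤ Real.log β := Real.log_le_log h0 h1.le
    have hlog0 : Real.log q.2.1 ≤ 0 := Real.log_nonpos h0.le (by linarith)
    have hpi : 0 < Real.pi⁻¹ := by positivity
    have k1 : Real.pi⁻¹ * (∫ τ in Ioi (q.2.2 - 1), heatPoisson q.2.1 τ) * Real.log q.2.1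
        ≤ C * Real.log q.2.1 :=
      mul_le_mul_of_nonpos_right (mul_le_mul_of_nonneg_left hI hpi.le) hlog0
    have k2 : C * Real.log q.2.1 ≤ C * Real.log β := mul_le_mul_of_nonneg_left hlog hC0.le
    rw [abs_le] at hv hq2
    linarith [hv.2, hq2.1]
  exact hWpos.ne' hWnull

theorem exists_log_growth : ∃ c : ℝ, 0 < c ∧ ∃ M : ℝ, ∀ x₂ ∈ Ioo (0 : ℝ) (1 / 2),
    |velocity datum 0 1 x₂ (1 + x₂ ^ 2) - c * Real.log x₂| ≤ M := by
  refine ⟨Real.pi⁻¹ * ∫ σ in Ioi (1 : ℝ), heatPoisson 1 σ,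
    mul_pos (by positivity) (integral_heatPoisson_one_pos one_pos), 17, fun b hb => ?_⟩
  have h := abs_velocity_sub_log_le (x := 1) (δ := b ^ 2) hb.1 hb.2 le_rfl
    (by nlinarith [sq_nonneg b]) (by simpa using hb.1.le)
  have e := integral_heatPoisson_scaling hb.1 1
  rw [mul_one] at e
  rwa [e] at h

end HalfPlaneStokes

theorem mainTheorem5 :
    -- the data belong to every `L^p`, `1 ≤ p ≤ ∞`, on the lateral boundary
    (∀ p : ℝ≥0∞, 1 ≤ p → ∀ i : Fin 2,
      MemLp (fun r : ℝ × ℝ => HalfPlaneStokes.datum i r.1 r.2) p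
        (volume.restrict HalfPlaneStokes.lateralBoundary)) ∧
    -- the velocity solves the Stokes system with these boundary data and zero initial data
    HalfPlaneStokes.IsVeryWeakSolution HalfPlaneStokes.datum
      (HalfPlaneStokes.velocity HalfPlaneStokes.datum) ∧
    -- logarithmic growth of the tangential component
    (∃ c : ℝ, 0 < c ∧ ∃ M : ℝ, ∀ x₂ ∈ Ioo (0 : ℝ) (1 / 2),
      |HalfPlaneStokes.velocity HalfPlaneStokes.datum 0 1 x₂ (1 + x₂ ^ 2) - c * Real.log x₂|
        ≤ M) ∧
    -- the tangential component is essentially unbounded on every time interval `(0, T)`, `T > 1`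
    (∀ T : ℝ, 1 < T →
      eLpNorm (fun q : ℝ × ℝ × ℝ =>
          HalfPlaneStokes.velocity HalfPlaneStokes.datum 0 q.1 q.2.1 q.2.2) ⊤
        (volume.restrict {q : ℝ × ℝ × ℝ | 0 < q.2.1 ∧ 0 < q.2.2 ∧ q.2.2 < T}) = ⊤) := by
  exact ⟨fun p _ i => HalfPlaneStokes.memLp_datum p i, HalfPlaneStokes.isVeryWeakSolution_velocity,
    HalfPlaneStokes.exists_log_growth, fun _ hT => HalfPlaneStokes.eLpNorm_velocity_eq_top hT⟩
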